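/- Let $d\ge 2$, let $\mathbb T^d=(\mathbb R/2\pi\mathbb Z)^d$, and for $k\in\mathbb Z^d$ let $\hat f(k)=(2\pi)^{-d}\int_{\mathbb T^d}f(x)e^{-ik\cdot x}\,dx$. For $s\ge 0$, $H^s(\mathbb T^d)$ is the space of real-valued $f\in L^2(\mathbb T^d)$ with $\|f\|_{H^s}^2=\sum_{k}(1+|k|^2)^s|\hat f(k)|^2<\infty$. For $1\le i,j\le d$ let $T_{ij}$ be a Fourier multiplier operator, $\widehat{T_{ij}f}(k)=\widehat T_{ij}(k)\hat f(k)$, with symbol $\widehat T_{ij}:\mathbb Z^d\to\mathbb C$. Assume: - (A1) $\sum_{i,j}\partial_{x_i}\partial_{x_j}T_{ij}f=0$ for every smooth real-valued $f$ on $\mathbb T^d$; - (A2) each $T_{ij}$ is bounded from real-valued $L^\infty(\mathbb T^d)$ to real-valued $BMO(\mathbb T^d)$: there is a constant $C$ such that $T_{ij}f$ is a real-valued integrable function with $\|T_{ij}f\|_{BMO}\le C\|f\|_{L^\infty}$ for every $f\in L^\infty$, where $\|g\|_{BMO}=\sup_Q\frac1{|Q|}\int_Q|g-g_Q|$ over all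 cubes $Q\subset\mathbb T^d$ and $g_Q$ is the mean of $g$ over $Q$; - (A5$_2$) there is $C_0>0$ with $|k_i\widehat T_{ij}(k)|\le C_0$ for all $1\le i,j\le d$ and all $k\in\mathbb Z^d$. Let $s>\frac d2+1$ and let $\theta_0,S\in H^s(\mathbb T^d)$ have zero mean. Consider the problem $$\partial_t\theta+u\cdot\nabla\theta=S(x),\qquad u_j=\sum_{i=1}^d\partial_{x_i}T_{ij}\theta\quad(1\le j\le d),\qquad \theta(\cdot,0)=\theta_0. \tag{$*$}$$ A pair $(\theta,u)$ is a weak solution of $(*)$ on $[0,T)\times\mathbb T^d$ if $\theta$, $u_j$ and $u_j\theta$ are integrable on $(0,T)\times\mathbb T^d$, the relation between $u$ and $\theta$ holds for a.e. $t\in(0,T)$, and $$\int_0^T\!\!\int_{\mathbb T^d}(\partial_t\varphi+u\cdot\nabla\varphi)\,\theta\,dx\,dt+\int_{\mathbb T^d}\varphi(x,0)\theta_0(x)\,dx=-\int_0^T\!\!\int_{\mathbb T^d}\varphi S\,dx\,dt$$ for every smooth real-valued $\varphi$ with compact support in $\mathbb T^d\times[0,T)$. Then there are $T>0$ and a solution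 $\theta$ of $(*)$, with velocity $u$, such that $$\theta\in L^\infty(0,T;H^s(\mathbb T^d)),$$ and this solution is unique. More precisely: $(\theta,u)$ is a weak solution on $[0,T)\times\mathbb T^d$; it is also a classical solution, that is, $\theta$ is continuously differentiable and $u$ is continuous on $[0,T]\times\mathbb T^d$, the relation between $u$ and $\theta$ holds for every $t\in[0,T]$, the equation $\partial_t\theta+u\cdot\nabla\theta=S$ holds for every $t\in[0,T]$ and a.e. $x$, and $\theta(\cdot,0)=\theta_0$ a.e.; $\int_{\mathbb T^d}\theta(x,t)\,dx=0$ for all $t\in[0,T]$; and every weak solution $(\theta',u')$ on $[0,T)\times\mathbb T^d$ with $\theta'\in L^\infty(0,T;H^s(\mathbb T^d))$ satisfies $\theta'(\cdot,t)=\theta(\cdot,t)$ a.e. on $\mathbb T^d$ for a.e. $t\in(0,T)$. -/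

import Mathlib

open MeasureTheory Set
open scoped ENNReal NNReal ContDiff

noncomputable section

namespace ActiveScalar

/-- The torus `𝕋^d = (ℝ / 2πℤ)^d`; its `volume` is Lebesgue measure, of total mass `(2π)^d`, and
its metric balls (for the sup metric) are the axis-parallel cubes. -/
abbrev Torus (d : ℕ) : Type := Fin d → AddCircle (2 * Real.pi)

instance instFactTwoPi : Fact (0 < 2 * Real.pi) := ⟨Real.two_pi_pos⟩

/-- The quotient map `ℝ^d → 𝕋^d`. -/
def proj {d : ℕ} (x : Fin d → ℝ) : Torus d := fun i => (x i : AddCircle (2 * Real.pi))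

/-- The character `e^{i k · x}`. -/
def mode {d : ℕ} (k : Fin d → ℤ) (x : Torus d) : ℂ := ∏ i, fourier (k i) (x i)

/-- Fourier coefficient `(2π)^{-d} ∫ f(x) e^{-i k · x} dx` of a real-valued function. -/
def coeff {d : ℕ} (f : Torus d → ℝ) (k : Fin d → ℤ) : ℂ :=
  (((2 * Real.pi) ^ d)⁻¹ : ℝ) * ∫ x, mode (-k) x * (f x : ℂ)

/-- `|k|²` for a frequency `k ∈ ℤ^d`. -/
def freqSq {d : ℕ} (k : Fin d → ℤ) : ℝ := ∑ i, (k i : ℝ) ^ 2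

/-- The `H^s` norm `(∑ₖ (1 + |k|²)^s |f̂(k)|²)^{1/2}`, with values in `[0, ∞]`. -/
def sobolevNorm {d : ℕ} (s : ℝ) (f : Torus d → ℝ) : ℝ≥0∞ :=
  (∑' k : Fin d → ℤ, ENNReal.ofReal ((1 + freqSq k) ^ s * ‖coeff f k‖ ^ 2)) ^ (1 / 2 : ℝ)

/-- Membership in `H^s(𝕋^d)`, `s ≥ 0`. -/
def MemSobolev {d : ℕ} (s : ℝ) (f : Torus d → ℝ) : Prop :=
  MemLp f 2 volume ∧ sobolevNorm s f < ⊤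

/-- Membership in `L^∞(0,T; H^s(𝕋^d))`. -/
def MemLinftySobolev {d : ℕ} (T s : ℝ) (θ : ℝ → Torus d → ℝ) : Prop :=
  AEStronglyMeasurable (fun p : ℝ × Torus d => θ p.1 p.2)
      ((volume.restrict (Ioo 0 T)).prod volume) ∧
    ∃ C : ℝ≥0, ∀ᵐ t ∂(volume.restrict (Ioo 0 T)),
      MemSobolev s (θ t) ∧ sobolevNorm s (θ t) ≤ C

/-- The BMO seminorm: the supremum over all cubes `Q` of the mean of `|g - g_Q|` over `Q`. -/
def bmoSeminorm {d : ℕ} (g : Torus d → ℝ) : ℝ≥0∞ :=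
  ⨆ (x : Torus d) (r : ℝ) (_ : 0 < r),
    ENNReal.ofReal (⨍ y in Metric.ball x r, |g y - ⨍ z in Metric.ball x r, g z|)

/-- `g` is the image of `f` under the Fourier multiplier operator with symbol `a`, that is
`ĝ(k) = a(k) f̂(k)` for all `k`; both functions are real-valued. -/
structure IsMultiplierImage {d : ℕ} (a : (Fin d → ℤ) → ℂ) (f g : Torus d → ℝ) : Prop where
  integrable_left : Integrable f volume
  integrable_right : Integrable g volume
  coeff_eq : ∀ k, coeff g k = a k * coeff f k

/-- The symbol `i k_j` of the derivative `∂_{x_j}`. -/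
def derivSymbol {d : ℕ} (j : Fin d) (k : Fin d → ℤ) : ℂ := Complex.I * (k j : ℂ)

/-- Smoothness of a function on the torus. -/
def IsSmooth {d : ℕ} (f : Torus d → ℝ) : Prop :=
  ContDiff ℝ ∞ (fun x : Fin d → ℝ => f (proj x))

/-! Assumptions on the operators `T_{ij}`, which are the Fourier multipliers with symbols `τ i j`. -/

/-- `∑_{i,j} ∂_i ∂_j T_{ij} f = 0` for every smooth `f`. -/
def AssumptionA1 {d : ℕ} (τ : Fin d → Fin d → (Fin d → ℤ) → ℂ) : Prop :=
  ∀ f : Torus d → ℝ, IsSmooth f →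
    IsMultiplierImage (fun k => ∑ i, ∑ j, derivSymbol i k * derivSymbol j k * τ i j k) f 0

/-- Each `T_{ij}` is bounded from (real) `L^∞(𝕋^d)` to (real) `BMO(𝕋^d)`. -/
def AssumptionA2 {d : ℕ} (τ : Fin d → Fin d → (Fin d → ℤ) → ℂ) : Prop :=
  ∀ i j, ∃ C : ℝ≥0, ∀ f : Torus d → ℝ, MemLp f ⊤ volume →
    ∃ g : Torus d → ℝ, IsMultiplierImage (τ i j) f g ∧
      bmoSeminorm g ≤ C * eLpNorm f ⊤ volume

/-- `|k_i T̂_{ij}(k)| ≤ C₀` for all `i`, `j` and `k`. -/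
def AssumptionA52 {d : ℕ} (τ : Fin d → Fin d → (Fin d → ℤ) → ℂ) : Prop :=
  ∃ C₀ : ℝ, 0 < C₀ ∧ ∀ i j k, ‖(k i : ℂ) * τ i j k‖ ≤ C₀

/-- The symbol of the operator `θ ↦ u_j = ∑_i ∂_{x_i} T_{ij} θ`. -/
def velocitySymbol {d : ℕ} (τ : Fin d → Fin d → (Fin d → ℤ) → ℂ) (j : Fin d)
    (k : Fin d → ℤ) : ℂ :=
  ∑ i, derivSymbol i k * τ i j k

/-- The constitutive law `u_j = ∑_i ∂_{x_i} T_{ij} θ`, `1 ≤ j ≤ d`, at a fixed time. -/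
def IsVelocity {d : ℕ} (τ : Fin d → Fin d → (Fin d → ℤ) → ℂ) (θ : Torus d → ℝ)
    (u : Torus d → Fin d → ℝ) : Prop :=
  ∀ j, IsMultiplierImage (velocitySymbol τ j) θ (fun x => u x j)

/-- The partial derivative `∂_{x_j} f (x)` on the torus. -/
def partialDeriv {d : ℕ} (j : Fin d) (f : Torus d → ℝ) (x : Torus d) : ℝ :=
  deriv (fun h : ℝ => f (x + Pi.single j (h : AddCircle (2 * Real.pi)))) 0

/-- Test functions: smooth functions on `[0,T) × 𝕋^d` with compact support. -/
structure IsTestFunction {d : ℕ} (T : ℝ) (φ : ℝ → Torus d → ℝ) : Prop where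
  smooth : ContDiff ℝ ∞ (fun p : ℝ × (Fin d → ℝ) => φ p.1 (proj p.2))
  support : ∃ a < T, ∀ t, a ≤ t → ∀ x, φ t x = 0

/-- `(θ, u)` is a weak solution on `[0,T) × 𝕋^d` of `∂_t θ + u · ∇θ = S`,
`u_j = ∑_i ∂_{x_i} T_{ij} θ`, `θ(·, 0) = θ₀` (with `div u = 0`). -/
structure IsWeakSolution {d : ℕ} (τ : Fin d → Fin d → (Fin d → ℤ) → ℂ) (T : ℝ)
    (S θ₀ : Torus d → ℝ) (θ : ℝ → Torus d → ℝ) (u : ℝ → Torus d → Fin d → ℝ) : Prop where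
  integrable_scalar : Integrable (fun p : ℝ × Torus d => θ p.1 p.2)
    ((volume.restrict (Ioo 0 T)).prod volume)
  integrable_velocity : ∀ j, Integrable (fun p : ℝ × Torus d => u p.1 p.2 j)
    ((volume.restrict (Ioo 0 T)).prod volume)
  integrable_flux : ∀ j, Integrable (fun p : ℝ × Torus d => u p.1 p.2 j * θ p.1 p.2)
    ((volume.restrict (Ioo 0 T)).prod volume)
  velocity : ∀ᵐ t ∂(volume.restrict (Ioo 0 T)), IsVelocity τ (θ t) (u t)
  weak_eq : ∀ φ : ℝ → Torus d → ℝ, IsTestFunction T φ →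
    (∫ t in Ioo 0 T, ∫ x,
        (deriv (fun r => φ r x) t + ∑ j, u t x j * partialDeriv j (φ t) x) * θ t x)
      + ∫ x, φ 0 x * θ₀ x
      = - ∫ t in Ioo 0 T, ∫ x, φ t x * S x

/-- `(θ, u)` is a classical solution on `[0,T] × 𝕋^d` of the same problem: `θ` is continuously
differentiable and `u` is continuous on `[0,T] × 𝕋^d`. As `S` and `θ₀` are given up to null sets,
so are the equation and the initial condition at each time. -/
structure IsClassicalSolution {d : ℕ} (τ : Fin d → Fin d → (Fin d → ℤ) → ℂ) (T : ℝ)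
    (S θ₀ : Torus d → ℝ) (θ : ℝ → Torus d → ℝ) (u : ℝ → Torus d → Fin d → ℝ) : Prop where
  contDiffOn_scalar : ContDiffOn ℝ 1 (fun p : ℝ × (Fin d → ℝ) => θ p.1 (proj p.2))
    (Icc 0 T ×ˢ univ)
  continuousOn_velocity : ContinuousOn (fun p : ℝ × Torus d => u p.1 p.2) (Icc 0 T ×ˢ univ)
  velocity : ∀ t ∈ Icc 0 T, IsVelocity τ (θ t) (u t)
  equation : ∀ t ∈ Icc 0 T, ∀ᵐ x : Torus d,
    derivWithin (fun r => θ r x) (Icc 0 T) t + ∑ j, u t x j * partialDeriv j (θ t) x = S x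
  initial : θ 0 =ᵐ[volume] θ₀

end ActiveScalar

end

noncomputable section

namespace ActiveScalar

/-! ### Weights on the frequency lattice -/

/-! The whole problem is moved to Fourier coefficients. If `θ = ∑ a(k) e^{ik·x}`, then `u_j` has
coefficients `μ_j(k) a(k)` with `μ_j = ∑_i i k_i T̂_{ij}`, and (A5₂) makes `μ_j` bounded: the
velocity is as regular as the scalar. The equation becomes `a'(k) = -∑_l c(k,l) a(k-l) a(l) + Ŝ(k)`
with `c(k,l) = ∑_j i l_j μ_j(k-l)`. The analysis uses only what `IsAdvectionKernel` records:
`|c(k,l)| ≤ M⟨l⟩` (one derivative, on the transported factor), `c(l,k) = -conj c(k,l)` (transport by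
a real divergence-free field is skew-adjoint) and `c(-k,-l) = conj c(k,l)` (real functions stay
real). Divergence-freeness comes from (A1), reality of the symbol from (A2).

A priori bound (`abs_energy_le`). In `∑ ⟨k⟩^{2s} Re(conj a(k) · (quadratic term))` skew symmetry
replaces `⟨k⟩^{2s}` by `⟨k⟩^s (⟨k⟩^s - ⟨l⟩^s)`. The difference is at most a constant times
`⟨k-l⟩(⟨k-l⟩^{s-1} + ⟨l⟩^{s-1})`, so the lost derivative is absorbed. What remains is a trilinear
sum with two `ℓ²` factors of `H^s` size and one factor `⟨m⟩|a(m)|`, which is summable because `s >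
d/2 + 1`. Truncation to a finite set `F = -F` keeps the antisymmetry, so the Galerkin systems obey
the same estimate and share a time of existence and an `H^s` bound (`exists_galerkin`).

Convergence and uniqueness (`sum_norm_sq_sub_le`). Compare in `ℓ²` two paths that satisfy the
equations for the frequencies in `F`. With `w` their difference, the quadratic terms differ by `a`
transporting `w` and `w` acting on the other path `b`. The first is antisymmetric up to frequencies
outside `F`, the second puts the derivative on `b`, which can afford it. Grönwall bounds `∑_F |w|²`
by the square of the largest `⟨k⟩^{1-s}` outside `F`, which tends to zero as `F` exhausts the
lattice. This single estimate shows that the Galerkin solutions are Cauchy and that the limit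
problem has one solution.

Return to the torus. Since `∑ ⟨k⟩|a(k)| < ∞`, the Fourier series is `C¹` in space, its products have
convolved coefficients (`series_mul_series`), and the system integrated in time becomes a pointwise
identity, because continuous functions with equal coefficients coincide (`series_sub_eq_integral`).
That gives the classical solution, and integration by parts gives the weak one. Conversely, testing
an arbitrary weak solution with `ψ(t) Re(z e^{-ik·x})` shows that its coefficients are primitives of
their weak rates (`coeff_eq_add_integral`). If it is bounded in `H^s`, they solve the same system,
and uniqueness there concludes (`ae_eq_series_of_isWeakSolution`). -/

/-- The weight `⟨k⟩ = (1 + |k|²)^{1/2}`. -/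
def bracket {d : ℕ} (k : Fin d → ℤ) : ℝ := Real.sqrt (1 + freqSq k)

section Weights

variable {d : ℕ}

lemma freqSq_nonneg (k : Fin d → ℤ) : 0 ≤ freqSq k :=
  Finset.sum_nonneg fun _ _ => sq_nonneg _

lemma bracket_sq (k : Fin d → ℤ) : bracket k ^ 2 = 1 + freqSq k :=
  Real.sq_sqrt (by linarith [freqSq_nonneg k])

lemma one_le_bracket (k : Fin d → ℤ) : 1 ≤ bracket k :=
  Real.one_le_sqrt.2 (by linarith [freqSq_nonneg k])

lemma bracket_pos (k : Fin d → ℤ) : 0 < bracket k := zero_lt_one.trans_le (one_le_bracket k)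

lemma bracket_rpow_sq (s : ℝ) (k : Fin d → ℤ) : (bracket k ^ s) ^ 2 = (1 + freqSq k) ^ s := by
  rw [← bracket_sq, ← Real.rpow_natCast, ← Real.rpow_natCast, ← Real.rpow_mul (bracket_pos k).le,
    ← Real.rpow_mul (bracket_pos k).le, mul_comm]

lemma abs_coord_le_bracket (k : Fin d → ℤ) (j : Fin d) : |(k j : ℝ)| ≤ bracket k := by
  refine Real.abs_le_sqrt ?_
  have := Finset.single_le_sum (f := fun i => (k i : ℝ) ^ 2) (fun _ _ => sq_nonneg _)
    (Finset.mem_univ j)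
  simp only [freqSq]
  linarith

/-- The vector `(1, k)`, whose Euclidean norm is `⟨k⟩`. -/
def liftFreq (a : ℝ) (k : Fin d → ℤ) : EuclideanSpace ℝ (Fin (d + 1)) :=
  WithLp.toLp 2 (Fin.cons a fun i => (k i : ℝ))

lemma norm_liftFreq (a : ℝ) (k : Fin d → ℤ) :
    ‖liftFreq a k‖ = Real.sqrt (a ^ 2 + freqSq k) := by
  simp [EuclideanSpace.norm_eq, liftFreq, Fin.sum_univ_succ, freqSq]

/-- Reverse triangle inequality for the Euclidean vectors `(1, k)` and `(1, l)`; their difference is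
`(0, k - l)`, which is why `liftFreq` has a free first entry. -/
lemma abs_bracket_sub_le (k l : Fin d → ℤ) : |bracket k - bracket l| ≤ bracket (k - l) := by
  have h1 : ∀ m : Fin d → ℤ, bracket m = ‖liftFreq 1 m‖ := fun m => by
    simp [norm_liftFreq, bracket]
  rw [h1 k, h1 l]
  refine (abs_norm_sub_norm_le _ _).trans ?_
  have : liftFreq 1 k - liftFreq 1 l = liftFreq 0 (k - l) := by
    ext i
    refine Fin.cases ?_ (fun j => ?_) i <;> simp [liftFreq]
  rw [this, norm_liftFreq]
  exact Real.sqrt_le_sqrt (by norm_num)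

lemma bracket_le_add (k l : Fin d → ℤ) : bracket k ≤ bracket (k - l) + bracket l := by
  linarith [le_abs_self (bracket k - bracket l), abs_bracket_sub_le k l]

/-- Bernoulli's inequality `(1 + z)^s ≥ 1 + s z` at `z = x/y - 1`, multiplied by `y^s`. -/
lemma rpow_sub_rpow_le {s x y : ℝ} (hs : 1 ≤ s) (hx : 0 < x) (hxy : x ≤ y) :
    y ^ s - x ^ s ≤ s * (y - x) * y ^ (s - 1) := by
  have hy : 0 < y := hx.trans_le hxy
  have h := one_add_mul_self_le_rpow_one_add (s := x / y - 1)
    (by linarith [(div_pos hx hy).le]) hs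
  have e : 1 + (x / y - 1) = x / y := by ring
  rw [e, Real.div_rpow hx.le hy.le, le_div_iff₀ (Real.rpow_pos_of_pos hy s)] at h
  have e2 : y ^ s = y * y ^ (s - 1) := by
    rw [Real.rpow_sub_one hy.ne']; field_simp
  have e3 : (1 + s * (x / y - 1)) * y ^ s = y ^ s + s * (x - y) * y ^ (s - 1) := by
    rw [e2]; field_simp
  rw [e3] at h
  linarith

/-- The commutator estimate at the level of symbols: commuting the weight of order `s` past a
multiplication gains one power of `⟨l⟩`, at the price of one power of `⟨k - l⟩`. This pays for the
derivative in the kernel. -/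
lemma abs_bracket_rpow_sub_le {s : ℝ} (hs : 1 ≤ s) (k l : Fin d → ℤ) :
    |bracket k ^ s - bracket l ^ s| ≤ s * 2 ^ s * bracket (k - l) *
      (bracket (k - l) ^ (s - 1) + bracket l ^ (s - 1)) := by
  have key : |bracket k ^ s - bracket l ^ s| ≤
      s * bracket (k - l) * (bracket (k - l) + bracket l) ^ (s - 1) := by
    have hd := abs_bracket_sub_le k l
    have hk := bracket_pos k
    have hl := bracket_pos l
    have hm := bracket_pos (k - l)
    rcases le_total (bracket k) (bracket l) with h | h
    · rw [abs_sub_comm, abs_of_nonneg (sub_nonneg.2 (Real.rpow_le_rpow hk.le h (by linarith)))]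
      refine (rpow_sub_rpow_le hs hk h).trans ?_
      rw [abs_sub_comm, abs_of_nonneg (sub_nonneg.2 h)] at hd
      gcongr
      linarith
    · rw [abs_of_nonneg (sub_nonneg.2 (Real.rpow_le_rpow hl.le h (by linarith)))]
      refine (rpow_sub_rpow_le hs hl h).trans ?_
      rw [abs_of_nonneg (sub_nonneg.2 h)] at hd
      gcongr
      exact bracket_le_add k l
  refine key.trans ?_
  have hk := bracket_pos (k - l)
  have hl := bracket_pos l
  have h2 : (bracket (k - l) + bracket l) ^ (s - 1) ≤
      2 ^ s * (bracket (k - l) ^ (s - 1) + bracket l ^ (s - 1)) := by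
    have hmax : (bracket (k - l) + bracket l) ^ (s - 1) ≤
        (2 * max (bracket (k - l)) (bracket l)) ^ (s - 1) := by
      refine Real.rpow_le_rpow (by linarith) ?_ (by linarith)
      linarith [le_max_left (bracket (k - l)) (bracket l),
        le_max_right (bracket (k - l)) (bracket l)]
    refine hmax.trans ?_
    rw [Real.mul_rpow (by norm_num) (hk.le.trans (le_max_left _ _))]
    refine mul_le_mul (Real.rpow_le_rpow_of_exponent_le (by norm_num) (by linarith)) ?_
      (Real.rpow_nonneg (hk.le.trans (le_max_left _ _)) _) (by positivity)
    · rcases le_total (bracket (k - l)) (bracket l) with h | h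
      · rw [max_eq_right h]
        linarith [Real.rpow_nonneg hk.le (s - 1)]
      · rw [max_eq_left h]
        linarith [Real.rpow_nonneg hl.le (s - 1)]
  calc s * bracket (k - l) * (bracket (k - l) + bracket l) ^ (s - 1)
      ≤ s * bracket (k - l) * (2 ^ s * (bracket (k - l) ^ (s - 1) + bracket l ^ (s - 1))) := by
        gcongr
    _ = _ := by ring

lemma norm_intCast_le_bracket (k : Fin d → ℤ) : ‖fun i => (k i : ℝ)‖ ≤ bracket k :=
  (pi_norm_le_iff_of_nonneg (bracket_pos k).le).2 fun i => abs_coord_le_bracket k i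

/-- Comparison with the sum of `‖x‖^(-p)` over the lattice `ℤ^d` in `ℝ^d`, whose rank is `d`. -/
lemma summable_bracket_rpow {p : ℝ} (hp : (d : ℝ) < p) :
    Summable fun k : Fin d → ℤ => bracket k ^ (-p) := by
  let L : Submodule ℤ (Fin d → ℝ) := Submodule.span ℤ (Set.range (Pi.basisFun ℝ (Fin d)))
  have hfin : Module.finrank ℤ L = d := by
    rw [ZLattice.rank ℝ L]; simp
  have hs := ZLattice.summable_norm_rpow L (-p) (by rw [hfin]; linarith)
  have hmem : ∀ k : Fin d → ℤ, (fun i => (k i : ℝ)) ∈ L := fun k =>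
    (Module.Basis.mem_span_iff_repr_mem ℤ (Pi.basisFun ℝ (Fin d)) _).2 fun i => ⟨k i, by simp⟩
  have hinj : Function.Injective fun k : Fin d → ℤ => (⟨fun i => (k i : ℝ), hmem k⟩ : L) := by
    intro k l h
    funext i
    have h' : (k i : ℝ) = l i := congrFun (congrArg Subtype.val h) i
    exact_mod_cast h'
  -- The comparison fails at `k = 0`, where `0 ^ (-p)` is `0` while the weight is `1`, so one
  -- frequency is set aside.
  refine Summable.of_norm_bounded_eventually (hs.comp_injective hinj) ?_
  refine (Set.finite_singleton (0 : Fin d → ℤ)).subset fun k hk => ?_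
  by_contra hk0
  refine hk ?_
  have hpos : 0 < ‖fun i => (k i : ℝ)‖ := by
    rw [norm_pos_iff]
    intro h
    refine hk0 (funext fun i => ?_)
    have h' : (k i : ℝ) = 0 := congrFun h i
    exact_mod_cast h'
  change ‖bracket k ^ (-p)‖ ≤ ‖fun i => (k i : ℝ)‖ ^ (-p)
  rw [Real.norm_of_nonneg (Real.rpow_nonneg (bracket_pos k).le _)]
  exact Real.rpow_le_rpow_of_nonpos hpos (norm_intCast_le_bracket k)
    (by have : (0 : ℝ) ≤ d := d.cast_nonneg
        linarith)

end Weights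
end ActiveScalar

namespace ActiveScalar

/-! ### Weighted `ℓ²` bounds and the basic estimates -/

open ComplexConjugate

section Estimates

variable {d : ℕ}

/-- `∑ ⟨k⟩^{2s} |a(k)|² ≤ R²`, in terms of finite partial sums. -/
def HsBound (s R : ℝ) (a : (Fin d → ℤ) → ℂ) : Prop :=
  ∀ F : Finset (Fin d → ℤ), ∑ k ∈ F, (bracket k ^ s * ‖a k‖) ^ 2 ≤ R ^ 2

/-- The symmetry of the Fourier coefficients of real-valued functions. -/
def IsRealSeq (a : (Fin d → ℤ) → ℂ) : Prop := ∀ k, a (-k) = conj (a k)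

/-- The symmetries and growth of the kernel of the quadratic term of the equation. -/
structure IsAdvectionKernel (M : ℝ) (c : (Fin d → ℤ) → (Fin d → ℤ) → ℂ) : Prop where
  nonneg : 0 ≤ M
  norm_le : ∀ k l, ‖c k l‖ ≤ M * bracket l
  antisymm : ∀ k l, c l k = -conj (c k l)
  neg : ∀ k l, c (-k) (-l) = conj (c k l)

/-- The constant of the embedding of `H^s` into the sequences with `∑ ⟨k⟩ |a(k)| < ∞`. -/
def embConst (d : ℕ) (s : ℝ) : ℝ := Real.sqrt (∑' k : Fin d → ℤ, (bracket k ^ (1 - s)) ^ 2)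

lemma embConst_nonneg (d : ℕ) (s : ℝ) : 0 ≤ embConst d s := Real.sqrt_nonneg _

/-- The threshold on `s` is exactly `2(s - 1) > d`. -/
lemma summable_bracket_one_sub_sq {s : ℝ} (hs : (d : ℝ) / 2 + 1 < s) :
    Summable fun k : Fin d → ℤ => (bracket k ^ (1 - s)) ^ 2 := by
  refine (summable_bracket_rpow (d := d) (p := 2 * (s - 1)) (by linarith)).congr fun k => ?_
  rw [← Real.rpow_natCast, ← Real.rpow_mul (bracket_pos k).le]
  congr 1
  push_cast; ring

lemma bracket_mul_eq (s : ℝ) (k : Fin d → ℤ) (x : ℝ) :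
    bracket k * x = bracket k ^ (1 - s) * (bracket k ^ s * x) := by
  rw [← mul_assoc, ← Real.rpow_add (bracket_pos k)]
  simp

namespace HsBound

variable {s R : ℝ} {a b : (Fin d → ℤ) → ℂ}

lemma mono {R' : ℝ} (h : HsBound s R a) (hR : 0 ≤ R) (hR' : R ≤ R') : HsBound s R' a := fun F =>
  (h F).trans (by gcongr)

lemma weight_le (h : HsBound s R a) (hR : 0 ≤ R) (k : Fin d → ℤ) : bracket k ^ s * ‖a k‖ ≤ R := by
  have := h {k}
  rw [Finset.sum_singleton] at this
  exact abs_le_of_sq_le_sq' this hR |>.2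

lemma norm_le (h : HsBound s R a) (hR : 0 ≤ R) (k : Fin d → ℤ) :
    ‖a k‖ ≤ R * bracket k ^ (-s) := by
  rw [Real.rpow_neg (bracket_pos k).le, ← div_eq_mul_inv,
    le_div_iff₀ (Real.rpow_pos_of_pos (bracket_pos k) s), mul_comm]
  exact h.weight_le hR k

/-- Cauchy–Schwarz on `⟨k⟩^{1-s} · ⟨k⟩^s |a(k)|`. The first factor is kept as a sum over `F`: on
far-away `F` it is small independently of `a`, which later gives convergence uniform in time. -/
lemma sum_bracket_le_sqrt (h : HsBound s R a) (hR : 0 ≤ R) (F : Finset (Fin d → ℤ)) :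
    ∑ k ∈ F, bracket k * ‖a k‖ ≤ Real.sqrt (∑ k ∈ F, (bracket k ^ (1 - s)) ^ 2) * R := by
  simp_rw [fun k => bracket_mul_eq s k ‖a k‖]
  refine (Real.sum_mul_le_sqrt_mul_sqrt F _ _).trans ?_
  gcongr
  exact Real.sqrt_le_iff.2 ⟨hR, h F⟩

lemma sum_bracket_le (h : HsBound s R a) (hs : (d : ℝ) / 2 + 1 < s) (hR : 0 ≤ R)
    (F : Finset (Fin d → ℤ)) : ∑ k ∈ F, bracket k * ‖a k‖ ≤ embConst d s * R := by
  refine (h.sum_bracket_le_sqrt hR F).trans ?_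
  gcongr
  exact Real.sqrt_le_sqrt ((summable_bracket_one_sub_sq hs).sum_le_tsum F fun _ _ => sq_nonneg _)

lemma summable_bracket (h : HsBound s R a) (hs : (d : ℝ) / 2 + 1 < s) (hR : 0 ≤ R) :
    Summable fun k => bracket k * ‖a k‖ :=
  summable_of_sum_le (fun k => mul_nonneg (bracket_pos k).le (norm_nonneg _))
    (h.sum_bracket_le hs hR)

lemma summable_norm (h : HsBound s R a) (hs : (d : ℝ) / 2 + 1 < s) (hR : 0 ≤ R) :
    Summable fun k => ‖a k‖ :=
  Summable.of_nonneg_of_le (fun _ => norm_nonneg _)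
    (fun k => le_mul_of_one_le_left (norm_nonneg _) (one_le_bracket k))
    (h.summable_bracket hs hR)

lemma sub (ha : HsBound s R a) (hb : HsBound s R b) : HsBound s (2 * R) (a - b) := fun F => by
  have : ∀ k ∈ F, (bracket k ^ s * ‖(a - b) k‖) ^ 2 ≤
      2 * (bracket k ^ s * ‖a k‖) ^ 2 + 2 * (bracket k ^ s * ‖b k‖) ^ 2 := fun k _ => by
    have h1 : bracket k ^ s * ‖(a - b) k‖ ≤ bracket k ^ s * ‖a k‖ + bracket k ^ s * ‖b k‖ := by
      rw [← mul_add]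
      exact mul_le_mul_of_nonneg_left (norm_sub_le _ _) (Real.rpow_nonneg (bracket_pos k).le _)
    have h0 : 0 ≤ bracket k ^ s * ‖(a - b) k‖ :=
      mul_nonneg (Real.rpow_nonneg (bracket_pos k).le _) (norm_nonneg _)
    nlinarith [sq_nonneg (bracket k ^ s * ‖a k‖ - bracket k ^ s * ‖b k‖)]
  refine (Finset.sum_le_sum this).trans ?_
  rw [Finset.sum_add_distrib, ← Finset.mul_sum, ← Finset.mul_sum]
  linarith [ha F, hb F]

end HsBound

/-! ### Young-type inequalities on the lattice, and antisymmetry -/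

lemma sum_sub_le_of_forall_sum_le {f : (Fin d → ℤ) → ℝ} {A : ℝ} (hA : ∀ F, ∑ k ∈ F, f k ≤ A)
    (F : Finset (Fin d → ℤ)) (l : Fin d → ℤ) : ∑ k ∈ F, f (k - l) ≤ A := by
  have := hA (F.map (Equiv.subRight l).toEmbedding)
  rwa [Finset.sum_map] at this

lemma sum_sub_le_of_forall_sum_le' {f : (Fin d → ℤ) → ℝ} {A : ℝ} (hA : ∀ F, ∑ k ∈ F, f k ≤ A)
    (F : Finset (Fin d → ℤ)) (k : Fin d → ℤ) : ∑ l ∈ F, f (k - l) ≤ A := by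
  have := hA (F.map (Equiv.subLeft k).toEmbedding)
  rwa [Finset.sum_map] at this

/-- Young's inequality, with the `ℓ¹` factor at `k - l`. -/
lemma trilinear_le {f g h : (Fin d → ℤ) → ℝ} {A : ℝ} (hf : ∀ k, 0 ≤ f k)
    (hA : ∀ F, ∑ k ∈ F, f k ≤ A) (F G : Finset (Fin d → ℤ)) :
    ∑ k ∈ F, ∑ l ∈ G, f (k - l) * g l * h k ≤
      A / 2 * (∑ l ∈ G, g l ^ 2 + ∑ k ∈ F, h k ^ 2) := by
  -- Split `g h ≤ (g² + h²)/2`; in each half, sum first over the index that occurs only in `f`.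
  have h1 : ∀ k ∈ F, ∀ l ∈ G, f (k - l) * g l * h k ≤
      f (k - l) * (g l ^ 2 / 2) + f (k - l) * (h k ^ 2 / 2) := fun k _ l _ => by
    rw [mul_assoc, ← mul_add]
    exact mul_le_mul_of_nonneg_left (by nlinarith [sq_nonneg (g l - h k)]) (hf _)
  refine (Finset.sum_le_sum fun k hk => Finset.sum_le_sum (h1 k hk)).trans ?_
  simp_rw [Finset.sum_add_distrib]
  rw [Finset.sum_comm, mul_add]
  simp_rw [← Finset.sum_mul]
  rw [Finset.mul_sum, Finset.mul_sum]
  refine add_le_add (Finset.sum_le_sum fun l _ => ?_) (Finset.sum_le_sum fun k _ => ?_)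
  · have := mul_le_mul_of_nonneg_right (sum_sub_le_of_forall_sum_le hA F l) (sq_nonneg (g l))
    linarith
  · have := mul_le_mul_of_nonneg_right (sum_sub_le_of_forall_sum_le' hA G k) (sq_nonneg (h k))
    linarith

/-- Young's inequality, with the `ℓ¹` factor at `l`. -/
lemma trilinear_le' {f g h : (Fin d → ℤ) → ℝ} {A Φ : ℝ} (hf : ∀ k, 0 ≤ f k)
    (hA : ∀ F, ∑ k ∈ F, f k ≤ A) (hg : ∀ F, ∑ k ∈ F, g k ^ 2 ≤ Φ) (F G : Finset (Fin d → ℤ)) :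
    ∑ k ∈ F, ∑ l ∈ G, g (k - l) * f l * h k ≤ A / 2 * (Φ + ∑ k ∈ F, h k ^ 2) := by
  have hΦ : 0 ≤ Φ := by simpa using hg ∅
  have h1 : ∀ k ∈ F, ∀ l ∈ G, g (k - l) * f l * h k ≤
      f l * (g (k - l) ^ 2 / 2 + h k ^ 2 / 2) := fun k _ l _ => by
    rw [mul_comm (g _), mul_assoc]
    exact mul_le_mul_of_nonneg_left (by nlinarith [sq_nonneg (g (k - l) - h k)]) (hf _)
  refine (Finset.sum_le_sum fun k hk => Finset.sum_le_sum (h1 k hk)).trans ?_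
  rw [Finset.sum_comm]
  simp_rw [← Finset.mul_sum, Finset.sum_add_distrib, ← Finset.sum_div]
  have h2 : ∀ l ∈ G, f l * ((∑ k ∈ F, g (k - l) ^ 2) / 2 + (∑ k ∈ F, h k ^ 2) / 2) ≤
      f l * ((Φ + ∑ k ∈ F, h k ^ 2) / 2) := fun l _ => by
    refine mul_le_mul_of_nonneg_left ?_ (hf l)
    have := sum_sub_le_of_forall_sum_le hg F l
    linarith
  refine (Finset.sum_le_sum h2).trans ?_
  rw [← Finset.sum_mul]
  have h3 : 0 ≤ (Φ + ∑ k ∈ F, h k ^ 2) / 2 := by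
    have := Finset.sum_nonneg fun k (_ : k ∈ F) => sq_nonneg (h k)
    linarith
  have := mul_le_mul_of_nonneg_right (hA G) h3
  linarith

lemma sum_antisymm_eq_zero {F : Finset (Fin d → ℤ)} {Q : (Fin d → ℤ) → (Fin d → ℤ) → ℝ}
    (hQ : ∀ k l, Q l k = -Q k l) : ∑ k ∈ F, ∑ l ∈ F, Q k l = 0 := by
  have h : ∑ k ∈ F, ∑ l ∈ F, Q k l = -∑ k ∈ F, ∑ l ∈ F, Q k l := by
    conv_lhs => rw [Finset.sum_comm]
    simp_rw [← Finset.sum_neg_distrib]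
    exact Finset.sum_congr rfl fun k _ => Finset.sum_congr rfl fun l _ => hQ k l
  linarith

/-- Skew-adjointness of transport. Only the transporting sequence `a` has to be real; `w` is
arbitrary. -/
lemma re_kernel_antisymm {M : ℝ} {c : (Fin d → ℤ) → (Fin d → ℤ) → ℂ} (hc : IsAdvectionKernel M c)
    {a w : (Fin d → ℤ) → ℂ} (ha : IsRealSeq a) (k l : Fin d → ℤ) :
    (c l k * a (l - k) * w k * conj (w l)).re = -(c k l * a (k - l) * w l * conj (w k)).re := by
  have h : c l k * a (l - k) * w k * conj (w l) =
      -conj (c k l * a (k - l) * w l * conj (w k)) := by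
    rw [hc.antisymm k l, ← neg_sub k l, ha (k - l)]
    simp only [map_mul, Complex.conj_conj]
    ring
  rw [h, Complex.neg_re, Complex.conj_re]

/-- The `H^s` energy estimate for the (truncated) quadratic term. -/
lemma abs_energy_le {s M R : ℝ} {c : (Fin d → ℤ) → (Fin d → ℤ) → ℂ} (hc : IsAdvectionKernel M c)
    (hs : (d : ℝ) / 2 + 1 < s) (hR : 0 ≤ R) {a : (Fin d → ℤ) → ℂ} (ha : IsRealSeq a)
    (hb : HsBound s R a) (F : Finset (Fin d → ℤ)) :
    |∑ k ∈ F, (bracket k ^ s) ^ 2 * (conj (a k) * ∑ l ∈ F, c k l * a (k - l) * a l).re| ≤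
      2 * s * 2 ^ s * M * embConst d s * R ^ 3 := by
  have hs1 : 1 ≤ s := by have : (0 : ℝ) ≤ d := d.cast_nonneg
                         linarith
  have hM := hc.nonneg
  set Q : (Fin d → ℤ) → (Fin d → ℤ) → ℝ := fun k l => (c k l * a (k - l) * a l * conj (a k)).re
  have hQ : ∀ k l, Q l k = -Q k l := fun k l => re_kernel_antisymm hc ha k l
  have hWpos : ∀ k : Fin d → ℤ, 0 < bracket k ^ s := fun k => Real.rpow_pos_of_pos (bracket_pos k) s
  -- A symmetric weight times an antisymmetric quantity sums to zero. Subtracting this sum turns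
  -- `⟨k⟩^{2s}` into `⟨k⟩^s (⟨k⟩^s - ⟨l⟩^s)`.
  have hzero : ∑ k ∈ F, ∑ l ∈ F, bracket k ^ s * bracket l ^ s * Q k l = 0 :=
    sum_antisymm_eq_zero fun k l => by rw [hQ]; ring
  have e1 : ∑ k ∈ F, (bracket k ^ s) ^ 2 * (conj (a k) * ∑ l ∈ F, c k l * a (k - l) * a l).re =
      ∑ k ∈ F, ∑ l ∈ F, bracket k ^ s * (bracket k ^ s - bracket l ^ s) * Q k l := by
    rw [← sub_zero (∑ k ∈ F, _), ← hzero, ← Finset.sum_sub_distrib]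
    refine Finset.sum_congr rfl fun k _ => ?_
    rw [Finset.mul_sum, Complex.re_sum, Finset.mul_sum, ← Finset.sum_sub_distrib]
    refine Finset.sum_congr rfl fun l _ => ?_
    rw [mul_comm (conj (a k))]
    ring
  rw [e1]
  refine (Finset.abs_sum_le_sum_abs _ _).trans
    ((Finset.sum_le_sum fun k _ => Finset.abs_sum_le_sum_abs _ _).trans ?_)
  set H : (Fin d → ℤ) → ℝ := fun k => bracket k ^ s * ‖a k‖
  set E : (Fin d → ℤ) → ℝ := fun k => bracket k * ‖a k‖
  have hE0 : ∀ k, 0 ≤ E k := fun k => mul_nonneg (bracket_pos k).le (norm_nonneg _)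
  -- The kernel's `⟨l⟩` completes `⟨l⟩^{s-1}` to `⟨l⟩^s`, and `⟨k-l⟩` completes `⟨k-l⟩^{s-1}`. In
  -- each summand one factor is of type `E`, bounded in `ℓ¹`, and two are of type `H`, bounded in
  -- `ℓ²`.
  have hterm : ∀ k ∈ F, ∀ l ∈ F, |bracket k ^ s * (bracket k ^ s - bracket l ^ s) * Q k l| ≤
      s * 2 ^ s * M * (H (k - l) * E l * H k + E (k - l) * H l * H k) := fun k _ l _ => by
    have hq : |Q k l| ≤ M * bracket l * ‖a (k - l)‖ * ‖a l‖ * ‖a k‖ := by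
      refine (Complex.abs_re_le_norm _).trans ?_
      rw [norm_mul, norm_mul, norm_mul, RCLike.norm_conj]
      gcongr
      exact hc.norm_le k l
    rw [abs_mul, abs_mul, abs_of_pos (hWpos k)]
    have hm := bracket_pos (k - l)
    have hl := bracket_pos l
    calc bracket k ^ s * |bracket k ^ s - bracket l ^ s| * |Q k l|
        ≤ bracket k ^ s * (s * 2 ^ s * bracket (k - l) *
            (bracket (k - l) ^ (s - 1) + bracket l ^ (s - 1))) *
            (M * bracket l * ‖a (k - l)‖ * ‖a l‖ * ‖a k‖) := by
          gcongr
          · have := hWpos k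
            have := abs_bracket_rpow_sub_le hs1 k l
            positivity
          · exact (hWpos k).le
          · exact abs_bracket_rpow_sub_le hs1 k l
      _ = _ := by
          simp only [H, E]
          rw [Real.rpow_sub_one hm.ne', Real.rpow_sub_one hl.ne']
          field_simp
  refine (Finset.sum_le_sum fun k hk => Finset.sum_le_sum (hterm k hk)).trans ?_
  simp_rw [← Finset.mul_sum, Finset.sum_add_distrib]
  have hEs := hb.sum_bracket_le hs hR
  have h1 := trilinear_le' (h := H) hE0 hEs hb F F
  have h2 := trilinear_le (g := H) (h := H) hE0 hEs F F
  have h3 : ∑ k ∈ F, H k ^ 2 ≤ R ^ 2 := hb F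
  have hA : 0 ≤ embConst d s * R := mul_nonneg (embConst_nonneg d s) hR
  have h4 : embConst d s * R / 2 * (R ^ 2 + ∑ k ∈ F, H k ^ 2) ≤ embConst d s * R ^ 3 := by
    nlinarith
  have h5 : embConst d s * R / 2 * (∑ k ∈ F, H k ^ 2 + ∑ k ∈ F, H k ^ 2) ≤
      embConst d s * R ^ 3 := by
    nlinarith
  have h6 : 0 ≤ s * 2 ^ s * M := by positivity
  calc _ ≤ s * 2 ^ s * M * (embConst d s * R ^ 3 + embConst d s * R ^ 3) := by
        refine mul_le_mul_of_nonneg_left ?_ h6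
        linarith
    _ = _ := by ring

end Estimates
end ActiveScalar

namespace ActiveScalar

/-! ### Fourier–Galerkin approximations -/

open ComplexConjugate

section Galerkin

variable {d : ℕ}

/-- Extension by zero of a sequence defined on a finite set of frequencies. -/
def extendZero (F : Finset (Fin d → ℤ)) (a : F → ℂ) (k : Fin d → ℤ) : ℂ :=
  if h : k ∈ F then a ⟨k, h⟩ else 0

/-- The real part, on the Fourier side, of a finitely supported sequence. -/
def realPart (F : Finset (Fin d → ℤ)) (a : F → ℂ) (k : Fin d → ℤ) : ℂ :=
  (extendZero F a k + conj (extendZero F a (-k))) / 2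

/-- The quadratic part of the Galerkin system. -/
def galerkinQuad (c : (Fin d → ℤ) → (Fin d → ℤ) → ℂ) (F : Finset (Fin d → ℤ)) (a : F → ℂ)
    (k : Fin d → ℤ) : ℂ :=
  ∑ l ∈ F, c k l * realPart F a (k - l) * realPart F a l

/-- The weighted energy `∑ ⟨k⟩^{2s} |a(k)|²`. -/
def energy (s : ℝ) (F : Finset (Fin d → ℤ)) (a : F → ℂ) : ℝ :=
  ∑ k : F, (bracket (k : Fin d → ℤ) ^ s * ‖a k‖) ^ 2

lemma isRealSeq_realPart (F : Finset (Fin d → ℤ)) (a : F → ℂ) : IsRealSeq (realPart F a) :=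
  fun k => by
    rw [realPart, realPart, map_div₀, map_add, neg_neg, Complex.conj_conj, map_ofNat, add_comm]

/-- Valid for every `a`, real or not, because the quadratic part is evaluated on `realPart F a`. So
the defect `a(-k) - conj a(k)` has zero derivative along the Galerkin flow, and reality propagates
without a uniqueness argument. -/
lemma galerkinQuad_neg {M : ℝ} {c : (Fin d → ℤ) → (Fin d → ℤ) → ℂ} (hc : IsAdvectionKernel M c)
    {F : Finset (Fin d → ℤ)} (hF : ∀ k ∈ F, -k ∈ F) (a : F → ℂ) (k : Fin d → ℤ) :
    galerkinQuad c F a (-k) = conj (galerkinQuad c F a k) := by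
  rw [galerkinQuad, galerkinQuad, map_sum]
  refine Finset.sum_bij' (fun l _ => -l) (fun l _ => -l) hF hF (by simp) (by simp) fun l _ => ?_
  have h1 := hc.neg k (-l)
  have h2 := isRealSeq_realPart F a (k - -l)
  have h3 := isRealSeq_realPart F a (-l)
  rw [neg_neg] at h1 h3
  rw [show -k - l = -(k - -l) by abel, h1, h2, h3, map_mul, map_mul]

lemma contDiff_extendZero (F : Finset (Fin d → ℤ)) (k : Fin d → ℤ) :
    ContDiff ℝ 1 fun a : F → ℂ => extendZero F a k := by
  unfold extendZero
  by_cases h : k ∈ F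
  · simp only [h, dif_pos]
    exact contDiff_apply ℝ ℂ _
  · simp only [h, dif_neg, not_false_eq_true]
    exact contDiff_const

lemma contDiff_realPart (F : Finset (Fin d → ℤ)) (k : Fin d → ℤ) :
    ContDiff ℝ 1 fun a : F → ℂ => realPart F a k := by
  unfold realPart
  exact ((contDiff_extendZero F k).add
    (Complex.conjCLE.contDiff.comp (contDiff_extendZero F (-k)))).div_const 2

lemma contDiff_galerkinQuad (c : (Fin d → ℤ) → (Fin d → ℤ) → ℂ) (F : Finset (Fin d → ℤ))
    (k : Fin d → ℤ) : ContDiff ℝ 1 fun a : F → ℂ => galerkinQuad c F a k :=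
  ContDiff.sum fun l _ => (contDiff_const.mul (contDiff_realPart F _)).mul (contDiff_realPart F l)

lemma contDiff_energy (s : ℝ) (F : Finset (Fin d → ℤ)) :
    ContDiff ℝ 1 fun a : F → ℂ => energy s F a := by
  unfold energy
  simp_rw [mul_pow]
  exact ContDiff.sum fun k _ => contDiff_const.mul ((contDiff_apply ℝ ℂ k).norm_sq ℝ)

lemma norm_sq_le_energy {s : ℝ} (hs : 0 ≤ s) (F : Finset (Fin d → ℤ)) (a : F → ℂ) (k : F) :
    ‖a k‖ ^ 2 ≤ energy s F a := by
  refine le_trans ?_ (Finset.single_le_sum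
    (f := fun k : F => (bracket (k : Fin d → ℤ) ^ s * ‖a k‖) ^ 2) (fun _ _ => sq_nonneg _)
    (Finset.mem_univ k))
  gcongr
  exact le_mul_of_one_le_left (norm_nonneg _) (Real.one_le_rpow (one_le_bracket _) hs)

/-- Global solvability of the Galerkin system with a cut-off quadratic part. -/
lemma exists_cutoff_galerkin (c : (Fin d → ℤ) → (Fin d → ℤ) → ℂ) {s : ℝ} (hs : 0 ≤ s)
    (F : Finset (Fin d → ℤ)) (η : ContDiffBump (0 : ℝ)) (a₀ S : F → ℂ) {T : ℝ} (hT : 0 ≤ T) :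
    ∃ α : ℝ → F → ℂ, α 0 = a₀ ∧ ∀ t ∈ Icc 0 T, HasDerivWithinAt α
      (fun k => -(η (energy s F (α t)) • galerkinQuad c F (α t) k) + S k) (Icc 0 T) t := by
  set N : (F → ℂ) → F → ℂ := fun a k => -(η (energy s F a) • galerkinQuad c F a k)
  have hN : ContDiff ℝ 1 N := contDiff_pi.2 fun k =>
    ((η.contDiff.comp (contDiff_energy s F)).smul (contDiff_galerkinQuad c F k)).neg
  -- The energy dominates every `|a(k)|²`, so the cutoff vanishes outside a ball. A compactly
  -- supported `C¹` field is bounded and globally Lipschitz.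
  have hsupp : HasCompactSupport N := by
    refine HasCompactSupport.intro (K := Metric.closedBall 0 (η.rOut + 1))
      (isCompact_closedBall _ _) fun a ha => ?_
    have : η.rOut ≤ energy s F a := by
      by_contra! hlt
      refine ha (mem_closedBall_zero_iff.2 ((pi_norm_le_iff_of_nonneg
        (by linarith [η.rOut_pos])).2 fun k => ?_))
      have h1 := norm_sq_le_energy hs F a k
      have := η.rOut_pos
      nlinarith [norm_nonneg (a k)]
    funext k
    have h0 : η (energy s F a) = 0 := η.zero_of_le_dist (by
      rw [Real.dist_eq, sub_zero]; exact this.trans (le_abs_self _))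
    simp [N, h0]
  obtain ⟨K, hK⟩ := ContDiff.lipschitzWith_of_hasCompactSupport hsupp hN one_ne_zero
  obtain ⟨B, hB⟩ := hsupp.exists_bound_of_continuous hN.continuous
  have hB0 : 0 ≤ B := (norm_nonneg _).trans (hB 0)
  set L : ℝ≥0 := ⟨B + ‖S‖, by positivity⟩
  -- The field is bounded by `L` everywhere, so the radius `L * T` is admissible and one application
  -- covers all of `[0,T]`.
  have hPL : IsPicardLindelof (fun _ a => N a + S) (⟨0, le_rfl, hT⟩ : Icc 0 T) a₀
      (L * ⟨T, hT⟩) 0 L K := by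
    refine ⟨fun t _ x _ y _ => ?_, fun x _ => continuousOn_const, fun t _ x _ => ?_, ?_⟩
    · rw [edist_add_right]
      exact hK x y
    · exact (norm_add_le _ _).trans (add_le_add (hB x) le_rfl)
    · simp only [sub_zero, sub_self, max_eq_left hT, NNReal.coe_zero]
      exact le_rfl
  obtain ⟨α, h0, hα⟩ := hPL.exists_eq_forall_mem_Icc_hasDerivWithinAt₀
  exact ⟨α, h0, fun t ht => hα t ht⟩

end Galerkin
end ActiveScalar

/-! ### Uniform bounds for the Galerkin solutions -/

namespace ActiveScalar

open ComplexConjugate Filter Topology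

section UniformBound

variable {d : ℕ}

lemma HasDerivWithinAt.Ici_of_Icc {E : Type*} [NormedAddCommGroup E] [NormedSpace ℝ E]
    {f : ℝ → E} {f' : E} {T t : ℝ} (h : HasDerivWithinAt f f' (Icc 0 T) t) (ht : t ∈ Ico 0 T) :
    HasDerivWithinAt f f' (Ici t) t :=
  h.mono_of_mem_nhdsWithin (mem_of_superset (Icc_mem_nhdsGE ht.2) (Icc_subset_Icc_left ht.1))

lemma le_gronwallBound_of_hasDerivWithinAt {f f' : ℝ → ℝ} {δ K ε T : ℝ}
    (hf : ∀ t ∈ Icc 0 T, HasDerivWithinAt f (f' t) (Icc 0 T) t) (h0 : f 0 ≤ δ)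
    (bound : ∀ t ∈ Icc 0 T, f' t ≤ K * f t + ε) : ∀ t ∈ Icc 0 T, f t ≤ gronwallBound δ K ε t := by
  have := le_gronwallBound_of_liminf_deriv_right_le (f := f) (f' := f') (δ := δ) (K := K) (ε := ε)
    (a := 0) (b := T) (fun t ht => (hf t ht).continuousWithinAt)
    (fun t ht r hr => (HasDerivWithinAt.Ici_of_Icc
      (hf t (Ico_subset_Icc_self ht)) ht).liminf_right_slope_le hr) h0
    (fun t ht => bound t (Ico_subset_Icc_self ht))
  simpa using this

lemma HasDerivWithinAt.norm_sq_complex {f : ℝ → ℂ} {f' : ℂ} {u : Set ℝ} {t : ℝ}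
    (h : HasDerivWithinAt f f' u t) :
    HasDerivWithinAt (fun r => ‖f r‖ ^ 2) (2 * (conj (f t) * f').re) u t := by
  have := h.norm_sq
  convert this using 2
  simp [Complex.inner]
  ring

/-- The Galerkin solutions exist and obey an `H^s` bound on a common time interval. -/
theorem exists_galerkin {M s : ℝ} {c : (Fin d → ℤ) → (Fin d → ℤ) → ℂ} (hc : IsAdvectionKernel M c)
    (hs : (d : ℝ) / 2 + 1 < s) {a₀ S : (Fin d → ℤ) → ℂ} (ha₀ : IsRealSeq a₀) (hS : IsRealSeq S)
    {R₀ : ℝ} (hR₀ : 0 ≤ R₀) (hab : HsBound s R₀ a₀) (hSb : HsBound s R₀ S) :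
    ∃ T > 0, ∃ R ≥ 0, ∀ F : Finset (Fin d → ℤ), (∀ k ∈ F, -k ∈ F) → ∃ A : ℝ → (Fin d → ℤ) → ℂ,
      (∀ t, ∀ k ∉ F, A t k = 0) ∧ (∀ k ∈ F, A 0 k = a₀ k) ∧ ∀ t ∈ Icc 0 T, IsRealSeq (A t) ∧
        HsBound s R (A t) ∧ ∀ k ∈ F, HasDerivWithinAt (fun r => A r k)
          (-(∑ l ∈ F, c k l * A t (k - l) * A t l) + S k) (Icc 0 T) t := by
  have hs0 : 0 ≤ s := by have : (0 : ℝ) ≤ d := d.cast_nonneg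
                         linarith
  set R : ℝ := R₀ + 1 with hRdef
  have hR : 0 < R := by positivity
  set C : ℝ := 2 * s * 2 ^ s * M * embConst d s * (R + 1) ^ 3 with hC
  have hM := hc.nonneg
  have hCnn : 0 ≤ C := by have := embConst_nonneg d s
                          positivity
  -- `2 * C` bounds the quadratic term; `R₀ ^ 2`, together with the energy itself, bounds the source
  -- through `2 Re(conj a S) ≤ |a|² + |S|²`.
  set ε : ℝ := 2 * C + R₀ ^ 2 with hε
  let η : ContDiffBump (0 : ℝ) := ⟨R ^ 2, R ^ 2 + 1, by positivity, by linarith⟩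
  -- The Grönwall bound is continuous and starts at `R₀² < (R₀ + 1)²`. The resulting time does not
  -- depend on the set of frequencies.
  obtain ⟨T, hT, hTb⟩ : ∃ T > 0, gronwallBound (R₀ ^ 2) 1 ε T ≤ R ^ 2 := by
    have hcont : Continuous (gronwallBound (R₀ ^ 2) 1 ε) :=
      continuous_iff_continuousAt.2 fun x => (hasDerivAt_gronwallBound _ _ _ x).continuousAt
    have h0 : gronwallBound (R₀ ^ 2) 1 ε 0 < R ^ 2 := by
      rw [gronwallBound_x0]
      nlinarith
    have hev : ∀ᶠ x in 𝓝[>] (0 : ℝ), gronwallBound (R₀ ^ 2) 1 ε x < R ^ 2 :=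
      (hcont.tendsto 0).eventually_lt_const h0 |>.filter_mono nhdsWithin_le_nhds
    obtain ⟨T, h1, h2⟩ := (hev.and self_mem_nhdsWithin).exists
    exact ⟨T, h2, h1.le⟩
  refine ⟨T, hT, R, hR.le, fun F hF => ?_⟩
  obtain ⟨α, h0, hα⟩ := exists_cutoff_galerkin c hs0 F η (fun k => a₀ k) (fun k => S k) hT.le
  set A : ℝ → (Fin d → ℤ) → ℂ := fun t => extendZero F (α t) with hA
  have hAnot : ∀ t, ∀ k ∉ F, A t k = 0 := fun t k hk => by simp [hA, extendZero, hk]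
  have hAmem : ∀ t k (hk : k ∈ F), A t k = α t ⟨k, hk⟩ := fun t k hk => by
    simp [hA, extendZero, hk]
  have hA0 : ∀ k ∈ F, A 0 k = a₀ k := fun k hk => by rw [hAmem 0 k hk, h0]
  set y : ℝ → ℝ := fun t => energy s F (α t) with hy
  have hderiv : ∀ t ∈ Icc 0 T, ∀ k ∈ F, HasDerivWithinAt (fun r => A r k)
      (-(η (y t) • galerkinQuad c F (α t) k) + S k) (Icc 0 T) t := fun t ht k hk => by
    have := hasDerivWithinAt_pi.1 (hα t ht) ⟨k, hk⟩
    refine this.congr (fun r _ => hAmem r k hk) (hAmem t k hk)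
  have hreal : ∀ t ∈ Icc 0 T, IsRealSeq (A t) := by
    intro t ht k
    by_cases hk : k ∈ F
    · have hnk := hF k hk
      have hd : ∀ r ∈ Icc 0 T,
          -- The reality defect is constant in time, and it vanishes at time zero.
          HasDerivWithinAt (fun r => A r (-k) - conj (A r k)) 0 (Icc 0 T) r := fun r hr => by
        have h1 := hderiv r hr (-k) hnk
        have h2 := (Complex.conjCLE : ℂ →L[ℝ] ℂ).hasFDerivAt.comp_hasDerivWithinAt r
          (hderiv r hr k hk)
        refine (h1.sub h2).congr_deriv ?_
        simp [galerkinQuad_neg hc hF, hS k]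
      have := constant_of_has_deriv_right_zero (fun r hr => (hd r hr).continuousWithinAt)
        (fun r hr => HasDerivWithinAt.Ici_of_Icc (hd r (Ico_subset_Icc_self hr)) hr) t ht
      rw [hA0 k hk, hA0 (-k) hnk, ha₀ k, sub_self] at this
      exact sub_eq_zero.1 this
    · have hnk : -k ∉ F := fun h => hk (by simpa using hF _ h)
      rw [hAnot t k hk, hAnot t _ hnk, map_zero]
  have hquad : ∀ t ∈ Icc 0 T, ∀ k,
      galerkinQuad c F (α t) k = ∑ l ∈ F, c k l * A t (k - l) * A t l := fun t ht k => by
    have : realPart F (α t) = A t := by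
      funext m
      have := hreal t ht m
      simp only [hA] at this
      rw [realPart, this, Complex.conj_conj, add_self_div_two]
    rw [galerkinQuad, this]
  have hysum : ∀ t, y t = ∑ k ∈ F, (bracket k ^ s * ‖A t k‖) ^ 2 := fun t => by
    rw [← Finset.sum_coe_sort F]
    exact Finset.sum_congr rfl fun k _ => by rw [hAmem t k k.2]
  have hbd : ∀ t, ∀ r, y t ≤ r ^ 2 → HsBound s r (A t) := fun t r h G => by
    refine le_trans ?_ (hysum t ▸ h)
    rw [← Finset.sum_filter_add_sum_filter_not G (· ∈ F)]
    have h1 : ∑ k ∈ G with k ∉ F, (bracket k ^ s * ‖A t k‖) ^ 2 = 0 :=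
      Finset.sum_eq_zero fun k hk => by rw [hAnot t k (Finset.mem_filter.1 hk).2]; simp
    rw [h1, add_zero]
    exact Finset.sum_le_sum_of_subset_of_nonneg (fun k hk => (Finset.mem_filter.1 hk).2)
      fun _ _ _ => sq_nonneg _
  have hyderiv : ∀ t ∈ Icc 0 T, HasDerivWithinAt y (∑ k ∈ F, (bracket k ^ s) ^ 2 *
      (2 * (conj (A t k) * (-(η (y t) • galerkinQuad c F (α t) k) + S k)).re)) (Icc 0 T) t :=
    fun t ht => by
      have : y = fun t => ∑ k ∈ F, (bracket k ^ s) ^ 2 * ‖A t k‖ ^ 2 := by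
        funext t
        simp_rw [hysum, mul_pow]
      rw [this]
      refine HasDerivWithinAt.fun_sum fun k hk => ?_
      exact (HasDerivWithinAt.norm_sq_complex (this ▸ hderiv t ht k hk)).const_mul _
  have hybound : ∀ t ∈ Icc 0 T, ∑ k ∈ F, (bracket k ^ s) ^ 2 *
      (2 * (conj (A t k) * (-(η (y t) • galerkinQuad c F (α t) k) + S k)).re) ≤
      1 * y t + ε := fun t ht => by
    have hsplit : ∑ k ∈ F, (bracket k ^ s) ^ 2 *
        (2 * (conj (A t k) * (-(η (y t) • galerkinQuad c F (α t) k) + S k)).re) =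
        -(2 * η (y t) * ∑ k ∈ F, (bracket k ^ s) ^ 2 *
          (conj (A t k) * ∑ l ∈ F, c k l * A t (k - l) * A t l).re) +
        ∑ k ∈ F, 2 * (bracket k ^ s) ^ 2 * (conj (A t k) * S k).re := by
      rw [Finset.mul_sum, ← Finset.sum_neg_distrib, ← Finset.sum_add_distrib]
      refine Finset.sum_congr rfl fun k _ => ?_
      rw [hquad t ht, mul_add, Complex.add_re, mul_neg, Complex.neg_re, mul_smul_comm,
        Complex.real_smul, Complex.re_ofReal_mul]
      ring
    rw [hsplit]
    have hfirst : -(2 * η (y t) * ∑ k ∈ F, (bracket k ^ s) ^ 2 *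
          (conj (A t k) * ∑ l ∈ F, c k l * A t (k - l) * A t l).re) ≤ 2 * C := by
      by_cases hη : η (y t) = 0
      · rw [hη]; simpa using hCnn
      · have hlt : y t < R ^ 2 + 1 := by
          by_contra! h
          refine hη (η.zero_of_le_dist ?_)
          rw [Real.dist_eq, sub_zero]
          exact h.trans (le_abs_self _)
        -- Where the cutoff is nonzero the energy is below `R² + 1 ≤ (R + 1)²`, hence the radius `R
        -- + 1` in `C`.
        have hE := abs_energy_le hc hs (by positivity) (hreal t ht)
          (hbd t (R + 1) (by nlinarith)) F
        rw [← hC] at hE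
        set X := ∑ k ∈ F, (bracket k ^ s) ^ 2 *
          (conj (A t k) * ∑ l ∈ F, c k l * A t (k - l) * A t l).re
        have h1 : η (y t) ≤ 1 := η.le_one
        have h2 : 0 ≤ η (y t) := η.nonneg
        have h3 := neg_abs_le X
        have h4 : η (y t) * |X| ≤ 1 * C := mul_le_mul h1 hE (abs_nonneg _) zero_le_one
        nlinarith
    have hsecond : ∑ k ∈ F, 2 * (bracket k ^ s) ^ 2 * (conj (A t k) * S k).re ≤
        y t + R₀ ^ 2 := by
      refine le_trans ?_ (add_le_add le_rfl (hSb F))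
      rw [hysum, ← Finset.sum_add_distrib]
      refine Finset.sum_le_sum fun k _ => ?_
      have h1 : (conj (A t k) * S k).re ≤ ‖A t k‖ * ‖S k‖ := by
        refine (Complex.re_le_norm _).trans ?_
        rw [norm_mul, RCLike.norm_conj]
      have h2 : 0 ≤ (bracket k ^ s) ^ 2 := sq_nonneg _
      nlinarith [mul_le_mul_of_nonneg_left h1 h2,
        mul_nonneg h2 (sq_nonneg (‖A t k‖ - ‖S k‖))]
    linarith
  have hy0 : y 0 ≤ R₀ ^ 2 := by
    rw [hysum]
    refine le_trans (le_of_eq (Finset.sum_congr rfl fun k hk => ?_)) (hab F)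
    rw [hA0 k hk]
  have hyR : ∀ t ∈ Icc 0 T, y t ≤ R ^ 2 := fun t ht =>
    (le_gronwallBound_of_hasDerivWithinAt hyderiv hy0 hybound t ht).trans
      ((gronwallBound_mono (sq_nonneg _) (by positivity) zero_le_one ht.2).trans hTb)
  refine ⟨A, hAnot, hA0, fun t ht => ⟨hreal t ht, hbd t R (hyR t ht), fun k hk => ?_⟩⟩
  -- On `[0,T]` the energy stays in the region where the cutoff equals one, so the original Galerkin
  -- system is solved.
  have hη : η (y t) = 1 := by
    refine η.one_of_mem_closedBall ?_
    rw [mem_closedBall_zero_iff, Real.norm_eq_abs, abs_of_nonneg]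
    · exact hyR t ht
    · exact Finset.sum_nonneg fun _ _ => sq_nonneg _
  have := hderiv t ht k hk
  rwa [hη, one_smul, hquad t ht] at this

end UniformBound
end ActiveScalar

namespace ActiveScalar

/-! ### The equation on the Fourier side: stability and uniqueness -/

open ComplexConjugate Filter Topology

section Stability

variable {d : ℕ}

/-- The quadratic term of the equation on the Fourier side. -/
def advect (c : (Fin d → ℤ) → (Fin d → ℤ) → ℂ) (a b : (Fin d → ℤ) → ℂ) (k : Fin d → ℤ) : ℂ :=
  ∑' l, c k l * a (k - l) * b l

/-- A summable majorant of the terms of `advect`. -/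
def advectMajorant (s M R : ℝ) (k l : Fin d → ℤ) : ℝ :=
  M * R ^ 2 * ((bracket l ^ (1 - s)) ^ 2 + (bracket (k - l) ^ (1 - s)) ^ 2)

lemma summable_advectMajorant {s : ℝ} (hs : (d : ℝ) / 2 + 1 < s) (M R : ℝ) (k : Fin d → ℤ) :
    Summable (advectMajorant s M R k) := by
  have h := summable_bracket_one_sub_sq (d := d) hs
  exact (h.add ((Equiv.subLeft k).summable_iff.2 h)).mul_left _

variable {s M R : ℝ} {c : (Fin d → ℤ) → (Fin d → ℤ) → ℂ}

/-- Pointwise decay `|a(k)| ≤ R⟨k⟩^{-s}` and `xy ≤ x² + y²` suffice. The majorant depends on the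
sequences only through `R`, so it serves for dominated convergence along paths and limits. -/
lemma norm_advect_term_le (hc : IsAdvectionKernel M c) (hR : 0 ≤ R) {a b : (Fin d → ℤ) → ℂ}
    (ha : HsBound s R a) (hb : HsBound s R b) (k l : Fin d → ℤ) :
    ‖c k l * a (k - l) * b l‖ ≤ advectMajorant s M R k l := by
  have hM := hc.nonneg
  rw [norm_mul, norm_mul, advectMajorant]
  have h1 := ha.norm_le hR (k - l)
  have h2 := hb.norm_le hR l
  have hl := bracket_pos l
  have hm := bracket_pos (k - l)
  calc ‖c k l‖ * ‖a (k - l)‖ * ‖b l‖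
      ≤ M * bracket l * (R * bracket (k - l) ^ (-s)) * (R * bracket l ^ (-s)) := by
        gcongr
        exact hc.norm_le k l
    _ = M * R ^ 2 * (bracket l ^ (1 - s) * bracket (k - l) ^ (-s)) := by
        rw [show (1 : ℝ) - s = 1 + -s by ring, Real.rpow_add hl, Real.rpow_one]
        ring
    _ ≤ M * R ^ 2 * (bracket l ^ (1 - s) * bracket (k - l) ^ (1 - s)) := by
        gcongr
        · exact one_le_bracket _
        · linarith
    _ ≤ _ := by
        gcongr
        nlinarith [sq_nonneg (bracket l ^ (1 - s) - bracket (k - l) ^ (1 - s)),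
          sq_nonneg (bracket l ^ (1 - s)), sq_nonneg (bracket (k - l) ^ (1 - s))]

lemma summable_advect (hc : IsAdvectionKernel M c) (hs : (d : ℝ) / 2 + 1 < s) (hR : 0 ≤ R)
    {a b : (Fin d → ℤ) → ℂ} (ha : HsBound s R a) (hb : HsBound s R b) (k : Fin d → ℤ) :
    Summable fun l => c k l * a (k - l) * b l :=
  Summable.of_norm_bounded (summable_advectMajorant hs M R k)
    (norm_advect_term_le hc hR ha hb k)

lemma norm_advect_le (hc : IsAdvectionKernel M c) (hs : (d : ℝ) / 2 + 1 < s) (hR : 0 ≤ R)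
    {a b : (Fin d → ℤ) → ℂ} (ha : HsBound s R a) (hb : HsBound s R b) (k : Fin d → ℤ) :
    ‖advect c a b k‖ ≤ ∑' l, advectMajorant s M R k l :=
  tsum_of_norm_bounded (summable_advectMajorant hs M R k).hasSum
    (norm_advect_term_le hc hR ha hb k)

lemma continuousOn_advect (hc : IsAdvectionKernel M c) (hs : (d : ℝ) / 2 + 1 < s) (hR : 0 ≤ R)
    {a b : ℝ → (Fin d → ℤ) → ℂ} {I : Set ℝ} (ha : ∀ t ∈ I, HsBound s R (a t))
    (hb : ∀ t ∈ I, HsBound s R (b t)) (hac : ∀ k, ContinuousOn (fun t => a t k) I)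
    (hbc : ∀ k, ContinuousOn (fun t => b t k) I) (k : Fin d → ℤ) :
    ContinuousOn (fun t => advect c (a t) (b t) k) I :=
  continuousOn_tsum (fun l => (continuousOn_const.mul (hac _)).mul (hbc l))
    (summable_advectMajorant hs M R k)
    fun l t ht => norm_advect_term_le hc hR (ha t ht) (hb t ht) k l

lemma tendsto_advect {ι : Type*} {L : Filter ι} (hc : IsAdvectionKernel M c)
    (hs : (d : ℝ) / 2 + 1 < s) (hR : 0 ≤ R) {a : ι → (Fin d → ℤ) → ℂ} {b : (Fin d → ℤ) → ℂ}
    (ha : ∀ n, HsBound s R (a n)) (hab : ∀ k, Tendsto (fun n => a n k) L (𝓝 (b k)))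
    (k : Fin d → ℤ) :
    Tendsto (fun n => advect c (a n) (a n) k) L (𝓝 (advect c b b k)) :=
  tendsto_tsum_of_dominated_convergence (summable_advectMajorant hs M R k)
    (fun l => (tendsto_const_nhds.mul (hab _)).mul (hab l))
    (Eventually.of_forall fun n l => norm_advect_term_le hc hR (ha n) (ha n) k l)

/-- The bilinear splitting behind stability: the difference is transported by `a`, where skew
symmetry acts, and it transports `b`, so there the derivative falls on `b`. -/
lemma advect_sub_advect (hc : IsAdvectionKernel M c) (hs : (d : ℝ) / 2 + 1 < s) (hR : 0 ≤ R)
    {a b : (Fin d → ℤ) → ℂ} (ha : HsBound s R a) (hb : HsBound s R b) (k : Fin d → ℤ) :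
    advect c a a k - advect c b b k = advect c a (a - b) k + advect c (a - b) b k := by
  have hab := ha.sub hb
  have hR2 : 0 ≤ 2 * R := by positivity
  have ha2 := ha.mono hR (by linarith : R ≤ 2 * R)
  have hb2 := hb.mono hR (by linarith : R ≤ 2 * R)
  rw [advect, advect, advect, advect,
    ← (summable_advect hc hs hR ha ha k).tsum_sub (summable_advect hc hs hR hb hb k),
    ← (summable_advect hc hs hR2 ha2 hab k).tsum_add (summable_advect hc hs hR2 hab hb2 k)]
  refine tsum_congr fun l => ?_
  simp only [Pi.sub_apply]
  ring

/-- Outside `F`, exchanging `s` derivatives for one gains the factor `δ`. -/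
lemma sum_tail_le {F : Finset (Fin d → ℤ)} {δ : ℝ} (hδ : ∀ k ∉ F, bracket k ^ (1 - s) ≤ δ)
    {w : (Fin d → ℤ) → ℂ} (hw : HsBound s R w) {G : Finset (Fin d → ℤ)}
    (hG : ∀ k ∈ G, k ∉ F) : ∑ k ∈ G, (bracket k * ‖w k‖) ^ 2 ≤ δ ^ 2 * R ^ 2 := by
  refine le_trans ?_ (mul_le_mul_of_nonneg_left (hw G) (sq_nonneg δ))
  rw [Finset.mul_sum]
  refine Finset.sum_le_sum fun k hk => ?_
  rw [bracket_mul_eq s k, mul_pow]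
  have := Real.rpow_nonneg (bracket_pos k).le (1 - s)
  gcongr
  exact hδ k (hG k hk)

lemma sum_norm_sq_le_add_tail {F : Finset (Fin d → ℤ)} {δ : ℝ}
    (hδ : ∀ k ∉ F, bracket k ^ (1 - s) ≤ δ) {w : (Fin d → ℤ) → ℂ} (hw : HsBound s R w)
    (G : Finset (Fin d → ℤ)) :
    ∑ k ∈ G, ‖w k‖ ^ 2 ≤ ∑ k ∈ F, ‖w k‖ ^ 2 + δ ^ 2 * R ^ 2 := by
  rw [← Finset.sum_filter_add_sum_filter_not G (· ∈ F)]
  refine add_le_add (Finset.sum_le_sum_of_subset_of_nonneg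
    (fun k hk => (Finset.mem_filter.1 hk).2) fun _ _ _ => sq_nonneg _) ?_
  refine le_trans (Finset.sum_le_sum fun k _ => ?_)
    (sum_tail_le hδ hw (G := G.filter (· ∉ F)) fun k hk => (Finset.mem_filter.1 hk).2)
  gcongr
  exact le_mul_of_one_le_left (norm_nonneg _) (one_le_bracket k)

lemma hasSum_re_inner_advect (hc : IsAdvectionKernel M c) (hs : (d : ℝ) / 2 + 1 < s) (hR : 0 ≤ R)
    {a b : (Fin d → ℤ) → ℂ} (ha : HsBound s R a) (hb : HsBound s R b) (w : (Fin d → ℤ) → ℂ)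
    (F : Finset (Fin d → ℤ)) :
    HasSum (fun l => ∑ k ∈ F, (c k l * a (k - l) * b l * conj (w k)).re)
      (∑ k ∈ F, (conj (w k) * advect c a b k).re) := by
  refine hasSum_sum fun k _ => ?_
  have := Complex.hasSum_re ((summable_advect hc hs hR ha hb k).hasSum.mul_left (conj (w k)))
  refine this.congr_fun fun l => ?_
  rw [mul_comm]

/-- The part with both `k` and `l` in `F` cancels by antisymmetry. In the rest `l ∉ F`, so the
derivative hits only the tail of `w`, which is of size `δ R` in `ℓ²`. -/
lemma transport_term_le (hc : IsAdvectionKernel M c) (hs : (d : ℝ) / 2 + 1 < s) (hR : 0 ≤ R)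
    {a w : (Fin d → ℤ) → ℂ} (ha : HsBound s R a) (hw : HsBound s R w) (hreal : IsRealSeq a)
    {F : Finset (Fin d → ℤ)} {δ : ℝ} (hδ : ∀ k ∉ F, bracket k ^ (1 - s) ≤ δ) :
    |∑ k ∈ F, (conj (w k) * advect c a w k).re| ≤
      M * (embConst d s * R / 2 * (δ ^ 2 * R ^ 2 + ∑ k ∈ F, ‖w k‖ ^ 2)) := by
  have hM := hc.nonneg
  have hsum := hasSum_re_inner_advect hc hs hR ha hw w F
  refine le_of_tendsto (Tendsto.abs hsum) ((eventually_ge_atTop F).mono fun G hG => ?_)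
  rw [← Finset.sum_filter_add_sum_filter_not G (· ∈ F), Finset.filter_mem_eq_inter,
    Finset.inter_eq_right.2 hG]
  have h0 : ∑ l ∈ F, ∑ k ∈ F, (c k l * a (k - l) * w l * conj (w k)).re = 0 :=
    sum_antisymm_eq_zero fun k l => by
      rw [re_kernel_antisymm hc hreal k l, neg_neg]
  rw [h0, zero_add, Finset.sum_comm]
  refine (Finset.abs_sum_le_sum_abs _ _).trans
    ((Finset.sum_le_sum fun k _ => Finset.abs_sum_le_sum_abs _ _).trans ?_)
  have hterm : ∀ k ∈ F, ∀ l ∈ G.filter (· ∉ F), |(c k l * a (k - l) * w l * conj (w k)).re| ≤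
      M * (‖a (k - l)‖ * (bracket l * ‖w l‖) * ‖w k‖) := fun k _ l _ => by
    refine (Complex.abs_re_le_norm _).trans ?_
    rw [norm_mul, norm_mul, norm_mul, RCLike.norm_conj]
    calc _ ≤ M * bracket l * ‖a (k - l)‖ * ‖w l‖ * ‖w k‖ := by
          gcongr
          exact hc.norm_le k l
      _ = _ := by ring
  refine (Finset.sum_le_sum fun k hk => Finset.sum_le_sum (hterm k hk)).trans ?_
  simp_rw [← Finset.mul_sum]
  refine mul_le_mul_of_nonneg_left ?_ hM
  refine (trilinear_le (f := fun m => ‖a m‖) (g := fun l => bracket l * ‖w l‖)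
    (h := fun k => ‖w k‖) (fun _ => norm_nonneg _) (fun H => (Finset.sum_le_sum fun k _ =>
      le_mul_of_one_le_left (norm_nonneg _) (one_le_bracket k)).trans
        (ha.sum_bracket_le hs hR H)) F _).trans ?_
  have := embConst_nonneg d s
  gcongr
  exact sum_tail_le hδ hw fun k hk => (Finset.mem_filter.1 hk).2

/-- No cancellation is needed: `⟨l⟩|b(l)|` is summable and Young's inequality leaves `w` in `ℓ²`,
over all frequencies. This is why its tail outside `F` appears again. -/
lemma stretching_term_le (hc : IsAdvectionKernel M c) (hs : (d : ℝ) / 2 + 1 < s) (hR : 0 ≤ R)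
    {b w : (Fin d → ℤ) → ℂ} (hb : HsBound s R b) (hw : HsBound s R w)
    {F : Finset (Fin d → ℤ)} {δ : ℝ} (hδ : ∀ k ∉ F, bracket k ^ (1 - s) ≤ δ) :
    |∑ k ∈ F, (conj (w k) * advect c w b k).re| ≤
      M * (embConst d s * R / 2 * (∑ k ∈ F, ‖w k‖ ^ 2 + δ ^ 2 * R ^ 2 + ∑ k ∈ F, ‖w k‖ ^ 2)) := by
  have hM := hc.nonneg
  have hsum := hasSum_re_inner_advect hc hs hR hw hb w F
  refine le_of_tendsto (Tendsto.abs hsum) (Eventually.of_forall fun G => ?_)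
  rw [Finset.sum_comm]
  refine (Finset.abs_sum_le_sum_abs _ _).trans
    ((Finset.sum_le_sum fun k _ => Finset.abs_sum_le_sum_abs _ _).trans ?_)
  have hterm : ∀ k ∈ F, ∀ l ∈ G, |(c k l * w (k - l) * b l * conj (w k)).re| ≤
      M * (‖w (k - l)‖ * (bracket l * ‖b l‖) * ‖w k‖) := fun k _ l _ => by
    refine (Complex.abs_re_le_norm _).trans ?_
    rw [norm_mul, norm_mul, norm_mul, RCLike.norm_conj]
    calc _ ≤ M * bracket l * ‖w (k - l)‖ * ‖b l‖ * ‖w k‖ := by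
          gcongr
          exact hc.norm_le k l
      _ = _ := by ring
  refine (Finset.sum_le_sum fun k hk => Finset.sum_le_sum (hterm k hk)).trans ?_
  simp_rw [← Finset.mul_sum]
  refine mul_le_mul_of_nonneg_left ?_ hM
  exact trilinear_le' (f := fun l => bracket l * ‖b l‖) (g := fun l => ‖w l‖)
    (h := fun k => ‖w k‖) (fun k => mul_nonneg (bracket_pos k).le (norm_nonneg _))
    (hb.sum_bracket_le hs hR) (sum_norm_sq_le_add_tail hδ hw) F G

/-- Two solutions of the equations for the frequencies in `F` stay close if they start together. -/
theorem sum_norm_sq_sub_le (hc : IsAdvectionKernel M c) (hs : (d : ℝ) / 2 + 1 < s) (hR : 0 ≤ R)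
    {T : ℝ} {S : (Fin d → ℤ) → ℂ} {a b : ℝ → (Fin d → ℤ) → ℂ} {F : Finset (Fin d → ℤ)} {δ : ℝ}
    (hδ : ∀ k ∉ F, bracket k ^ (1 - s) ≤ δ)
    (har : ∀ t ∈ Icc 0 T, IsRealSeq (a t)) (ha : ∀ t ∈ Icc 0 T, HsBound s R (a t))
    (hb : ∀ t ∈ Icc 0 T, HsBound s R (b t)) (h0 : ∀ k ∈ F, a 0 k = b 0 k)
    (had : ∀ t ∈ Icc 0 T, ∀ k ∈ F, HasDerivWithinAt (fun r => a r k)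
      (-advect c (a t) (a t) k + S k) (Icc 0 T) t)
    (hbd : ∀ t ∈ Icc 0 T, ∀ k ∈ F, HasDerivWithinAt (fun r => b r k)
      (-advect c (b t) (b t) k + S k) (Icc 0 T) t) :
    ∀ t ∈ Icc 0 T, ∑ k ∈ F, ‖a t k - b t k‖ ^ 2 ≤
      gronwallBound 0 (6 * M * embConst d s * R) (16 * M * embConst d s * R ^ 3 * δ ^ 2) t := by
  refine le_gronwallBound_of_hasDerivWithinAt (fun t ht => HasDerivWithinAt.fun_sum fun k hk =>
    HasDerivWithinAt.norm_sq_complex ((had t ht k hk).sub (hbd t ht k hk))) ?_ ?_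
  · exact (Finset.sum_eq_zero fun k hk => by simp [h0 k hk]).le
  · intro t ht
    set w := a t - b t with hw
    have hR2 : 0 ≤ 2 * R := by positivity
    have ha2 := (ha t ht).mono hR (by linarith : R ≤ 2 * R)
    have hb2 := (hb t ht).mono hR (by linarith : R ≤ 2 * R)
    have hwb : HsBound s (2 * R) w := (ha t ht).sub (hb t ht)
    have e : ∀ k ∈ F, 2 * (conj (a t k - b t k) * (-advect c (a t) (a t) k + S k -
        (-advect c (b t) (b t) k + S k))).re = -2 * ((conj (w k) * advect c (a t) w k).re +
          (conj (w k) * advect c w (b t) k).re) := fun k _ => by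
      rw [← Complex.add_re, ← mul_add, ← advect_sub_advect hc hs hR (ha t ht) (hb t ht) k,
        show -advect c (a t) (a t) k + S k - (-advect c (b t) (b t) k + S k) =
          -(advect c (a t) (a t) k - advect c (b t) (b t) k) by ring, mul_neg, Complex.neg_re]
      simp only [hw, Pi.sub_apply]
      ring
    -- Both bounds are used with `2R`, the `H^s` bound of `w`. With `E` the embedding constant they
    -- add up to `M E R (3 ∑|w|² + 8 R² δ²)`; the factor `2` from differentiating a square gives the
    -- constants `6` and `16`.
    have h1 := transport_term_le hc hs hR2 ha2 hwb (har t ht) hδ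
    have h2 := stretching_term_le hc hs hR2 hb2 hwb hδ
    rw [Finset.sum_congr rfl e, ← Finset.mul_sum, Finset.sum_add_distrib]
    have h3 := neg_abs_le (∑ k ∈ F, (conj (w k) * advect c (a t) w k).re)
    have h4 := neg_abs_le (∑ k ∈ F, (conj (w k) * advect c w (b t) k).re)
    have e5 : ∑ k ∈ F, ‖a t k - b t k‖ ^ 2 = ∑ k ∈ F, ‖w k‖ ^ 2 := rfl
    rw [e5]
    linarith

end Stability
end ActiveScalar

namespace ActiveScalar

/-! ### Local well-posedness on the Fourier side -/

open ComplexConjugate Filter Topology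

section FourierSolution

variable {d : ℕ}

/-- The frequencies with `|k_i| ≤ N` for all `i`. -/
def freqBox (d N : ℕ) : Finset (Fin d → ℤ) :=
  Fintype.piFinset fun _ => Finset.Icc (-(N : ℤ)) N

lemma mem_freqBox {N : ℕ} {k : Fin d → ℤ} : k ∈ freqBox d N ↔ ∀ i, |k i| ≤ N := by
  simp [freqBox, abs_le]

lemma neg_mem_freqBox {N : ℕ} : ∀ k ∈ freqBox d N, -k ∈ freqBox d N := fun k hk => by
  rw [mem_freqBox] at hk ⊢
  simpa using hk

lemma freqBox_mono {N N' : ℕ} (h : N ≤ N') : freqBox d N ⊆ freqBox d N' := fun k hk => by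
  rw [mem_freqBox] at hk ⊢
  exact fun i => (hk i).trans (by exact_mod_cast h)

lemma exists_mem_freqBox (k : Fin d → ℤ) : ∃ N, k ∈ freqBox d N := by
  refine ⟨∑ i, (k i).natAbs, mem_freqBox.2 fun i => ?_⟩
  have := Finset.single_le_sum (f := fun i => (k i).natAbs) (fun _ _ => Nat.zero_le _)
    (Finset.mem_univ i)
  zify at this
  simpa using this

lemma bracket_rpow_le_of_notMem {s : ℝ} (hs : 1 ≤ s) {N : ℕ} :
    ∀ k ∉ freqBox d N, bracket k ^ (1 - s) ≤ ((N : ℝ) + 1) ^ (1 - s) := fun k hk => by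
  rw [mem_freqBox] at hk
  push Not at hk
  obtain ⟨i, hi⟩ := hk
  have h1 := abs_coord_le_bracket k i
  have h2 : (N : ℝ) + 1 ≤ |(k i : ℝ)| := by
    have : (N : ℤ) + 1 ≤ |k i| := hi
    exact_mod_cast this
  exact Real.rpow_le_rpow_of_nonpos (by positivity) (h2.trans h1) (by linarith)

variable {s M R T : ℝ} {c : (Fin d → ℤ) → (Fin d → ℤ) → ℂ} {S : (Fin d → ℤ) → ℂ}

/-- Fourier coefficients of a real-valued solution that is bounded in `H^s` on `[0,T]`. -/
structure IsFourierSolution (c : (Fin d → ℤ) → (Fin d → ℤ) → ℂ) (s R T : ℝ)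
    (S : (Fin d → ℤ) → ℂ) (a : ℝ → (Fin d → ℤ) → ℂ) : Prop where
  real : ∀ t ∈ Icc 0 T, IsRealSeq (a t)
  bound : ∀ t ∈ Icc 0 T, HsBound s R (a t)
  deriv : ∀ t ∈ Icc 0 T, ∀ k, HasDerivWithinAt (fun r => a r k)
    (-advect c (a t) (a t) k + S k) (Icc 0 T) t

/-- The error bound in the comparison of approximate solutions. -/
def stabilityBound (d : ℕ) (M s R T : ℝ) (N : ℕ) : ℝ :=
  gronwallBound 0 (6 * M * embConst d s * R)
    (16 * M * embConst d s * R ^ 3 * (((N : ℝ) + 1) ^ (1 - s)) ^ 2) T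

lemma tendsto_stabilityBound (d : ℕ) {s : ℝ} (hs : 1 < s) (M R T : ℝ) :
    Tendsto (stabilityBound d M s R T) atTop (𝓝 0) := by
  have h1 : Tendsto (fun N : ℕ => ((N : ℝ) + 1) ^ (1 - s)) atTop (𝓝 0) := by
    have := (tendsto_rpow_neg_atTop (by linarith : 0 < s - 1)).comp
      (tendsto_atTop_add_const_right _ (1 : ℝ) (tendsto_natCast_atTop_atTop (R := ℝ)))
    simpa [Function.comp_def] using this
  have h2 : Tendsto (fun N : ℕ => 16 * M * embConst d s * R ^ 3 *
      (((N : ℝ) + 1) ^ (1 - s)) ^ 2) atTop (𝓝 0) := by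
    simpa using (h1.pow 2).const_mul (16 * M * embConst d s * R ^ 3)
  have h3 := ((gronwallBound_continuous_ε 0 (6 * M * embConst d s * R) T).tendsto 0).comp h2
  rw [gronwallBound_ε0_δ0] at h3
  exact h3

lemma norm_sq_sub_le_stabilityBound (hc : IsAdvectionKernel M c) (hs : (d : ℝ) / 2 + 1 < s)
    (hR : 0 ≤ R) {a b : ℝ → (Fin d → ℤ) → ℂ} {N : ℕ}
    (har : ∀ t ∈ Icc 0 T, IsRealSeq (a t)) (ha : ∀ t ∈ Icc 0 T, HsBound s R (a t))
    (hb : ∀ t ∈ Icc 0 T, HsBound s R (b t)) (h0 : ∀ k ∈ freqBox d N, a 0 k = b 0 k)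
    (had : ∀ t ∈ Icc 0 T, ∀ k ∈ freqBox d N, HasDerivWithinAt (fun r => a r k)
      (-advect c (a t) (a t) k + S k) (Icc 0 T) t)
    (hbd : ∀ t ∈ Icc 0 T, ∀ k ∈ freqBox d N, HasDerivWithinAt (fun r => b r k)
      (-advect c (b t) (b t) k + S k) (Icc 0 T) t) :
    ∀ t ∈ Icc 0 T, ∀ k ∈ freqBox d N, ‖a t k - b t k‖ ^ 2 ≤ stabilityBound d M s R T N := by
  intro t ht k hk
  have hs1 : 1 ≤ s := by have : (0 : ℝ) ≤ d := d.cast_nonneg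
                         linarith
  have hM := hc.nonneg
  have hE := embConst_nonneg d s
  refine (Finset.single_le_sum (f := fun k => ‖a t k - b t k‖ ^ 2) (fun _ _ => sq_nonneg _)
    hk).trans ((sum_norm_sq_sub_le hc hs hR (bracket_rpow_le_of_notMem hs1) har ha hb h0 had hbd
      t ht).trans ?_)
  exact gronwallBound_mono le_rfl (by positivity) (by positivity) ht.2

/-- Uniqueness on the Fourier side. -/
theorem IsFourierSolution.unique (hc : IsAdvectionKernel M c) (hs : (d : ℝ) / 2 + 1 < s)
    (hR : 0 ≤ R) {a b : ℝ → (Fin d → ℤ) → ℂ} (ha : IsFourierSolution c s R T S a)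
    (hb : IsFourierSolution c s R T S b) (h0 : a 0 = b 0) : ∀ t ∈ Icc 0 T, a t = b t := by
  intro t ht
  funext k
  have hs1 : 1 < s := by have : (0 : ℝ) ≤ d := d.cast_nonneg
                         linarith
  obtain ⟨N₀, hN₀⟩ := exists_mem_freqBox k
  have hle : ‖a t k - b t k‖ ^ 2 ≤ 0 :=
    ge_of_tendsto (tendsto_stabilityBound d hs1 M R T) ((eventually_ge_atTop N₀).mono
      fun N hN => norm_sq_sub_le_stabilityBound hc hs hR ha.real ha.bound hb.bound
        (fun k _ => congrFun h0 k) (fun t ht k _ => ha.deriv t ht k)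
        (fun t ht k _ => hb.deriv t ht k) t ht k (freqBox_mono hN hN₀))
  exact sub_eq_zero.1 (norm_eq_zero.1 (by nlinarith [norm_nonneg (a t k - b t k)]))

lemma hasDerivWithinAt_integral {E : Type*} [NormedAddCommGroup E] [NormedSpace ℝ E]
    [CompleteSpace E] {f : ℝ → E} (hT : 0 ≤ T) (hf : ContinuousOn f (Icc 0 T)) {t : ℝ}
    (ht : t ∈ Icc 0 T) :
    HasDerivWithinAt (fun r => ∫ x in (0 : ℝ)..r, f x) (f t) (Icc 0 T) t := by
  -- Extending `f` by its endpoint values gives a continuous function on the line, so the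
  -- fundamental theorem also covers the endpoints.
  set g := IccExtend hT ((Icc 0 T).domRestrict f)
  have hg : Continuous g := (continuousOn_iff_continuous_domRestrict.1 hf).Icc_extend'
  have hfg : ∀ r ∈ Icc 0 T, g r = f r := fun r hr => IccExtend_of_mem hT _ hr
  have := (hg.integral_hasStrictDerivAt 0 t).hasDerivAt.hasDerivWithinAt (s := Icc 0 T)
  rw [hfg t ht] at this
  refine this.congr (fun r hr => ?_) ?_
  · refine intervalIntegral.integral_congr fun x hx => (hfg x ?_).symm
    rw [uIcc_of_le hr.1] at hx
    exact ⟨hx.1, hx.2.trans hr.2⟩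
  · refine intervalIntegral.integral_congr fun x hx => (hfg x ?_).symm
    rw [uIcc_of_le ht.1] at hx
    exact ⟨hx.1, hx.2.trans ht.2⟩

lemma sub_eq_integral_of_hasDerivWithinAt {E : Type*} [NormedAddCommGroup E] [NormedSpace ℝ E]
    [CompleteSpace E] {f f' : ℝ → E}
    (hf : ∀ t ∈ Icc 0 T, HasDerivWithinAt f (f' t) (Icc 0 T) t) (hf' : ContinuousOn f' (Icc 0 T))
    {t : ℝ} (ht : t ∈ Icc 0 T) : ∫ x in (0 : ℝ)..t, f' x = f t - f 0 := by
  have hsub : Icc 0 t ⊆ Icc 0 T := Icc_subset_Icc_right ht.2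
  refine intervalIntegral.integral_eq_sub_of_hasDeriv_right_of_le ht.1
    (fun x hx => ((hf x (hsub hx)).continuousWithinAt).mono hsub) (fun x hx => ?_) ?_
  · exact (HasDerivWithinAt.Ici_of_Icc (hf x (hsub (Ioo_subset_Icc_self hx)))
      ⟨hx.1.le, hx.2.trans_le ht.2⟩).mono Ioi_subset_Ici_self
  · exact (hf'.mono (by rw [uIcc_of_le ht.1]; exact hsub)).intervalIntegrable

/-- Local existence on the Fourier side. -/
theorem exists_isFourierSolution (hc : IsAdvectionKernel M c) (hs : (d : ℝ) / 2 + 1 < s)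
    {a₀ : (Fin d → ℤ) → ℂ} (ha₀ : IsRealSeq a₀) (hS : IsRealSeq S)
    {R₀ : ℝ} (hR₀ : 0 ≤ R₀) (hab : HsBound s R₀ a₀) (hSb : HsBound s R₀ S) :
    ∃ T > 0, ∃ R ≥ 0, ∃ a : ℝ → (Fin d → ℤ) → ℂ, IsFourierSolution c s R T S a ∧ a 0 = a₀ := by
  have hs1 : 1 < s := by have : (0 : ℝ) ≤ d := d.cast_nonneg
                         linarith
  obtain ⟨T, hT, R, hR, hgal⟩ := exists_galerkin hc hs ha₀ hS hR₀ hab hSb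
  choose A hAnot hA0 hA using fun N => hgal (freqBox d N) neg_mem_freqBox
  -- The approximations vanish off their box, so the truncated sum is the full one: each satisfies
  -- the exact equations for the frequencies in its box, as the stability estimate requires.
  have hadv : ∀ N t k, advect c (A N t) (A N t) k =
      ∑ l ∈ freqBox d N, c k l * A N t (k - l) * A N t l := fun N t k =>
    tsum_eq_sum fun l hl => by rw [hAnot N t l hl, mul_zero]
  have hderiv : ∀ N, ∀ t ∈ Icc 0 T, ∀ k ∈ freqBox d N, HasDerivWithinAt (fun r => A N r k)
      (-advect c (A N t) (A N t) k + S k) (Icc 0 T) t := fun N t ht k hk => by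
    rw [hadv]
    exact (hA N t ht).2.2 k hk
  -- The solutions for two boxes are compared on the smaller one, where both satisfy the exact
  -- equations with the same data.
  have hcauchy : ∀ N N', N ≤ N' → ∀ t ∈ Icc 0 T, ∀ k ∈ freqBox d N,
      ‖A N t k - A N' t k‖ ^ 2 ≤ stabilityBound d M s R T N := fun N N' hN t ht k hk =>
    norm_sq_sub_le_stabilityBound hc hs hR (fun t ht => (hA N t ht).1)
      (fun t ht => (hA N t ht).2.1) (fun t ht => (hA N' t ht).2.1)
      (fun k hk => by rw [hA0 N k hk, hA0 N' k (freqBox_mono hN hk)]) (hderiv N)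
      (fun t ht k hk => hderiv N' t ht k (freqBox_mono hN hk)) t ht k hk
  have hstab : ∀ ε > 0, ∀ k, ∃ N₁, ∀ N ≥ N₁, k ∈ freqBox d N ∧ ∀ N' ≥ N, ∀ t ∈ Icc 0 T,
      ‖A N t k - A N' t k‖ < ε := fun ε hε k => by
    obtain ⟨N₀, hN₀⟩ := exists_mem_freqBox k
    obtain ⟨N₂, hN₂⟩ := eventually_atTop.1 ((tendsto_stabilityBound d hs1 M R T).eventually_lt_const
      (by positivity : 0 < ε ^ 2))
    refine ⟨max N₀ N₂, fun N hN => ?_⟩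
    have hk := freqBox_mono ((le_max_left _ _).trans hN) hN₀
    exact ⟨hk, fun N' hN' t ht => lt_of_pow_lt_pow_left₀ 2 hε.le
      ((hcauchy N N' hN' t ht k hk).trans_lt (hN₂ N ((le_max_right _ _).trans hN)))⟩
  have hlim : ∀ t k, ∃ z, t ∈ Icc 0 T → Tendsto (fun N => A N t k) atTop (𝓝 z) := fun t k => by
    by_cases ht : t ∈ Icc 0 T
    · have : CauchySeq fun N => A N t k := by
        refine Metric.cauchySeq_iff'.2 fun ε hε => ?_
        obtain ⟨N₁, hN₁⟩ := hstab ε hε k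
        exact ⟨N₁, fun N hN => by
          rw [dist_comm, dist_eq_norm]
          exact (hN₁ N₁ le_rfl).2 N hN t ht⟩
      obtain ⟨z, hz⟩ := cauchySeq_tendsto_of_complete this
      exact ⟨z, fun _ => hz⟩
    · exact ⟨0, fun h => absurd h ht⟩
  choose a ha using hlim
  have hbound : ∀ t ∈ Icc 0 T, HsBound s R (a t) := fun t ht G =>
    le_of_tendsto (tendsto_finsetSum G fun k _ => ((ha t k ht).norm.const_mul _).pow 2)
      (Eventually.of_forall fun N => (hA N t ht).2.1 G)
  have hreal : ∀ t ∈ Icc 0 T, IsRealSeq (a t) := fun t ht k =>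
    tendsto_nhds_unique (ha t (-k) ht)
      (((Complex.continuous_conj.tendsto _).comp (ha t k ht)).congr
        fun N => ((hA N t ht).1 k).symm)
  have h0mem : (0 : ℝ) ∈ Icc 0 T := ⟨le_rfl, hT.le⟩
  have ha0 : a 0 = a₀ := by
    funext k
    obtain ⟨N₀, hN₀⟩ := exists_mem_freqBox k
    exact tendsto_nhds_unique_of_eventuallyEq (ha 0 k h0mem) tendsto_const_nhds
      ((eventually_ge_atTop N₀).mono fun N hN => hA0 N k (freqBox_mono hN hN₀))
  have hunif : ∀ k, TendstoUniformlyOn (fun N t => A N t k) (fun t => a t k) atTop (Icc 0 T) :=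
    fun k => by
      refine Metric.tendstoUniformlyOn_iff.2 fun ε hε => ?_
      obtain ⟨N₁, hN₁⟩ := hstab (ε / 2) (by positivity) k
      refine (eventually_ge_atTop N₁).mono fun N hN t ht => ?_
      rw [dist_comm, dist_eq_norm]
      refine lt_of_le_of_lt (le_of_tendsto ((tendsto_const_nhds.sub (ha t k ht)).norm)
        ((eventually_ge_atTop N).mono fun N' hN' => ((hN₁ N hN).2 N' hN' t ht).le)) (by linarith)
  have hAcont : ∀ N k, ContinuousOn (fun t => A N t k) (Icc 0 T) := fun N k => by
    by_cases hk : k ∈ freqBox d N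
    · exact fun t ht => (hderiv N t ht k hk).continuousWithinAt
    · exact continuousOn_const.congr fun t _ => hAnot N t k hk
  have hacont : ∀ k, ContinuousOn (fun t => a t k) (Icc 0 T) := fun k =>
    (hunif k).continuousOn (Frequently.of_forall fun N => hAcont N k)
  have hadvcont : ∀ k, ContinuousOn (fun t => -advect c (a t) (a t) k + S k) (Icc 0 T) :=
    fun k => ((continuousOn_advect hc hs hR hbound hbound hacont hacont k).neg).add
      continuousOn_const
  -- The limit is taken in the integrated equation, so convergence of the time derivatives is not
  -- needed; differentiability follows from the continuity of the integrand.
  have hint : ∀ t ∈ Icc 0 T, ∀ k,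
      a t k = a₀ k + ∫ r in (0 : ℝ)..t, (-advect c (a r) (a r) k + S k) := fun t ht k => by
    obtain ⟨N₀, hN₀⟩ := exists_mem_freqBox k
    have hsub : ∀ r ∈ uIoc 0 t, r ∈ Icc 0 T := fun r hr => by
      rw [uIoc_of_le ht.1] at hr
      exact ⟨hr.1.le, hr.2.trans ht.2⟩
    have hNcont : ∀ N, ContinuousOn (fun t => -advect c (A N t) (A N t) k + S k) (Icc 0 T) :=
      fun N => ((continuousOn_advect hc hs hR (fun t ht => (hA N t ht).2.1)
        (fun t ht => (hA N t ht).2.1) (hAcont N) (hAcont N) k).neg).add continuousOn_const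
    have hdct : Tendsto (fun N => ∫ r in (0 : ℝ)..t, (-advect c (A N r) (A N r) k + S k)) atTop
        (𝓝 (∫ r in (0 : ℝ)..t, (-advect c (a r) (a r) k + S k))) := by
      refine intervalIntegral.tendsto_integral_filter_of_dominated_convergence
        (fun _ => ∑' l, advectMajorant s M R k l + ‖S k‖)
        (Eventually.of_forall fun N => ?_) (Eventually.of_forall fun N => ?_) ?_ ?_
      · refine ((hNcont N).mono ?_).aestronglyMeasurable measurableSet_uIoc
        exact hsub
      · refine ae_of_all _ fun r hr => ?_
        refine (norm_add_le _ _).trans (add_le_add ?_ le_rfl)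
        rw [norm_neg]
        exact norm_advect_le hc hs hR (hA N r (hsub r hr)).2.1 (hA N r (hsub r hr)).2.1 k
      · exact intervalIntegrable_const
      · refine ae_of_all _ fun r hr => ?_
        exact ((tendsto_advect hc hs hR (fun N => (hA N r (hsub r hr)).2.1)
          (fun k => ha r k (hsub r hr)) k).neg).add tendsto_const_nhds
    refine tendsto_nhds_unique_of_eventuallyEq (ha t k ht) (tendsto_const_nhds.add hdct)
      ((eventually_ge_atTop N₀).mono fun N hN => ?_)
    have hk := freqBox_mono hN hN₀
    change A N t k = _ + _
    rw [sub_eq_integral_of_hasDerivWithinAt (fun t ht => hderiv N t ht k hk) (hNcont N) ht,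
      hA0 N k hk]
    ring
  refine ⟨T, hT, R, hR, a, ⟨hreal, hbound, fun t ht k => ?_⟩, ha0⟩
  exact ((hasDerivWithinAt_integral hT.le (hadvcont k) ht).const_add (a₀ k)).congr
    (fun r hr => hint r hr k) (hint t ht k)

end FourierSolution
end ActiveScalar

namespace ActiveScalar

/-! ### Fourier coefficients on the torus -/

open ComplexConjugate Filter Topology

section FourierTorus

variable {d : ℕ}

lemma norm_mode (k : Fin d → ℤ) (x : Torus d) : ‖mode k x‖ = 1 := by
  rw [mode, norm_prod]
  exact Finset.prod_eq_one fun i _ => by rw [fourier_apply, Circle.norm_coe]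

lemma mode_zero (x : Torus d) : mode 0 x = 1 := by simp [mode]

lemma mode_add (k l : Fin d → ℤ) (x : Torus d) : mode (k + l) x = mode k x * mode l x := by
  simp [mode, Finset.prod_mul_distrib]

lemma mode_neg (k : Fin d → ℤ) (x : Torus d) : mode (-k) x = conj (mode k x) := by
  simp only [mode, Pi.neg_apply, fourier_neg, map_prod]

lemma continuous_mode (k : Fin d → ℤ) : Continuous (mode k) := by
  unfold mode
  fun_prop

lemma fourier_coe_two_pi (n : ℤ) (x : ℝ) :
    fourier n (x : AddCircle (2 * Real.pi)) = Complex.exp (Complex.I * n * x) := by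
  rw [fourier_coe_apply]
  congr 1
  have := Real.pi_ne_zero
  push_cast
  field_simp

lemma mode_add_single (k : Fin d → ℤ) (x : Torus d) (j : Fin d) (h : ℝ) :
    mode k (x + Pi.single j (h : AddCircle (2 * Real.pi))) =
      mode k x * Complex.exp (Complex.I * k j * h) := by
  classical
  have h1 : ∀ i, fourier (k i) ((x + Pi.single j (h : AddCircle (2 * Real.pi)) : Torus d) i) =
      fourier (k i) (x i) * (if i = j then Complex.exp (Complex.I * k j * h) else 1) := fun i => by
    by_cases hi : i = j
    · subst hi
      simp only [Pi.add_apply, Pi.single_eq_same, if_true]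
      rw [← fourier_coe_two_pi, fourier_apply, smul_add, AddCircle.toCircle_add,
        Circle.coe_mul, ← fourier_apply, ← fourier_apply]
    · simp [hi]
  simp only [mode]
  rw [Finset.prod_congr rfl fun i _ => h1 i, Finset.prod_mul_distrib]
  simp

/-- Translation by `π / k_j` in a coordinate with `k_j ≠ 0` changes the sign of the character and
leaves the measure invariant. -/
lemma integral_mode_of_ne_zero {k : Fin d → ℤ} (hk : k ≠ 0) : ∫ x : Torus d, mode k x = 0 := by
  obtain ⟨j, hj⟩ := Function.ne_iff.1 hk
  have hj' : (k j : ℂ) ≠ 0 := by exact_mod_cast hj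
  refine integral_eq_zero_of_add_right_eq_neg
    (g := Pi.single j ((Real.pi / k j : ℝ) : AddCircle (2 * Real.pi))) fun x => ?_
  rw [mode_add_single]
  have : Complex.I * k j * ((Real.pi / k j : ℝ) : ℂ) = Real.pi * Complex.I := by
    push_cast
    field_simp
  rw [this, Complex.exp_pi_mul_I]
  ring

lemma volume_real_torus : (volume : Measure (Torus d)).real univ = (2 * Real.pi) ^ d := by
  rw [Measure.real, volume_pi, Measure.pi_univ]
  simp [AddCircle.measure_univ, Real.pi_pos.le]

lemma integrable_of_continuous {E : Type*} [NormedAddCommGroup E] [SecondCountableTopology E]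
    {f : Torus d → E} (hf : Continuous f) : Integrable f :=
  hf.integrable_of_hasCompactSupport (HasCompactSupport.of_compactSpace f)

lemma coeff_congr_ae {f g : Torus d → ℝ} (h : f =ᵐ[volume] g) : coeff f = coeff g := by
  funext k
  rw [coeff, coeff]
  congr 1
  exact integral_congr_ae (h.mono fun x hx => by simp only [hx])

lemma integrable_mode_mul {f : Torus d → ℝ} (hf : Integrable f) (k : Fin d → ℤ) :
    Integrable fun x => mode k x * (f x : ℂ) :=
  hf.ofReal.bdd_mul (c := 1) (continuous_mode k).aestronglyMeasurable
    (ae_of_all _ fun x => (norm_mode k x).le)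

lemma integral_mode_mul (f : Torus d → ℝ) (k : Fin d → ℤ) :
    ∫ x, mode (-k) x * (f x : ℂ) = ((2 * Real.pi) ^ d : ℝ) * coeff f k := by
  rw [coeff, ← mul_assoc, ← Complex.ofReal_mul, mul_inv_cancel₀ (by positivity),
    Complex.ofReal_one, one_mul]

lemma isRealSeq_coeff (f : Torus d → ℝ) : IsRealSeq (coeff f) := fun k => by
  rw [coeff, coeff, map_mul, Complex.conj_ofReal, ← integral_conj]
  congr 1
  refine integral_congr_ae (ae_of_all _ fun x => ?_)
  simp only [map_mul, Complex.conj_ofReal]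
  rw [← mode_neg]

lemma coeff_zero_eq (f : Torus d → ℝ) :
    coeff f 0 = (((2 * Real.pi) ^ d)⁻¹ * ∫ x, f x : ℝ) := by
  rw [coeff]
  simp only [neg_zero, mode_zero, one_mul]
  rw [integral_complex_ofReal, Complex.ofReal_mul]

lemma coeff_sub {f g : Torus d → ℝ} (hf : Integrable f) (hg : Integrable g) :
    coeff (fun x => f x - g x) = coeff f - coeff g := by
  funext k
  simp only [coeff, Pi.sub_apply, Complex.ofReal_sub, mul_sub]
  rw [integral_sub (integrable_mode_mul hf _) (integrable_mode_mul hg _), mul_sub]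

/-! ### Integrable functions are determined by their Fourier coefficients -/

/-- The star subalgebra of `C(𝕋^d, ℂ)` generated by the characters. -/
def modeSubalgebra (d : ℕ) : StarSubalgebra ℂ C(Torus d, ℂ) where
  toSubalgebra := Algebra.adjoin ℂ
    (range fun k : Fin d → ℤ => (⟨mode k, continuous_mode k⟩ : C(Torus d, ℂ)))
  star_mem' := by
    change Algebra.adjoin ℂ _ ≤ star (Algebra.adjoin ℂ _)
    refine Algebra.adjoin_le ?_
    rintro _ ⟨n, rfl⟩
    refine Algebra.subset_adjoin ⟨-n, ?_⟩
    ext1 x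
    exact mode_neg n x

lemma modeSubalgebra_separatesPoints : (modeSubalgebra d).SeparatesPoints := by
  classical
  intro x y hxy
  obtain ⟨i, hi⟩ := Function.ne_iff.1 hxy
  refine ⟨_, ⟨⟨mode (Pi.single i 1), continuous_mode _⟩,
    Algebra.subset_adjoin ⟨Pi.single i 1, rfl⟩, rfl⟩, ?_⟩
  have h1 : ∀ z : Torus d, mode (Pi.single i 1) z = fourier 1 (z i) := fun z => by
    rw [mode, Finset.prod_eq_single i]
    · simp
    · intro j _ hj
      simp [hj]
    · simp
  change mode (Pi.single i 1) x ≠ mode (Pi.single i 1) y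
  rw [h1, h1, fourier_one, fourier_one]
  exact fun h => hi (AddCircle.injective_toCircle Real.two_pi_pos.ne' (Circle.ext h))

lemma modeSubalgebra_toSubmodule : (modeSubalgebra d).toSubalgebra.toSubmodule = Submodule.span ℂ
    (range fun k : Fin d → ℤ => (⟨mode k, continuous_mode k⟩ : C(Torus d, ℂ))) := by
  apply Algebra.adjoin_eq_span_of_subset
  refine .trans (fun x ↦ Submonoid.closure_induction (fun _ ↦ id) ⟨0, ?_⟩ ?_)
    Submodule.subset_span
  · ext z
    simp [mode_zero]
  · rintro _ _ _ _ ⟨m, rfl⟩ ⟨n, rfl⟩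
    exact ⟨m + n, ContinuousMap.ext fun z => mode_add m n z⟩

/-- Stone–Weierstrass: `g ↦ ∫ g f` is continuous for the sup norm and vanishes on the span of the
characters, which is dense. -/
lemma integral_continuousMap_mul_eq_zero {f : Torus d → ℝ} (hf : Integrable f)
    (h : coeff f = 0) (g : C(Torus d, ℂ)) : ∫ x, g x * (f x : ℂ) = 0 := by
  have hint : ∀ g : C(Torus d, ℂ), Integrable fun x => g x * (f x : ℂ) := fun g =>
    hf.ofReal.bdd_mul g.continuous.aestronglyMeasurable
      (ae_of_all _ fun x => g.norm_coe_le_norm x)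
  let Λ : C(Torus d, ℂ) →ₗ[ℂ] ℂ :=
    { toFun := fun g => ∫ x, g x * (f x : ℂ)
      map_add' := fun g₁ g₂ => by
        rw [← integral_add (hint g₁) (hint g₂)]
        simp [add_mul]
      map_smul' := fun z g => by
        simp only [ContinuousMap.smul_apply, smul_eq_mul, RingHom.id_apply, mul_assoc]
        exact integral_const_mul _ _ }
  let Λc := Λ.mkContinuous (∫ x, ‖f x‖) fun g => by
    refine (norm_integral_le_integral_norm _).trans ?_
    rw [← integral_mul_const]
    refine integral_mono (hint g).norm (hf.norm.mul_const _) fun x => ?_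
    simp only [norm_mul, Complex.norm_real]
    rw [mul_comm]
    gcongr
    exact g.norm_coe_le_norm x
  have hker : (modeSubalgebra d).toSubalgebra.toSubmodule ≤ LinearMap.ker Λ := by
    rw [modeSubalgebra_toSubmodule, Submodule.span_le]
    rintro _ ⟨k, rfl⟩
    have h1 := integral_mode_mul f (-k)
    rw [neg_neg, h] at h1
    simpa [Λ] using h1
  have hmem : g ∈ (modeSubalgebra d).topologicalClosure := by
    rw [ContinuousMap.starSubalgebra_topologicalClosure_eq_top_of_separatesPoints _
      modeSubalgebra_separatesPoints]
    trivial
  have hclosed : IsClosed {g : C(Torus d, ℂ) | Λc g = 0} :=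
    isClosed_eq Λc.continuous continuous_const
  exact closure_minimal (fun g hg => hker hg) hclosed hmem

/-- The function is only integrable, so Parseval is not at hand. Indicators of closed sets are
bounded limits of continuous functions, hence all integrals over closed sets vanish. -/
lemma ae_eq_zero_of_coeff_eq_zero {f : Torus d → ℝ} (hf : Integrable f) (h : coeff f = 0) :
    f =ᵐ[volume] 0 := by
  refine ae_eq_zero_of_forall_setIntegral_isClosed_eq_zero hf fun K hK => ?_
  have hδ : ∀ n : ℕ, (0 : ℝ) < 1 / ((n : ℝ) + 1) := fun n => Nat.one_div_pos_of_nat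
  set g : ℕ → Torus d → ℝ := fun n x => (thickenedIndicator (hδ n) K x : ℝ)
  have hzero : ∀ n, ∫ x, g n x * f x = 0 := fun n => by
    have hc : Continuous fun x : Torus d => ((g n x : ℝ) : ℂ) :=
      Complex.continuous_ofReal.comp
        (NNReal.continuous_coe.comp (thickenedIndicator (hδ n) K).continuous)
    have := integral_continuousMap_mul_eq_zero hf h ⟨_, hc⟩
    simp only [ContinuousMap.coe_mk, ← Complex.ofReal_mul] at this
    rw [integral_complex_ofReal] at this
    exact_mod_cast this
  have hlim : Tendsto (fun n => ∫ x, g n x * f x) atTop (𝓝 (∫ x, K.indicator f x)) := by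
    refine tendsto_integral_of_dominated_convergence (fun x => ‖f x‖) (fun n => ?_) hf.norm
      (fun n => ae_of_all _ fun x => ?_) (ae_of_all _ fun x => ?_)
    · exact (NNReal.continuous_coe.comp
        (thickenedIndicator (hδ n) K).continuous).aestronglyMeasurable.mul hf.aestronglyMeasurable
    · rw [norm_mul]
      refine mul_le_of_le_one_left (norm_nonneg _) ?_
      have := thickenedIndicator_le_one (hδ n) K x
      rw [Real.norm_of_nonneg (NNReal.coe_nonneg _)]
      exact_mod_cast this
    · have h1 := tendsto_pi_nhds.1 (thickenedIndicator_tendsto_indicator_closure hδ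
        tendsto_one_div_add_atTop_nhds_zero_nat K) x
      have h2 := ((NNReal.continuous_coe.tendsto _).comp h1).mul_const (f x)
      refine h2.trans (le_of_eq ?_)
      rw [hK.closure_eq]
      by_cases hx : x ∈ K <;> simp [hx]
  rw [integral_indicator hK.measurableSet] at hlim
  exact tendsto_nhds_unique hlim (tendsto_const_nhds.congr fun n => (hzero n).symm)

/-- An integrable function is determined by its Fourier coefficients. -/
theorem ae_eq_of_coeff_eq {f g : Torus d → ℝ} (hf : Integrable f) (hg : Integrable g)
    (h : coeff f = coeff g) : f =ᵐ[volume] g := by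
  have := ae_eq_zero_of_coeff_eq_zero (hf.sub hg) (by
    change coeff (fun x => f x - g x) = 0
    rw [coeff_sub hf hg, h, sub_self])
  exact this.mono fun x hx => sub_eq_zero.1 hx

/-! ### Absolutely convergent Fourier series -/

/-- The real part of the Fourier series with coefficients `a`. -/
def series (a : (Fin d → ℤ) → ℂ) (x : Torus d) : ℝ := (∑' k, a k * mode k x).re

lemma norm_mul_mode (a : (Fin d → ℤ) → ℂ) (k : Fin d → ℤ) (x : Torus d) :
    ‖a k * mode k x‖ = ‖a k‖ := by
  rw [norm_mul, norm_mode, mul_one]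

variable {a b : (Fin d → ℤ) → ℂ}

lemma summable_mul_mode (ha : Summable fun k => ‖a k‖) (x : Torus d) :
    Summable fun k => a k * mode k x :=
  Summable.of_norm (by simpa only [norm_mul_mode] using ha)

lemma ofReal_series (hr : IsRealSeq a) (x : Torus d) :
    (series a x : ℂ) = ∑' k, a k * mode k x := by
  refine Complex.conj_eq_iff_re.1 ?_
  rw [Complex.conj_tsum, ← (Equiv.neg (Fin d → ℤ)).tsum_eq]
  refine tsum_congr fun k => ?_
  simp only [Equiv.neg_apply]
  rw [hr k, mode_neg, map_mul, Complex.conj_conj, Complex.conj_conj]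

lemma continuous_tsum_mode (ha : Summable fun k => ‖a k‖) :
    Continuous fun x : Torus d => ∑' k, a k * mode k x :=
  continuous_tsum (fun k => continuous_const.mul (continuous_mode k)) ha
    fun k x => (norm_mul_mode a k x).le

lemma continuous_series (ha : Summable fun k => ‖a k‖) : Continuous (series a) :=
  Complex.continuous_re.comp (continuous_tsum_mode ha)

lemma coeff_series (ha : Summable fun k => ‖a k‖) (hr : IsRealSeq a) : coeff (series a) = a := by
  funext k
  have hsum : HasSum (fun l => ∫ x : Torus d, mode (-k) x * (a l * mode l x))
      (∫ x : Torus d, ∑' l, mode (-k) x * (a l * mode l x)) := by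
    refine hasSum_integral_of_summable_integral_norm (fun l => integrable_of_continuous
      ((continuous_mode _).mul (continuous_const.mul (continuous_mode l)))) ?_
    refine (ha.mul_left ((2 * Real.pi) ^ d)).congr fun l => ?_
    simp only [norm_mul, norm_mode, one_mul, mul_one, integral_const, volume_real_torus,
      smul_eq_mul]
  have hterm : ∀ l, l ≠ k → ∫ x : Torus d, mode (-k) x * (a l * mode l x) = 0 := fun l hl => by
    have : ∀ x : Torus d, mode (-k) x * (a l * mode l x) = a l * mode (l - k) x := fun x => by
      rw [sub_eq_add_neg, mode_add]; ring
    simp_rw [this]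
    rw [integral_const_mul, integral_mode_of_ne_zero (sub_ne_zero.2 hl), mul_zero]
  have hk : ∫ x : Torus d, mode (-k) x * (a k * mode k x) = ((2 * Real.pi) ^ d : ℝ) * a k := by
    have : ∀ x : Torus d, mode (-k) x * (a k * mode k x) = a k := fun x => by
      rw [mul_left_comm, ← mode_add, neg_add_cancel, mode_zero, mul_one]
    simp_rw [this]
    rw [integral_const, volume_real_torus, Complex.real_smul]
  have h2 := hsum.tsum_eq
  rw [tsum_eq_single k hterm, hk] at h2
  rw [coeff]
  have h3 : ∀ x : Torus d, mode (-k) x * (series a x : ℂ) =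
      ∑' l, mode (-k) x * (a l * mode l x) := fun x => by
    rw [ofReal_series hr, tsum_mul_left]
  simp_rw [h3]
  rw [← h2, ← mul_assoc, ← Complex.ofReal_mul, inv_mul_cancel₀ (by positivity)]
  simp

/-- Convolution of sequences on the frequency lattice. -/
def conv (a b : (Fin d → ℤ) → ℂ) (k : Fin d → ℤ) : ℂ := ∑' l, a (k - l) * b l

/-- The change of variables `(k, l) ↦ (k - l, l)`. -/
def shearEquiv (d : ℕ) : (Fin d → ℤ) × (Fin d → ℤ) ≃ (Fin d → ℤ) × (Fin d → ℤ) where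
  toFun p := (p.1 - p.2, p.2)
  invFun p := (p.1 + p.2, p.2)
  left_inv p := by simp
  right_inv p := by simp

lemma summable_shear (ha : Summable fun k => ‖a k‖) (hb : Summable fun k => ‖b k‖) :
    Summable fun p : (Fin d → ℤ) × (Fin d → ℤ) => ‖a (p.1 - p.2) * b p.2‖ :=
  (shearEquiv d).summable_iff.2 (ha.mul_norm hb)

lemma summable_norm_conv (ha : Summable fun k => ‖a k‖) (hb : Summable fun k => ‖b k‖) :
    Summable fun k => ‖conv a b k‖ :=
  Summable.of_nonneg_of_le (fun _ => norm_nonneg _)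
    (fun k => norm_tsum_le_tsum_norm ((summable_shear ha hb).prod_factor k))
    (summable_shear ha hb).prod

lemma isRealSeq_conv (ha : IsRealSeq a) (hb : IsRealSeq b) : IsRealSeq (conv a b) := fun k => by
  rw [conv, conv, Complex.conj_tsum, ← (Equiv.neg (Fin d → ℤ)).tsum_eq]
  refine tsum_congr fun l => ?_
  simp only [Equiv.neg_apply]
  rw [map_mul, ← ha, ← hb]
  congr 2
  abel

/-- The Cauchy product of two absolutely convergent series, regrouped by total frequency through the
shear. It identifies `u · ∇θ` and `uθ` with convolutions. -/
lemma series_mul_series (ha : Summable fun k => ‖a k‖) (hb : Summable fun k => ‖b k‖)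
    (hra : IsRealSeq a) (hrb : IsRealSeq b) (x : Torus d) :
    series a x * series b x = series (conv a b) x := by
  rw [← Complex.ofReal_inj, Complex.ofReal_mul, ofReal_series hra, ofReal_series hrb,
    ofReal_series (isRealSeq_conv hra hrb)]
  have h1 : Summable fun k => ‖a k * mode k x‖ := by simpa only [norm_mul_mode] using ha
  have h2 : Summable fun k => ‖b k * mode k x‖ := by simpa only [norm_mul_mode] using hb
  rw [tsum_mul_tsum_of_summable_norm h1 h2, ← (shearEquiv d).tsum_eq]
  have hs : Summable fun p : (Fin d → ℤ) × (Fin d → ℤ) =>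
      a ((shearEquiv d p).1) * mode ((shearEquiv d p).1) x *
        (b ((shearEquiv d p).2) * mode ((shearEquiv d p).2) x) :=
    (shearEquiv d).summable_iff.2 (summable_mul_of_summable_norm h1 h2)
  rw [hs.tsum_prod]
  refine tsum_congr fun k => ?_
  rw [conv, ← tsum_mul_right]
  refine tsum_congr fun l => ?_
  have : mode k x = mode (k - l) x * mode l x := by rw [← mode_add, sub_add_cancel]
  simp only [shearEquiv, Equiv.coe_fn_mk]
  rw [this]
  ring

end FourierTorus
end ActiveScalar

namespace ActiveScalar

open ComplexConjugate Filter Topology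

/-! ### Calculus on the torus -/

section Calculus

variable {d : ℕ}

lemma isOpenQuotientMap_proj : IsOpenQuotientMap (proj : (Fin d → ℝ) → Torus d) :=
  IsOpenQuotientMap.piMap (f := fun _ (y : ℝ) => (y : AddCircle (2 * Real.pi)))
    fun _ => QuotientAddGroup.isOpenQuotientMap_mk

lemma proj_add_single [DecidableEq (Fin d)] (x : Fin d → ℝ) (j : Fin d) (h : ℝ) :
    proj x + Pi.single j (h : AddCircle (2 * Real.pi)) = proj (x + Pi.single j h) := by
  funext i
  by_cases hi : i = j
  · subst hi
    simp [proj]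
  · simp [proj, hi]

/-- Smoothness on the torus is expressed on the cover `ℝ^d`; continuity descends because the
projection is an open quotient map. -/
lemma continuous_of_comp_proj {E : Type*} [TopologicalSpace E] {f : ℝ × Torus d → E}
    (hf : Continuous fun p : ℝ × (Fin d → ℝ) => f (p.1, proj p.2)) : Continuous f :=
  (IsOpenQuotientMap.id.prodMap isOpenQuotientMap_proj).isQuotientMap.continuous_iff.2 hf

/-- `f` has the partial derivative `f'` in the `j`-th coordinate at `x`. -/
def HasPartialAt (j : Fin d) (f : Torus d → ℝ) (f' : ℝ) (x : Torus d) : Prop :=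
  HasDerivAt (fun h : ℝ => f (x + Pi.single j (h : AddCircle (2 * Real.pi)))) f' 0

lemma HasPartialAt.partialDeriv_eq {j : Fin d} {f : Torus d → ℝ} {f' : ℝ} {x : Torus d}
    (h : HasPartialAt j f f' x) : partialDeriv j f x = f' := h.deriv

lemma HasPartialAt.mul {j : Fin d} {f g : Torus d → ℝ} {f' g' : ℝ} {x : Torus d}
    (hf : HasPartialAt j f f' x) (hg : HasPartialAt j g g' x) :
    HasPartialAt j (fun y => f y * g y) (f' * g x + f x * g') x := by
  have := HasDerivAt.mul hf hg
  simpa using! this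

lemma HasPartialAt.hasDerivAt {j : Fin d} {f f' : Torus d → ℝ}
    (hf : ∀ x, HasPartialAt j f (f' x) x) (x : Torus d) (r : ℝ) :
    HasDerivAt (fun h : ℝ => f (x + Pi.single j (h : AddCircle (2 * Real.pi))))
      (f' (x + Pi.single j (r : AddCircle (2 * Real.pi)))) r := by
  have h1 := hf (x + Pi.single j (r : AddCircle (2 * Real.pi)))
  have h2 : HasDerivAt (fun h : ℝ => h - r) 1 r := (hasDerivAt_id r).sub_const r
  have h3 := HasDerivAt.scomp_of_eq r h1 h2 (sub_self r).symm
  simp only [one_smul] at h3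
  refine h3.congr_of_eventuallyEq (Eventually.of_forall fun h => ?_)
  simp only [Function.comp_apply]
  rw [add_assoc, ← Pi.single_add, ← AddCircle.coe_add, add_sub_cancel]

/-- `∫ f(x + r e_j) dx` does not depend on `r`; differentiate under the integral at `r = 0`. -/
lemma integral_partial_eq_zero {j : Fin d} {f f' : Torus d → ℝ} (hf : Continuous f)
    (hf' : Continuous f') (h : ∀ x, HasPartialAt j f (f' x) x) : ∫ x, f' x = 0 := by
  obtain ⟨B, hB⟩ := (isCompact_univ (X := Torus d)).exists_bound_of_continuousOn
    hf'.continuousOn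
  have hshift : ∀ {g : Torus d → ℝ}, Continuous g → ∀ r : ℝ,
      Continuous fun x : Torus d => g (x + Pi.single j (r : AddCircle (2 * Real.pi))) :=
    fun hg r => hg.comp (continuous_add_const _)
  have hd := (hasDerivAt_integral_of_dominated_loc_of_deriv_le (μ := (volume : Measure (Torus d)))
    (F := fun (r : ℝ) x => f (x + Pi.single j (r : AddCircle (2 * Real.pi))))
    (F' := fun r x => f' (x + Pi.single j (r : AddCircle (2 * Real.pi))))
    (x₀ := 0) (bound := fun _ => B) univ_mem
    (Eventually.of_forall fun r => (hshift hf r).aestronglyMeasurable)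
    (integrable_of_continuous (hshift hf 0))
    (hshift hf' 0).aestronglyMeasurable
    (ae_of_all _ fun x r _ => hB _ (mem_univ _)) (integrable_const _)
    (ae_of_all _ fun x r _ => HasPartialAt.hasDerivAt h x r)).2
  have hconst : ∀ r : ℝ, ∫ x : Torus d, f (x + Pi.single j (r : AddCircle (2 * Real.pi))) =
      ∫ x : Torus d, f x := fun r => integral_add_right_eq_self f _
  simp_rw [hconst] at hd
  simpa using hd.unique (hasDerivAt_const (0 : ℝ) (∫ x : Torus d, f x))

/-- The Fourier coefficients of the `j`-th partial derivative. -/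
def derivCoeff (j : Fin d) (a : (Fin d → ℤ) → ℂ) (k : Fin d → ℤ) : ℂ := derivSymbol j k * a k

lemma norm_derivCoeff_le (j : Fin d) (a : (Fin d → ℤ) → ℂ) (k : Fin d → ℤ) :
    ‖derivCoeff j a k‖ ≤ bracket k * ‖a k‖ := by
  rw [derivCoeff, derivSymbol, norm_mul, norm_mul, Complex.norm_I, one_mul]
  gcongr
  simpa using abs_coord_le_bracket k j

lemma isRealSeq_derivCoeff (j : Fin d) {a : (Fin d → ℤ) → ℂ} (ha : IsRealSeq a) :
    IsRealSeq (derivCoeff j a) := fun k => by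
  simp [derivCoeff, derivSymbol, ha k]

variable {a : (Fin d → ℤ) → ℂ}

lemma summable_norm_of_bracket (ha : Summable fun k => bracket k * ‖a k‖) :
    Summable fun k => ‖a k‖ :=
  Summable.of_nonneg_of_le (fun _ => norm_nonneg _)
    (fun k => le_mul_of_one_le_left (norm_nonneg _) (one_le_bracket k)) ha

lemma summable_norm_derivCoeff (j : Fin d) (ha : Summable fun k => bracket k * ‖a k‖) :
    Summable fun k => ‖derivCoeff j a k‖ :=
  Summable.of_nonneg_of_le (fun _ => norm_nonneg _) (norm_derivCoeff_le j a) ha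

lemma hasPartialAt_series (ha : Summable fun k => bracket k * ‖a k‖) (j : Fin d) (x : Torus d) :
    HasPartialAt j (series a) (series (derivCoeff j a) x) x := by
  have h1 : ∀ k (h : ℝ), HasDerivAt
      (fun h : ℝ => a k * (mode k x * Complex.exp (Complex.I * k j * h)))
      (a k * (mode k x * (Complex.exp (Complex.I * k j * h) * (Complex.I * k j)))) h := fun k h => by
    have := ((Complex.ofRealCLM.hasDerivAt (x := h)).const_mul (Complex.I * k j)).cexp
    simp only [Complex.ofRealCLM_apply, Complex.ofReal_one, mul_one] at this
    exact (this.const_mul (mode k x)).const_mul (a k)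
  have hnorm : ∀ (k : Fin d → ℤ) (h : ℝ), ‖Complex.exp (Complex.I * k j * h)‖ = 1 := fun k h => by
    rw [Complex.norm_exp]; simp
  have h2 := hasDerivAt_tsum ha h1 (fun k h => by
    rw [norm_mul, norm_mul, norm_mul, norm_mode, hnorm, one_mul, one_mul, mul_comm]
    gcongr
    simpa using abs_coord_le_bracket k j) (y₀ := 0) (by
    simpa using summable_mul_mode (summable_norm_of_bracket ha) x) 0
  have h3 := Complex.reCLM.hasFDerivAt.comp_hasDerivAt (0 : ℝ) h2
  refine (h3.congr_of_eventuallyEq (Eventually.of_forall fun h => ?_)).congr_deriv ?_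
  · simp only [series, Function.comp_apply, Complex.reCLM_apply]
    simp_rw [mode_add_single]
  · simp only [series, Complex.reCLM_apply]
    congr 1
    refine tsum_congr fun k => ?_
    simp only [Complex.ofReal_zero, mul_zero, Complex.exp_zero, one_mul, derivCoeff, derivSymbol]
    ring

lemma mode_proj (k : Fin d → ℤ) (y : Fin d → ℝ) :
    mode k (proj y) = Complex.exp (Complex.I * ∑ i, (k i : ℂ) * y i) := by
  rw [Finset.mul_sum, Complex.exp_sum]
  refine Finset.prod_congr rfl fun i _ => ?_
  rw [proj, fourier_coe_two_pi, mul_assoc]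

/-- The real-linear phase `y ↦ k · y`, with complex values. -/
def phaseCLM (k : Fin d → ℤ) : (Fin d → ℝ) →L[ℝ] ℂ :=
  ∑ i, (k i : ℝ) • Complex.ofRealCLM.comp (ContinuousLinearMap.proj i)

lemma phaseCLM_apply (k : Fin d → ℤ) (y : Fin d → ℝ) :
    phaseCLM k y = ∑ i, (k i : ℂ) * y i := by
  simp [phaseCLM]

lemma norm_phaseCLM_le (k : Fin d → ℤ) : ‖phaseCLM k‖ ≤ d * bracket k := by
  refine (norm_sum_le _ _).trans ?_
  have : ∀ i ∈ (Finset.univ : Finset (Fin d)), ‖(k i : ℝ) • Complex.ofRealCLM.comp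
      (ContinuousLinearMap.proj (R := ℝ) (φ := fun _ : Fin d => ℝ) i)‖ ≤ bracket k := fun i _ => by
    rw [norm_smul]
    refine (mul_le_of_le_one_right (norm_nonneg _) ?_).trans (abs_coord_le_bracket k i)
    refine ContinuousLinearMap.opNorm_le_bound _ zero_le_one fun y => ?_
    simpa using norm_le_pi_norm y i
  refine (Finset.sum_le_sum this).trans ?_
  simp

/-- The total derivative on the cover, needed for joint `C¹` regularity, which partial derivatives
along the axes do not give directly. -/
lemma hasFDerivAt_series_proj (ha : Summable fun k => bracket k * ‖a k‖) (y : Fin d → ℝ) :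
    HasFDerivAt (fun y => series a (proj y)) (∑ j, series (derivCoeff j a) (proj y) •
      (ContinuousLinearMap.proj (R := ℝ) (φ := fun _ : Fin d => ℝ) j)) y := by
  have h1 : ∀ k (y : Fin d → ℝ), HasFDerivAt (fun y => a k * mode k (proj y))
      ((a k * mode k (proj y) * Complex.I) • phaseCLM k) y := fun k y => by
    have h := (((phaseCLM k).hasFDerivAt (x := y)).const_mul Complex.I).cexp.const_mul (a k)
    have e : ∀ y, Complex.exp (Complex.I * phaseCLM k y) = mode k (proj y) := fun y => by
      rw [mode_proj, phaseCLM_apply]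
    simp_rw [e] at h
    refine h.congr_fderiv ?_
    rw [smul_smul, smul_smul]
  have hbound : ∀ k (y : Fin d → ℝ), ‖(a k * mode k (proj y) * Complex.I) • phaseCLM k‖ ≤
      d * (bracket k * ‖a k‖) := fun k y => by
    rw [norm_smul, norm_mul, norm_mul_mode, Complex.norm_I, mul_one]
    have := mul_le_mul_of_nonneg_left (norm_phaseCLM_le k) (norm_nonneg (a k))
    linarith
  have hsum := ha.mul_left (d : ℝ)
  have h2 := hasFDerivAt_tsum hsum h1 hbound (x₀ := 0)
    (summable_mul_mode (summable_norm_of_bracket ha) _) y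
  refine (Complex.reCLM.hasFDerivAt.comp y h2).congr_fderiv ?_
  ext v
  have hs : Summable fun k => (a k * mode k (proj y) * Complex.I) • phaseCLM k :=
    Summable.of_norm_bounded hsum fun k => hbound k y
  have e1 : (∑' k, (a k * mode k (proj y) * Complex.I) • phaseCLM k) v =
      ∑' k, ∑ j, derivCoeff j a k * mode k (proj y) * v j := by
    rw [← ContinuousLinearMap.apply_apply (𝕜 := ℝ) v, ContinuousLinearMap.map_tsum _ hs]
    refine tsum_congr fun k => ?_
    simp only [ContinuousLinearMap.apply_apply, _root_.smul_apply, phaseCLM_apply,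
      smul_eq_mul, Finset.mul_sum]
    refine Finset.sum_congr rfl fun j _ => ?_
    simp only [derivCoeff, derivSymbol]
    ring
  have hsj : ∀ j ∈ (Finset.univ : Finset (Fin d)),
      Summable fun k => derivCoeff j a k * mode k (proj y) * (v j : ℂ) :=
    fun j _ => (summable_mul_mode (summable_norm_derivCoeff j ha) _).mul_right _
  simp only [ContinuousLinearMap.comp_apply, e1, Complex.reCLM_apply]
  rw [Summable.tsum_finsetSum hsj, Complex.re_sum]
  simp only [_root_.sum_apply, _root_.smul_apply,
    ContinuousLinearMap.proj_apply, smul_eq_mul]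
  refine Finset.sum_congr rfl fun j _ => ?_
  rw [tsum_mul_right, series, Complex.re_mul_ofReal]

/-- Joint continuity of Fourier series whose coefficients are bounded in `H^s`, uniformly in time. -/
lemma continuous_series_time {s R C : ℝ} (hs : (d : ℝ) / 2 + 1 < s) (hR : 0 ≤ R) (hC : 0 ≤ C)
    {a b : ℝ → (Fin d → ℤ) → ℂ} (ha : ∀ t, HsBound s R (a t))
    (hb : ∀ k, Continuous fun t => b t k) (hba : ∀ t k, ‖b t k‖ ≤ C * (bracket k * ‖a t k‖)) :
    Continuous fun p : ℝ × Torus d => series (b p.1) p.2 := by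
  refine Complex.continuous_re.comp ?_
  have hsum : ∀ p : ℝ × Torus d, Summable fun k => b p.1 k * mode k p.2 := fun p =>
    summable_mul_mode (Summable.of_nonneg_of_le (fun _ => norm_nonneg _) (hba p.1)
      (((ha p.1).summable_bracket hs hR).mul_left C)) p.2
  have hunif : TendstoUniformly (fun (F : Finset (Fin d → ℤ)) (p : ℝ × Torus d) =>
      ∑ k ∈ F, b p.1 k * mode k p.2) (fun p => ∑' k, b p.1 k * mode k p.2) atTop := by
    refine Metric.tendstoUniformly_iff.2 fun ε hε => ?_
    set δ : ℝ := ε / (2 * (C * R + 1)) with hδ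
    have hCR : 0 < C * R + 1 := by positivity
    have hδpos : 0 < δ := by positivity
    -- The tail is controlled by the fixed sequence `⟨k⟩^{1-s}`, so `F₀` is the same for all times;
    -- the choice of `δ` makes the remainder at most `ε / 2`.
    obtain ⟨F₀, hF₀⟩ := summable_iff_vanishing_norm.1 (summable_bracket_one_sub_sq (d := d) hs)
      (δ ^ 2) (by positivity)
    refine (eventually_ge_atTop F₀).mono fun F hF p => ?_
    have hlim : Tendsto (fun G : Finset (Fin d → ℤ) =>
        ‖∑ k ∈ G, b p.1 k * mode k p.2 - ∑ k ∈ F, b p.1 k * mode k p.2‖) atTop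
        (𝓝 ‖∑' k, b p.1 k * mode k p.2 - ∑ k ∈ F, b p.1 k * mode k p.2‖) :=
      (Tendsto.sub (hsum p).hasSum tendsto_const_nhds).norm
    rw [dist_eq_norm]
    refine lt_of_le_of_lt (le_of_tendsto hlim ((eventually_ge_atTop F).mono fun G hG => ?_))
      (half_lt_self hε)
    rw [← Finset.sum_sdiff hG, add_sub_cancel_right]
    refine (norm_sum_le _ _).trans ?_
    simp only [norm_mul, norm_mode, mul_one]
    have hdisj : Disjoint (G \ F) F₀ := Finset.sdiff_disjoint.mono_right hF
    have h1 := hF₀ (G \ F) hdisj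
    rw [Real.norm_of_nonneg (Finset.sum_nonneg fun _ _ => sq_nonneg _)] at h1
    have h2 : Real.sqrt (∑ k ∈ G \ F, (bracket k ^ (1 - s)) ^ 2) ≤ δ :=
      Real.sqrt_le_iff.2 ⟨hδpos.le, h1.le⟩
    calc ∑ k ∈ G \ F, ‖b p.1 k‖ ≤ ∑ k ∈ G \ F, C * (bracket k * ‖a p.1 k‖) :=
          Finset.sum_le_sum fun k _ => hba p.1 k
      _ = C * ∑ k ∈ G \ F, bracket k * ‖a p.1 k‖ := by rw [Finset.mul_sum]
      _ ≤ C * (δ * R) := by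
          gcongr
          exact ((ha p.1).sum_bracket_le_sqrt hR _).trans (by gcongr)
      _ ≤ (C * R + 1) * δ := by nlinarith
      _ = ε / 2 := by rw [hδ]; field_simp
  exact hunif.continuous (Frequently.of_forall fun F => continuous_finsetSum _ fun k _ =>
    ((hb k).comp continuous_fst).mul ((continuous_mode k).comp continuous_snd))

end Calculus

/-! ### The symbols -/

section Symbols

variable {d : ℕ}

/-- The function `cos (k · x)`. -/
def cosMode (k : Fin d → ℤ) (x : Torus d) : ℝ := (mode k x).re

lemma contDiff_mode_proj (k : Fin d → ℤ) :
    ContDiff ℝ ∞ fun y : Fin d → ℝ => mode k (proj y) := by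
  have e : (fun y : Fin d → ℝ => mode k (proj y)) =
      fun y => Complex.exp (Complex.I * phaseCLM k y) := by
    funext y
    rw [mode_proj, phaseCLM_apply]
  rw [e]
  exact (contDiff_const.mul (phaseCLM k).contDiff).cexp

lemma isSmooth_cosMode (k : Fin d → ℤ) : IsSmooth (cosMode k) :=
  Complex.reCLM.contDiff.comp (contDiff_mode_proj k)

lemma continuous_cosMode (k : Fin d → ℤ) : Continuous (cosMode k) :=
  Complex.continuous_re.comp (continuous_mode k)

/-- The value is `1` at `k = 0` and `1/2` otherwise. Being real and nonzero, it can be divided out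
when an assumption on real-valued functions is turned into one on the symbol at `k`. -/
lemma exists_coeff_cosMode (k : Fin d → ℤ) :
    ∃ r : ℝ, r ≠ 0 ∧ coeff (cosMode k) k = r := by
  have h1 : ∀ x : Torus d, mode (-k) x * (cosMode k x : ℂ) = (1 + mode (-k + -k) x) / 2 :=
    fun x => by
      have h2 : (cosMode k x : ℂ) = (mode k x + mode (-k) x) / 2 := by
        rw [mode_neg, Complex.add_conj, cosMode]
        push_cast
        ring
      rw [h2, ← mul_div_assoc, mul_add, ← mode_add, ← mode_add, neg_add_cancel, mode_zero]
  have hpos : (0 : ℝ) < (2 * Real.pi) ^ d := by positivity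
  rw [coeff]
  simp_rw [h1]
  rw [integral_div, integral_add (integrable_const _) (integrable_of_continuous
    (continuous_mode _)), integral_const, volume_real_torus, Complex.real_smul, mul_one]
  by_cases hk : -k + -k = 0
  · refine ⟨1, one_ne_zero, ?_⟩
    simp_rw [hk, mode_zero]
    rw [integral_const, volume_real_torus, Complex.real_smul, mul_one, add_self_div_two,
      ← Complex.ofReal_mul, inv_mul_cancel₀ hpos.ne']
  · refine ⟨1 / 2, by norm_num, ?_⟩
    rw [integral_mode_of_ne_zero hk, add_zero, ← mul_div_assoc, ← Complex.ofReal_mul,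
      inv_mul_cancel₀ hpos.ne']
    simp

/-- The properties of the velocity symbol that the analysis uses: it is bounded, and the
velocity is real-valued and divergence free. -/
structure IsVelocitySymbol (M : ℝ) (μ : Fin d → (Fin d → ℤ) → ℂ) : Prop where
  nonneg : 0 ≤ M
  norm_le : ∀ j k, ‖μ j k‖ ≤ M
  div_free : ∀ k, ∑ j, (k j : ℂ) * μ j k = 0
  real : ∀ j, IsRealSeq (μ j)

/-- The bound is (A5₂) summed over `i`. (A1) applied to `cos(k · x)` gives `∑ k_i k_j T̂_{ij}(k) =
0`, which is `div u = 0` at frequency `k`. (A2) says that the image of `cos(k · x)` is real, which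
gives `T̂_{ij}(-k) = conj T̂_{ij}(k)`. -/
lemma isVelocitySymbol_velocitySymbol {τ : Fin d → Fin d → (Fin d → ℤ) → ℂ}
    (hA1 : AssumptionA1 τ) (hA2 : AssumptionA2 τ) (hA52 : AssumptionA52 τ) :
    ∃ M, IsVelocitySymbol M (velocitySymbol τ) := by
  obtain ⟨C₀, hC₀, hb⟩ := hA52
  refine ⟨d * C₀, by positivity, fun j k => ?_, fun k => ?_, fun j k => ?_⟩
  · refine (norm_sum_le _ _).trans ((Finset.sum_le_sum fun i _ => ?_).trans_eq
      (b := ∑ _i : Fin d, C₀) (by simp))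
    rw [derivSymbol, mul_assoc, norm_mul, Complex.norm_I, one_mul]
    exact hb i j k
  · obtain ⟨r, hr, hrk⟩ := exists_coeff_cosMode k
    have h := (hA1 (cosMode k) (isSmooth_cosMode k)).coeff_eq k
    have h0 : coeff (0 : Torus d → ℝ) k = 0 := by simp [coeff]
    rw [h0, hrk] at h
    have h1 := (mul_eq_zero.1 h.symm).resolve_right (by exact_mod_cast hr)
    rw [Finset.sum_comm] at h1
    have h2 : Complex.I * ∑ j, (k j : ℂ) * velocitySymbol τ j k = 0 := by
      rw [← h1, Finset.mul_sum]
      refine Finset.sum_congr rfl fun j _ => ?_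
      rw [velocitySymbol, Finset.mul_sum, Finset.mul_sum]
      refine Finset.sum_congr rfl fun i _ => ?_
      simp only [derivSymbol]
      ring
    exact (mul_eq_zero.1 h2).resolve_left Complex.I_ne_zero
  · have hτ : ∀ i, τ i j (-k) = conj (τ i j k) := fun i => by
      obtain ⟨C, hC⟩ := hA2 i j
      have hmem : MemLp (cosMode k) ⊤ volume :=
        memLp_top_of_bound (continuous_cosMode k).aestronglyMeasurable 1
          (ae_of_all _ fun x => by
            rw [cosMode, Real.norm_eq_abs]
            exact (Complex.abs_re_le_norm _).trans (norm_mode k x).le)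
      obtain ⟨g, hg, -⟩ := hC _ hmem
      obtain ⟨r, hr, hrk⟩ := exists_coeff_cosMode k
      have h1 := hg.coeff_eq k
      have h2 := hg.coeff_eq (-k)
      rw [isRealSeq_coeff g k, isRealSeq_coeff (cosMode k) k, h1, hrk, map_mul,
        Complex.conj_ofReal] at h2
      exact (mul_right_cancel₀ (by exact_mod_cast hr) h2).symm
    simp only [velocitySymbol, map_sum, map_mul, hτ, derivSymbol, Pi.neg_apply, Int.cast_neg,
      Complex.conj_I, map_intCast]
    refine Finset.sum_congr rfl fun i _ => ?_
    ring

/-- The kernel of the quadratic term `u · ∇θ` on the Fourier side. -/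
def advectionKernel (μ : Fin d → (Fin d → ℤ) → ℂ) (k l : Fin d → ℤ) : ℂ :=
  ∑ j, derivSymbol j l * μ j (k - l)

variable {M : ℝ} {μ : Fin d → (Fin d → ℤ) → ℂ}

/-- The Fourier form of `u · ∇θ = div(uθ)`: the two expressions differ by the divergence of the
velocity mode `k - l`. -/
lemma advectionKernel_eq (hμ : IsVelocitySymbol M μ) (k l : Fin d → ℤ) :
    advectionKernel μ k l = ∑ j, derivSymbol j k * μ j (k - l) := by
  rw [← sub_eq_zero, advectionKernel, ← Finset.sum_sub_distrib, ← neg_eq_zero,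
    ← mul_zero Complex.I, ← hμ.div_free (k - l), Finset.mul_sum, ← Finset.sum_neg_distrib]
  refine Finset.sum_congr rfl fun j _ => ?_
  simp only [derivSymbol, Pi.sub_apply, Int.cast_sub]
  ring

lemma isAdvectionKernel_advectionKernel (hμ : IsVelocitySymbol M μ) :
    IsAdvectionKernel (d * M) (advectionKernel μ) where
  nonneg := by have := hμ.nonneg
               positivity
  norm_le k l := by
    refine (norm_sum_le _ _).trans ((Finset.sum_le_sum fun j _ => ?_).trans_eq
      (b := ∑ _j : Fin d, bracket l * M) (by simp; ring))
    rw [derivSymbol, norm_mul, norm_mul, Complex.norm_I, one_mul]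
    have := bracket_pos l
    gcongr
    · simpa using abs_coord_le_bracket l j
    · exact hμ.norm_le j _
  antisymm k l := by
    rw [advectionKernel_eq hμ k l, advectionKernel, map_sum, ← Finset.sum_neg_distrib]
    refine Finset.sum_congr rfl fun j _ => ?_
    rw [← neg_sub k l, hμ.real j (k - l), derivSymbol, map_mul, map_mul, Complex.conj_I,
      map_intCast]
    ring
  neg k l := by
    rw [advectionKernel, advectionKernel, map_sum]
    refine Finset.sum_congr rfl fun j _ => ?_
    rw [show -k - -l = -(k - l) by abel, hμ.real j (k - l), derivSymbol, derivSymbol, map_mul,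
      map_mul, Complex.conj_I, map_intCast]
    simp

end Symbols
end ActiveScalar

namespace ActiveScalar

open ComplexConjugate Filter Topology

/-! ### The classical solution -/

section Classical

variable {d : ℕ} {s M R T : ℝ} {μ : Fin d → (Fin d → ℤ) → ℂ}

/-- A path of real sequences, bounded in `H^s` and continuous in each coefficient. -/
structure IsBoundedPath (s R : ℝ) (a : ℝ → (Fin d → ℤ) → ℂ) : Prop where
  nonneg : 0 ≤ R
  real : ∀ t, IsRealSeq (a t)
  bound : ∀ t, HsBound s R (a t)
  cont : ∀ k, Continuous fun t => a t k

/-- Freezing the path at its endpoint values outside `[0,T]` makes the bounds and the continuity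
global in time, so the joint continuity statements need no domain. -/
lemma IsFourierSolution.exists_clamp {c : (Fin d → ℤ) → (Fin d → ℤ) → ℂ} {S : (Fin d → ℤ) → ℂ}
    {a : ℝ → (Fin d → ℤ) → ℂ} (ha : IsFourierSolution c s R T S a) (hT : 0 ≤ T) (hR : 0 ≤ R) :
    ∃ b : ℝ → (Fin d → ℤ) → ℂ, IsBoundedPath s R b ∧ IsFourierSolution c s R T S b ∧
      b 0 = a 0 := by
  set b : ℝ → (Fin d → ℤ) → ℂ := fun t => a (projIcc 0 T hT t)
  have hb : ∀ t ∈ Icc 0 T, b t = a t := fun t ht => by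
    simp only [b, projIcc_of_mem hT ht]
  refine ⟨b, ⟨hR, fun t => ha.real _ (projIcc 0 T hT t).2, fun t => ha.bound _
    (projIcc 0 T hT t).2, fun k => ?_⟩, ⟨fun t ht => hb t ht ▸ ha.real t ht,
    fun t ht => hb t ht ▸ ha.bound t ht, fun t ht k => ?_⟩, hb 0 ⟨le_rfl, hT⟩⟩
  · have : ContinuousOn (fun t => a t k) (Icc 0 T) := fun t ht =>
      (ha.deriv t ht k).continuousWithinAt
    exact (continuousOn_iff_continuous_domRestrict.1 this).Icc_extend'
  · rw [hb t ht]
    exact (ha.deriv t ht k).congr (fun r hr => by rw [hb r hr]) (by rw [hb t ht])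

/-- The Fourier coefficients of the `j`-th component of the velocity. -/
def velCoeff (μ : Fin d → (Fin d → ℤ) → ℂ) (j : Fin d) (a : (Fin d → ℤ) → ℂ)
    (k : Fin d → ℤ) : ℂ := μ j k * a k

lemma norm_velCoeff_le (hμ : IsVelocitySymbol M μ) (j : Fin d) (a : (Fin d → ℤ) → ℂ)
    (k : Fin d → ℤ) : ‖velCoeff μ j a k‖ ≤ M * ‖a k‖ := by
  rw [velCoeff, norm_mul]
  gcongr
  exact hμ.norm_le j k

lemma isRealSeq_velCoeff (hμ : IsVelocitySymbol M μ) (j : Fin d) {a : (Fin d → ℤ) → ℂ}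
    (ha : IsRealSeq a) : IsRealSeq (velCoeff μ j a) := fun k => by
  rw [velCoeff, velCoeff, map_mul, ha k, hμ.real j k]

lemma summable_bracket_velCoeff (hμ : IsVelocitySymbol M μ) (j : Fin d) {a : (Fin d → ℤ) → ℂ}
    (ha : Summable fun k => bracket k * ‖a k‖) :
    Summable fun k => bracket k * ‖velCoeff μ j a k‖ := by
  refine Summable.of_nonneg_of_le (fun k => mul_nonneg (bracket_pos k).le (norm_nonneg _))
    (fun k => ?_) (ha.mul_left M)
  have := mul_le_mul_of_nonneg_left (norm_velCoeff_le hμ j a k) (bracket_pos k).le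
  linarith

lemma sum_conv_derivCoeff (hμ : IsVelocitySymbol M μ) {a : (Fin d → ℤ) → ℂ}
    (ha : Summable fun k => bracket k * ‖a k‖) (k : Fin d → ℤ) :
    ∑ j, conv (velCoeff μ j a) (derivCoeff j a) k = advect (advectionKernel μ) a a k := by
  simp only [conv]
  rw [← Summable.tsum_finsetSum fun j _ => (((summable_shear (summable_norm_of_bracket
    (summable_bracket_velCoeff hμ j ha)) (summable_norm_derivCoeff j ha)).prod_factor k).of_norm)]
  refine tsum_congr fun l => ?_
  rw [advectionKernel, Finset.sum_mul, Finset.sum_mul]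
  refine Finset.sum_congr rfl fun j _ => ?_
  simp only [velCoeff, derivCoeff]
  ring

/-- The conservative form `div(uθ)`, which is the one that the weak formulation sees. -/
lemma sum_derivSymbol_mul_conv (hμ : IsVelocitySymbol M μ) {a : (Fin d → ℤ) → ℂ}
    (ha : Summable fun k => bracket k * ‖a k‖) (k : Fin d → ℤ) :
    ∑ j, derivSymbol j k * conv (velCoeff μ j a) a k = advect (advectionKernel μ) a a k := by
  simp only [conv, ← tsum_mul_left]
  rw [← Summable.tsum_finsetSum fun j _ => ((((summable_shear (summable_norm_of_bracket
    (summable_bracket_velCoeff hμ j ha))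
      (summable_norm_of_bracket ha)).prod_factor k).of_norm).mul_left _)]
  refine tsum_congr fun l => ?_
  rw [advectionKernel_eq hμ, Finset.sum_mul, Finset.sum_mul]
  refine Finset.sum_congr rfl fun j _ => ?_
  simp only [velCoeff]
  ring

lemma sum_series_derivCoeff_velCoeff (hμ : IsVelocitySymbol M μ) {a : (Fin d → ℤ) → ℂ}
    (ha : Summable fun k => bracket k * ‖a k‖) (x : Torus d) :
    ∑ j, series (derivCoeff j (velCoeff μ j a)) x = 0 := by
  simp only [series]
  rw [← Complex.re_sum, ← Summable.tsum_finsetSum fun j _ => summable_mul_mode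
    (summable_norm_derivCoeff j (summable_bracket_velCoeff hμ j ha)) x]
  have : ∀ k, ∑ j, derivCoeff j (velCoeff μ j a) k * mode k x = 0 := fun k => by
    rw [← Finset.sum_mul]
    have h : ∑ j, derivCoeff j (velCoeff μ j a) k =
        Complex.I * a k * ∑ j, (k j : ℂ) * μ j k := by
      rw [Finset.mul_sum]
      refine Finset.sum_congr rfl fun j _ => ?_
      simp only [derivCoeff, derivSymbol, velCoeff]
      ring
    rw [h, hμ.div_free, mul_zero, zero_mul]
  simp_rw [this]
  simp

/-- The time derivative `S - u · ∇θ` prescribed by the equation. -/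
def timeDeriv (μ : Fin d → (Fin d → ℤ) → ℂ) (S a : (Fin d → ℤ) → ℂ) (x : Torus d) : ℝ :=
  series S x - ∑ j, series (velCoeff μ j a) x * series (derivCoeff j a) x

lemma coeff_sum {ι : Type*} (F : Finset ι) {f : ι → Torus d → ℝ}
    (hf : ∀ i ∈ F, Integrable (f i)) (k : Fin d → ℤ) :
    coeff (fun x => ∑ i ∈ F, f i x) k = ∑ i ∈ F, coeff (f i) k := by
  simp only [coeff, Complex.ofReal_sum, Finset.mul_sum]
  rw [integral_finsetSum F fun i hi => integrable_mode_mul (hf i hi) _, Finset.mul_sum]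

lemma coeff_series_mul_series {a b : (Fin d → ℤ) → ℂ} (ha : Summable fun k => ‖a k‖)
    (hb : Summable fun k => ‖b k‖) (hra : IsRealSeq a) (hrb : IsRealSeq b) :
    coeff (fun x => series a x * series b x) = conv a b := by
  rw [← coeff_series (summable_norm_conv ha hb) (isRealSeq_conv hra hrb)]
  congr 1
  funext x
  exact series_mul_series ha hb hra hrb x

lemma coeff_timeDeriv (hμ : IsVelocitySymbol M μ) {S a : (Fin d → ℤ) → ℂ}
    (hS : Summable fun k => ‖S k‖) (hrS : IsRealSeq S)
    (ha : Summable fun k => bracket k * ‖a k‖) (hra : IsRealSeq a) (k : Fin d → ℤ) :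
    coeff (timeDeriv μ S a) k = -advect (advectionKernel μ) a a k + S k := by
  have hv := fun j => summable_norm_of_bracket (summable_bracket_velCoeff hμ j ha)
  have hd := fun j => summable_norm_derivCoeff j ha
  have hint : ∀ j ∈ (Finset.univ : Finset (Fin d)), Integrable fun x : Torus d =>
      series (velCoeff μ j a) x * series (derivCoeff j a) x := fun j _ =>
    integrable_of_continuous ((continuous_series (hv j)).mul (continuous_series (hd j)))
  have h1 : coeff (timeDeriv μ S a) = _ :=
    coeff_sub (integrable_of_continuous (continuous_series hS)) (integrable_finsetSum _ hint)
  rw [h1, Pi.sub_apply, coeff_series hS hrS, coeff_sum _ hint, ← sum_conv_derivCoeff hμ ha]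
  simp_rw [fun j => coeff_series_mul_series (hv j) (hd j) (isRealSeq_velCoeff hμ j hra)
    (isRealSeq_derivCoeff j hra)]
  ring

variable {a : ℝ → (Fin d → ℤ) → ℂ} {S : (Fin d → ℤ) → ℂ}

namespace IsBoundedPath

lemma summable (ha : IsBoundedPath s R a) (hs : (d : ℝ) / 2 + 1 < s) (t : ℝ) :
    Summable fun k => bracket k * ‖a t k‖ := (ha.bound t).summable_bracket hs ha.nonneg

lemma continuous_scalar (ha : IsBoundedPath s R a) (hs : (d : ℝ) / 2 + 1 < s) :
    Continuous fun p : ℝ × Torus d => series (a p.1) p.2 :=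
  continuous_series_time hs ha.nonneg zero_le_one ha.bound ha.cont fun t k => by
    rw [one_mul]
    exact le_mul_of_one_le_left (norm_nonneg _) (one_le_bracket k)

lemma continuous_velocity (ha : IsBoundedPath s R a) (hs : (d : ℝ) / 2 + 1 < s)
    (hμ : IsVelocitySymbol M μ) (j : Fin d) :
    Continuous fun p : ℝ × Torus d => series (velCoeff μ j (a p.1)) p.2 :=
  continuous_series_time hs ha.nonneg hμ.nonneg ha.bound
    (fun k => continuous_const.mul (ha.cont k)) fun t k => by
    refine (norm_velCoeff_le hμ j _ k).trans (mul_le_mul_of_nonneg_left ?_ hμ.nonneg)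
    exact le_mul_of_one_le_left (norm_nonneg _) (one_le_bracket k)

lemma continuous_gradient (ha : IsBoundedPath s R a) (hs : (d : ℝ) / 2 + 1 < s) (j : Fin d) :
    Continuous fun p : ℝ × Torus d => series (derivCoeff j (a p.1)) p.2 :=
  continuous_series_time hs ha.nonneg zero_le_one ha.bound
    (fun k => continuous_const.mul (ha.cont k)) fun t k => by
    rw [one_mul]
    exact norm_derivCoeff_le j _ k

lemma continuous_timeDeriv (ha : IsBoundedPath s R a) (hs : (d : ℝ) / 2 + 1 < s)
    (hμ : IsVelocitySymbol M μ) (hS : Summable fun k => ‖S k‖) :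
    Continuous fun p : ℝ × Torus d => timeDeriv μ S (a p.1) p.2 :=
  ((continuous_series hS).comp continuous_snd).sub (continuous_finsetSum _ fun j _ =>
    (ha.continuous_velocity hs hμ j).mul (ha.continuous_gradient hs j))

end IsBoundedPath

lemma integrable_prod_of_continuous {E : Type*} [NormedAddCommGroup E]
    [SecondCountableTopology E] {f : ℝ × Torus d → E} (hf : Continuous f) {A : Set ℝ}
    (hA : A ⊆ Icc 0 T) :
    Integrable f ((volume.restrict A).prod (volume : Measure (Torus d))) := by
  have h1 : IntegrableOn f (Icc 0 T ×ˢ univ) ((volume : Measure ℝ).prod volume) :=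
    hf.continuousOn.integrableOn_compact (isCompact_Icc.prod isCompact_univ)
  have h2 := h1.mono_set (prod_mono hA (subset_refl univ))
  rwa [IntegrableOn, ← Measure.prod_restrict, Measure.restrict_univ] at h2

lemma coeff_intervalIntegral {g : ℝ → Torus d → ℝ}
    (hg : Continuous fun p : ℝ × Torus d => g p.1 p.2) {t : ℝ} (ht : 0 ≤ t) (k : Fin d → ℤ) :
    coeff (fun x => ∫ r in (0 : ℝ)..t, g r x) k = ∫ r in (0 : ℝ)..t, coeff (g r) k := by
  simp only [coeff]
  rw [intervalIntegral.integral_const_mul]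
  congr 1
  rw [intervalIntegral_integral_swap]
  · refine integral_congr_ae (ae_of_all _ fun x => ?_)
    simp only
    rw [← intervalIntegral.integral_ofReal, intervalIntegral.integral_const_mul]
  · rw [uIoc_of_le ht]
    exact integrable_prod_of_continuous (T := t) (((continuous_mode _).comp continuous_snd).mul
      (Complex.continuous_ofReal.comp hg)) Ioc_subset_Icc_self

/-- The equation, integrated in time at each point of the torus. -/
lemma series_sub_eq_integral (hμ : IsVelocitySymbol M μ) (hs : (d : ℝ) / 2 + 1 < s)
    (ha : IsBoundedPath s R a) (hsol : IsFourierSolution (advectionKernel μ) s R T S a)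
    (hS : Summable fun k => ‖S k‖) (hrS : IsRealSeq S) {t : ℝ} (ht : t ∈ Icc 0 T)
    (x : Torus d) :
    series (a t) x - series (a 0) x = ∫ r in (0 : ℝ)..t, timeDeriv μ S (a r) x := by
  have hcont := ha.continuous_timeDeriv hs hμ hS
  have hc1 : ∀ t, Continuous (series (a t)) := fun t =>
    continuous_series (summable_norm_of_bracket (ha.summable hs t))
  have hc2 : Continuous fun x => ∫ r in (0 : ℝ)..t, timeDeriv μ S (a r) x :=
    intervalIntegral.continuous_parametric_intervalIntegral_of_continuous'
      (f := fun x r => timeDeriv μ S (a r) x)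
      (hcont.comp (f := fun p : Torus d × ℝ => (p.2, p.1)) continuous_swap) 0 t
  have hadv : ∀ k, ContinuousOn (fun t => -advect (advectionKernel μ) (a t) (a t) k + S k)
      (Icc 0 T) := fun k => ((continuousOn_advect (isAdvectionKernel_advectionKernel hμ) hs
    ha.nonneg (fun t _ => ha.bound t) (fun t _ => ha.bound t) (fun k => (ha.cont k).continuousOn)
    (fun k => (ha.cont k).continuousOn) k).neg).add continuousOn_const
  -- Both sides are continuous in `x`, so equal Fourier coefficients give equality at every point.
  refine congrFun ((Continuous.ae_eq_iff_eq volume ((hc1 t).sub (hc1 0)) hc2).1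
    (ae_eq_of_coeff_eq (integrable_of_continuous ((hc1 t).sub (hc1 0)))
      (integrable_of_continuous hc2) ?_)) x
  funext k
  have h1 := coeff_sub (integrable_of_continuous (hc1 t)) (integrable_of_continuous (hc1 0))
  rw [coeff_series (summable_norm_of_bracket (ha.summable hs t)) (ha.real t),
    coeff_series (summable_norm_of_bracket (ha.summable hs 0)) (ha.real 0)] at h1
  refine (congrFun h1 k).trans ?_
  rw [coeff_intervalIntegral hcont ht.1]
  simp_rw [fun r => coeff_timeDeriv hμ hS hrS (ha.summable hs r) (ha.real r) k]
  rw [sub_eq_integral_of_hasDerivWithinAt (fun t ht => hsol.deriv t ht k) (hadv k) ht,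
    Pi.sub_apply]

lemma hasDerivWithinAt_series_time (hμ : IsVelocitySymbol M μ) (hs : (d : ℝ) / 2 + 1 < s)
    (ha : IsBoundedPath s R a) (hsol : IsFourierSolution (advectionKernel μ) s R T S a)
    (hS : Summable fun k => ‖S k‖) (hrS : IsRealSeq S) {t : ℝ} (ht : t ∈ Icc 0 T)
    (x : Torus d) :
    HasDerivWithinAt (fun r => series (a r) x) (timeDeriv μ S (a t) x) (Icc 0 T) t := by
  have hcont : Continuous fun r => timeDeriv μ S (a r) x :=
    (ha.continuous_timeDeriv hs hμ hS).comp (f := fun r : ℝ => ((r, x) : ℝ × Torus d))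
      (continuous_id.prodMk continuous_const)
  have h := (hasDerivWithinAt_integral (ht.1.trans ht.2) hcont.continuousOn ht).const_add
    (series (a 0) x)
  have e : ∀ r ∈ Icc 0 T, series (a r) x =
      series (a 0) x + ∫ q in (0 : ℝ)..r, timeDeriv μ S (a q) x := fun r hr => by
    rw [← series_sub_eq_integral hμ hs ha hsol hS hrS hr x]
    ring
  exact h.congr e (e t ht)

/-- At the base point the interval of integration is degenerate, so the dependence of `G` on `y`
enters only at order `o(|p.1 - t|)`: continuity of `G` suffices, with no derivative in `y`. -/
lemma hasFDerivAt_integral_param {E : Type*} [NormedAddCommGroup E] [NormedSpace ℝ E]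
    {G : ℝ × E → ℝ} (hG : Continuous G) (t : ℝ) (y : E) :
    HasFDerivAt (fun p : ℝ × E => ∫ r in t..p.1, G (r, p.2))
      (G (t, y) • ContinuousLinearMap.fst ℝ ℝ E) (t, y) := by
  rw [hasFDerivAt_iff_isLittleO, Asymptotics.isLittleO_iff]
  intro ε hε
  obtain ⟨δ, hδ, hball⟩ := Metric.continuousAt_iff.1 hG.continuousAt ε hε
  filter_upwards [Metric.ball_mem_nhds (t, y) hδ] with p hp
  have hp1 : |p.1 - t| < δ := by
    have := (le_max_left _ _).trans_lt (Metric.mem_ball.1 hp)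
    rwa [Real.dist_eq] at this
  have hp2 : dist p.2 y < δ := (le_max_right _ _).trans_lt (Metric.mem_ball.1 hp)
  have hint : ∀ c : E, IntervalIntegrable (fun r => G (r, c)) volume t p.1 := fun c =>
    (hG.comp (continuous_id.prodMk continuous_const)).intervalIntegrable _ _
  have e : ∫ r in t..p.1, G (r, p.2) - G (t, y) =
      (∫ r in t..p.1, G (r, p.2)) - G (t, y) * (p.1 - t) := by
    rw [intervalIntegral.integral_sub (hint _) intervalIntegrable_const,
      intervalIntegral.integral_const, smul_eq_mul, mul_comm]
  have h1 : ‖∫ r in t..p.1, G (r, p.2) - G (t, y)‖ ≤ ε * |p.1 - t| := by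
    refine intervalIntegral.norm_integral_le_of_norm_le_const fun r hr => ?_
    rw [← dist_eq_norm]
    refine (hball (max_lt ?_ hp2)).le
    rw [Real.dist_eq]
    have hr' := uIoc_subset_uIcc hr
    exact (abs_sub_left_of_mem_uIcc hr').trans_lt hp1
  simp only [intervalIntegral.integral_same, sub_zero, _root_.smul_apply,
    ContinuousLinearMap.coe_fst', Prod.fst_sub, smul_eq_mul]
  rw [← e]
  refine h1.trans (mul_le_mul_of_nonneg_left ?_ hε.le)
  exact (norm_fst_le (p - (t, y)))

lemma contDiffOn_series (hμ : IsVelocitySymbol M μ) (hs : (d : ℝ) / 2 + 1 < s) (hT : 0 < T)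
    (ha : IsBoundedPath s R a) (hsol : IsFourierSolution (advectionKernel μ) s R T S a)
    (hS : Summable fun k => ‖S k‖) (hrS : IsRealSeq S) :
    ContDiffOn ℝ 1 (fun p : ℝ × (Fin d → ℝ) => series (a p.1) (proj p.2))
      (Icc 0 T ×ˢ univ) := by
  have hproj : Continuous (proj : (Fin d → ℝ) → Torus d) := isOpenQuotientMap_proj.continuous
  have hmap : Continuous fun p : ℝ × (Fin d → ℝ) => ((p.1, proj p.2) : ℝ × Torus d) :=
    continuous_fst.prodMk (hproj.comp continuous_snd)
  have hG : Continuous fun p : ℝ × (Fin d → ℝ) => timeDeriv μ S (a p.1) (proj p.2) :=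
    (ha.continuous_timeDeriv hs hμ hS).comp
      (f := fun p : ℝ × (Fin d → ℝ) => ((p.1, proj p.2) : ℝ × Torus d)) hmap
  have huniq : UniqueDiffOn ℝ (Icc 0 T ×ˢ (univ : Set (Fin d → ℝ))) :=
    (uniqueDiffOn_Icc hT).prod uniqueDiffOn_univ
  rw [show (1 : WithTop ℕ∞) = 0 + 1 from rfl,
    contDiffOn_succ_iff_hasFDerivWithinAt_of_uniqueDiffOn huniq]
  refine ⟨fun h => absurd h (by simp), fun p => timeDeriv μ S (a p.1) (proj p.2) •
    ContinuousLinearMap.fst ℝ ℝ (Fin d → ℝ) + (∑ j, series (derivCoeff j (a p.1)) (proj p.2) •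
      (ContinuousLinearMap.proj (R := ℝ) (φ := fun _ : Fin d => ℝ) j)).comp
      (ContinuousLinearMap.snd ℝ ℝ (Fin d → ℝ)), ?_, ?_⟩
  · rw [contDiffOn_zero]
    refine Continuous.continuousOn ((hG.smul continuous_const).add ?_)
    refine Continuous.clm_comp (continuous_finsetSum _ fun j _ => ?_) continuous_const
    exact ((ha.continuous_gradient hs j).comp hmap).smul continuous_const
  · rintro ⟨t, y⟩ ⟨ht, -⟩
    have h1 := (hasFDerivAt_integral_param hG t y).hasFDerivWithinAt
      (s := Icc 0 T ×ˢ (univ : Set (Fin d → ℝ)))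
    have h2 := ((hasFDerivAt_series_proj (ha.summable hs t) y).comp (t, y)
      (hasFDerivAt_snd (𝕜 := ℝ) (p := ((t, y) : ℝ × (Fin d → ℝ))))).hasFDerivWithinAt
      (s := Icc 0 T ×ˢ (univ : Set (Fin d → ℝ)))
    -- The integral starts at the base time `t`, so the spatial derivative is taken of `series (a
    -- t)` alone; `timeDeriv` is only known to be continuous in `x`.
    have e : ∀ p ∈ Icc 0 T ×ˢ (univ : Set (Fin d → ℝ)), series (a p.1) (proj p.2) =
        (∫ r in t..p.1, timeDeriv μ S (a r) (proj p.2)) + series (a t) (proj p.2) := by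
      rintro ⟨r, z⟩ ⟨hr, -⟩
      have hint : ∀ q, IntervalIntegrable (fun r => timeDeriv μ S (a r) (proj z)) volume 0 q :=
        fun q => (hG.comp (f := fun r : ℝ => (r, z))
          (continuous_id.prodMk continuous_const)).intervalIntegrable _ _
      rw [← intervalIntegral.integral_interval_sub_left (hint _) (hint _),
        ← series_sub_eq_integral hμ hs ha hsol hS hrS hr (proj z),
        ← series_sub_eq_integral hμ hs ha hsol hS hrS ht (proj z)]
      ring
    exact (h1.add h2).congr e (e (t, y) ⟨ht, mem_univ _⟩)

end Classical
end ActiveScalar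

namespace ActiveScalar

open ComplexConjugate Filter Topology

/-! ### The weak formulation -/

section Weak

variable {d : ℕ} {s M R T : ℝ} {μ : Fin d → (Fin d → ℤ) → ℂ}

namespace IsTestFunction

variable {φ : ℝ → Torus d → ℝ}

lemma continuous_self (hφ : IsTestFunction T φ) : Continuous fun p : ℝ × Torus d => φ p.1 p.2 :=
  continuous_of_comp_proj hφ.smooth.continuous

lemma hasFDerivAt (hφ : IsTestFunction T φ) (p : ℝ × (Fin d → ℝ)) :
    HasFDerivAt (fun p : ℝ × (Fin d → ℝ) => φ p.1 (proj p.2))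
      (fderiv ℝ (fun p : ℝ × (Fin d → ℝ) => φ p.1 (proj p.2)) p) p :=
  (hφ.smooth.differentiable (by simp) p).hasFDerivAt

lemma hasDerivAt_time_proj (hφ : IsTestFunction T φ) (t : ℝ) (y : Fin d → ℝ) :
    HasDerivAt (fun r => φ r (proj y))
      (fderiv ℝ (fun p : ℝ × (Fin d → ℝ) => φ p.1 (proj p.2)) (t, y) (1, 0)) t := by
  have hline : HasDerivAt (fun r : ℝ => ((r, y) : ℝ × (Fin d → ℝ))) (1, 0) t :=
    (hasDerivAt_id t).prodMk (hasDerivAt_const t y)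
  exact HasFDerivAt.comp_hasDerivAt t (hφ.hasFDerivAt (t, y)) hline

lemma hasDerivAt_time (hφ : IsTestFunction T φ) (t : ℝ) (x : Torus d) :
    HasDerivAt (fun r => φ r x) (deriv (fun r => φ r x) t) t := by
  obtain ⟨y, rfl⟩ := isOpenQuotientMap_proj.surjective x
  exact (hφ.hasDerivAt_time_proj t y).differentiableAt.hasDerivAt

lemma hasPartialAt_proj (hφ : IsTestFunction T φ) (j : Fin d) (t : ℝ) (y : Fin d → ℝ) :
    HasPartialAt j (φ t) (fderiv ℝ (fun p : ℝ × (Fin d → ℝ) => φ p.1 (proj p.2)) (t, y)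
      (0, Pi.single j 1)) (proj y) := by
  have hline : HasDerivAt (fun h : ℝ => ((t, y + h • Pi.single j 1) : ℝ × (Fin d → ℝ)))
      (0, Pi.single j 1) 0 := by
    refine (hasDerivAt_const _ _).prodMk ?_
    simpa using ((hasDerivAt_id (0 : ℝ)).smul_const (Pi.single j (1 : ℝ) : Fin d → ℝ)).const_add y
  have h := HasFDerivAt.comp_hasDerivAt_of_eq (0 : ℝ) (hφ.hasFDerivAt (t, y)) hline (by simp)
  refine h.congr_of_eventuallyEq (Eventually.of_forall fun h => ?_)
  simp only [Function.comp_apply]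
  rw [proj_add_single, ← Pi.single_smul, smul_eq_mul, mul_one]

lemma hasPartialAt (hφ : IsTestFunction T φ) (j : Fin d) (t : ℝ) (x : Torus d) :
    HasPartialAt j (φ t) (partialDeriv j (φ t) x) x := by
  obtain ⟨y, rfl⟩ := isOpenQuotientMap_proj.surjective x
  have := hφ.hasPartialAt_proj j t y
  rwa [this.partialDeriv_eq]

lemma continuous_fderiv_apply (hφ : IsTestFunction T φ) (v : ℝ × (Fin d → ℝ)) :
    Continuous fun p => fderiv ℝ (fun p : ℝ × (Fin d → ℝ) => φ p.1 (proj p.2)) p v :=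
  (hφ.smooth.continuous_fderiv (by simp)).clm_apply continuous_const

lemma continuous_time_deriv (hφ : IsTestFunction T φ) :
    Continuous fun p : ℝ × Torus d => deriv (fun r => φ r p.2) p.1 :=
  continuous_of_comp_proj ((hφ.continuous_fderiv_apply (1, 0)).congr fun p =>
    (hφ.hasDerivAt_time_proj p.1 p.2).deriv.symm)

lemma continuous_partialDeriv (hφ : IsTestFunction T φ) (j : Fin d) :
    Continuous fun p : ℝ × Torus d => partialDeriv j (φ p.1) p.2 :=
  continuous_of_comp_proj ((hφ.continuous_fderiv_apply (0, Pi.single j 1)).congr fun p =>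
    (hφ.hasPartialAt_proj j p.1 p.2).partialDeriv_eq.symm)

end IsTestFunction

variable {a : ℝ → (Fin d → ℤ) → ℂ} {S : (Fin d → ℤ) → ℂ} {φ : ℝ → Torus d → ℝ}

lemma Continuous.slice {E X Y : Type*} [TopologicalSpace E] [TopologicalSpace X]
    [TopologicalSpace Y] {f : X × Y → E} (hf : Continuous f) (t : X) : Continuous fun x => f (t, x) :=
  hf.comp (continuous_const.prodMk continuous_id)

/-- Integration by parts in space, at a fixed time. -/
lemma integral_transport_eq (hμ : IsVelocitySymbol M μ) (hs : (d : ℝ) / 2 + 1 < s)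
    (ha : IsBoundedPath s R a) (hS : Summable fun k => ‖S k‖) (hφ : IsTestFunction T φ) (t : ℝ) :
    ∫ x, (deriv (fun r => φ r x) t +
        ∑ j, series (velCoeff μ j (a t)) x * partialDeriv j (φ t) x) * series (a t) x =
      (∫ x, (deriv (fun r => φ r x) t * series (a t) x + φ t x * timeDeriv μ S (a t) x)) -
        ∫ x, φ t x * series S x := by
  have hsum := ha.summable hs t
  have hcφ : Continuous (φ t) := Continuous.slice hφ.continuous_self t
  have hcφt : Continuous fun x => deriv (fun r => φ r x) t :=
    Continuous.slice hφ.continuous_time_deriv t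
  have hcφj : ∀ j, Continuous fun x => partialDeriv j (φ t) x := fun j =>
    Continuous.slice (hφ.continuous_partialDeriv j) t
  have hcθ : Continuous (series (a t)) := continuous_series (summable_norm_of_bracket hsum)
  have hcu : ∀ j, Continuous (series (velCoeff μ j (a t))) := fun j =>
    continuous_series (summable_norm_of_bracket (summable_bracket_velCoeff hμ j hsum))
  have hcd : ∀ j, Continuous (series (derivCoeff j (a t))) := fun j =>
    continuous_series (summable_norm_derivCoeff j hsum)
  have hcdu : ∀ j, Continuous (series (derivCoeff j (velCoeff μ j (a t)))) := fun j =>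
    continuous_series (summable_norm_derivCoeff j (summable_bracket_velCoeff hμ j hsum))
  have hcS : Continuous (series S) := continuous_series hS
  have hcG : Continuous (timeDeriv μ S (a t)) :=
    hcS.sub (continuous_finsetSum _ fun j _ => (hcu j).mul (hcd j))
  have hcj : ∀ j, Continuous fun x => series (derivCoeff j (velCoeff μ j (a t))) x *
      (φ t x * series (a t) x) + series (velCoeff μ j (a t)) x *
        (partialDeriv j (φ t) x * series (a t) x + φ t x * series (derivCoeff j (a t)) x) :=
    fun j => ((hcdu j).mul (hcφ.mul hcθ)).add
      ((hcu j).mul (((hcφj j).mul hcθ).add (hcφ.mul (hcd j))))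
  -- The integrand is `∂_j(u_j φ θ)` expanded by the product rule; after summation over `j` the
  -- first term drops because `div u = 0`.
  have hj : ∀ j, ∫ x, (series (derivCoeff j (velCoeff μ j (a t))) x * (φ t x * series (a t) x) +
      series (velCoeff μ j (a t)) x * (partialDeriv j (φ t) x * series (a t) x +
        φ t x * series (derivCoeff j (a t)) x)) = 0 := fun j => by
    refine integral_partial_eq_zero (j := j)
      (f := fun x => series (velCoeff μ j (a t)) x * (φ t x * series (a t) x))
      ((hcu j).mul (hcφ.mul hcθ)) (hcj j) fun x => ?_
    exact (hasPartialAt_series (summable_bracket_velCoeff hμ j hsum) j x).mul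
      ((hφ.hasPartialAt j t x).mul (hasPartialAt_series hsum j x))
  have hall : ∫ x, ∑ j, (series (derivCoeff j (velCoeff μ j (a t))) x *
      (φ t x * series (a t) x) + series (velCoeff μ j (a t)) x * (partialDeriv j (φ t) x *
        series (a t) x + φ t x * series (derivCoeff j (a t)) x)) = 0 := by
    rw [integral_finsetSum _ fun j _ => integrable_of_continuous (hcj j)]
    exact Finset.sum_eq_zero fun j _ => hj j
  rw [← sub_zero (∫ x, (_ + _) * _), ← hall, ← integral_sub, ← integral_sub]
  · refine integral_congr_ae (ae_of_all _ fun x => ?_)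
    have hdiv := sum_series_derivCoeff_velCoeff hμ hsum x
    simp only
    rw [Finset.sum_add_distrib, ← Finset.sum_mul, hdiv, zero_mul, zero_add, timeDeriv]
    have e : ∀ j ∈ (Finset.univ : Finset (Fin d)), series (velCoeff μ j (a t)) x *
        (partialDeriv j (φ t) x * series (a t) x + φ t x * series (derivCoeff j (a t)) x) =
        series (velCoeff μ j (a t)) x * partialDeriv j (φ t) x * series (a t) x +
        φ t x * (series (velCoeff μ j (a t)) x * series (derivCoeff j (a t)) x) := fun j _ => by
      ring
    rw [Finset.sum_congr rfl e, Finset.sum_add_distrib, ← Finset.sum_mul, ← Finset.mul_sum]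
    ring
  · exact integrable_of_continuous ((hcφt.mul hcθ).add (hcφ.mul hcG))
  · exact integrable_of_continuous (hcφ.mul hcS)
  · exact integrable_of_continuous ((hcφt.add (continuous_finsetSum _ fun j _ =>
      (hcu j).mul (hcφj j))).mul hcθ)
  · exact integrable_of_continuous (continuous_finsetSum _ fun j _ => hcj j)

/-- Integration by parts in time. -/
lemma integral_integral_time_eq (hμ : IsVelocitySymbol M μ) (hs : (d : ℝ) / 2 + 1 < s)
    (hT : 0 < T) (ha : IsBoundedPath s R a)
    (hsol : IsFourierSolution (advectionKernel μ) s R T S a)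
    (hS : Summable fun k => ‖S k‖) (hrS : IsRealSeq S) (hφ : IsTestFunction T φ) :
    ∫ t in Ioo 0 T, ∫ x, (deriv (fun r => φ r x) t * series (a t) x +
      φ t x * timeDeriv μ S (a t) x) = -∫ x, φ 0 x * series (a 0) x := by
  have hcont : Continuous fun p : ℝ × Torus d => deriv (fun r => φ r p.2) p.1 *
      series (a p.1) p.2 + φ p.1 p.2 * timeDeriv μ S (a p.1) p.2 :=
    (hφ.continuous_time_deriv.mul (ha.continuous_scalar hs)).add
      (hφ.continuous_self.mul (ha.continuous_timeDeriv hs hμ hS))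
  rw [← integral_Ioc_eq_integral_Ioo, ← intervalIntegral.integral_of_le hT.le,
    intervalIntegral_integral_swap (by
      rw [uIoc_of_le hT.le]
      exact integrable_prod_of_continuous hcont Ioc_subset_Icc_self), ← integral_neg]
  refine integral_congr_ae (ae_of_all _ fun x => ?_)
  have hTm : T ∈ Icc 0 T := ⟨hT.le, le_rfl⟩
  have h := sub_eq_integral_of_hasDerivWithinAt (T := T)
    (f := fun t => φ t x * series (a t) x)
    (f' := fun t => deriv (fun r => φ r x) t * series (a t) x + φ t x * timeDeriv μ S (a t) x)
    (fun t ht => (hφ.hasDerivAt_time t x).hasDerivWithinAt.mul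
      (hasDerivWithinAt_series_time hμ hs ha hsol hS hrS ht x))
    (hcont.comp (f := fun t : ℝ => ((t, x) : ℝ × Torus d))
      (continuous_id.prodMk continuous_const)).continuousOn hTm
  -- The test function vanishes at `T` but not necessarily at `0`, so only the initial boundary term
  -- survives.
  obtain ⟨b, hb, hφb⟩ := hφ.support
  simp only [hφb T hb.le x, zero_mul, zero_sub] at h
  exact h

/-- The Fourier-side solution yields a weak solution. -/
lemma weak_eq_of_isFourierSolution (hμ : IsVelocitySymbol M μ) (hs : (d : ℝ) / 2 + 1 < s)
    (hT : 0 < T) (ha : IsBoundedPath s R a)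
    (hsol : IsFourierSolution (advectionKernel μ) s R T S a)
    (hS : Summable fun k => ‖S k‖) (hrS : IsRealSeq S) {f θ₀ : Torus d → ℝ}
    (hf : f =ᵐ[volume] series S) (hθ₀ : θ₀ =ᵐ[volume] series (a 0)) (hφ : IsTestFunction T φ) :
    (∫ t in Ioo 0 T, ∫ x, (deriv (fun r => φ r x) t +
        ∑ j, series (velCoeff μ j (a t)) x * partialDeriv j (φ t) x) * series (a t) x)
      + ∫ x, φ 0 x * θ₀ x = -∫ t in Ioo 0 T, ∫ x, φ t x * f x := by
  have e1 : ∀ t, ∫ x, φ t x * f x = ∫ x, φ t x * series S x := fun t =>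
    integral_congr_ae (hf.mono fun x hx => by simp only [hx])
  have e2 : ∫ x, φ 0 x * θ₀ x = ∫ x, φ 0 x * series (a 0) x :=
    integral_congr_ae (hθ₀.mono fun x hx => by simp only [hx])
  simp_rw [e1, fun t => integral_transport_eq hμ hs ha hS hφ t]
  have hc1 : Continuous fun p : ℝ × Torus d => deriv (fun r => φ r p.2) p.1 *
      series (a p.1) p.2 + φ p.1 p.2 * timeDeriv μ S (a p.1) p.2 :=
    (hφ.continuous_time_deriv.mul (ha.continuous_scalar hs)).add
      (hφ.continuous_self.mul (ha.continuous_timeDeriv hs hμ hS))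
  have hc2 : Continuous fun p : ℝ × Torus d => φ p.1 p.2 * series S p.2 :=
    hφ.continuous_self.mul ((continuous_series hS).comp continuous_snd)
  rw [integral_sub (integrable_prod_of_continuous hc1 Ioo_subset_Icc_self).integral_prod_left
    (integrable_prod_of_continuous hc2 Ioo_subset_Icc_self).integral_prod_left,
    integral_integral_time_eq hμ hs hT ha hsol hS hrS hφ, e2]
  ring

end Weak
end ActiveScalar

namespace ActiveScalar

open ComplexConjugate Filter Topology

/-! ### Weak solutions on the Fourier side -/

section WeakFourier

variable {d : ℕ} {s M R T : ℝ}

/-- A function whose distributional derivative on `[0,T)`, with initial value `c`, is integrable is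
a primitive. -/
lemma ae_eq_add_integral_of_weak {g q : ℝ → ℝ} {c : ℝ} (hT : 0 < T)
    (hg : IntegrableOn g (Ioo 0 T)) (hq : IntegrableOn q (Ioo 0 T))
    (h : ∀ ψ : ℝ → ℝ, ContDiff ℝ ∞ ψ → (∃ b < T, ∀ t, b ≤ t → ψ t = 0) →
      (∫ t in Ioo 0 T, (deriv ψ t * g t + ψ t * q t)) + ψ 0 * c = 0) :
    ∀ᵐ t ∂(volume.restrict (Ioo 0 T)), g t = c + ∫ r in (0 : ℝ)..t, q r := by
  have hqI : IntervalIntegrable q volume 0 T :=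
    (intervalIntegrable_iff_integrableOn_Ioo_of_le hT.le).2 hq
  have hac := hqI.absolutelyContinuousOnInterval_intervalIntegral (c := 0) (by simp)
  have hPc : ContinuousOn (fun t => ∫ r in (0 : ℝ)..t, q r) (Icc 0 T) := by
    have := hac.continuousOn
    rwa [uIcc_of_le hT.le] at this
  have hPi : IntegrableOn (fun t => c + ∫ r in (0 : ℝ)..t, q r) (Ioo 0 T) :=
    ((continuousOn_const.add hPc).integrableOn_compact isCompact_Icc).mono_set Ioo_subset_Icc_self
  -- The fundamental lemma of the calculus of variations on `(0,T)`; it remains to test against each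
  -- `ζ` with compact support there.
  have hmain := isOpen_Ioo.ae_eq_zero_of_integral_contDiff_smul_eq_zero (μ := volume)
    (f := fun t => g t - (c + ∫ r in (0 : ℝ)..t, q r)) (hg.sub hPi).locallyIntegrableOn ?_
  · rw [ae_restrict_iff' measurableSet_Ioo]
    exact hmain.mono fun t ht h0 => sub_eq_zero.1 (ht h0)
  intro ζ hζ hζc hζs
  obtain ⟨b, hb0, hbT, hb⟩ : ∃ b, 0 ≤ b ∧ b < T ∧ ∀ t, b ≤ t → ζ t = 0 := by
    by_cases hne : (tsupport ζ).Nonempty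
    · obtain ⟨m, hm, hmax⟩ := IsCompact.exists_isGreatest hζc hne
      have hmI := hζs hm
      -- With `m` the last point of the support of `ζ`, the midpoint of `m` and `T` lies strictly
      -- beyond the support and before `T`.
      refine ⟨(m + T) / 2, by linarith [hmI.1], by linarith [hmI.2], fun t ht => ?_⟩
      by_contra hne0
      have := hmax (subset_tsupport ζ hne0)
      linarith [hmI.2]
    · refine ⟨0, le_rfl, hT, fun t _ => ?_⟩
      by_contra hne0
      exact hne ⟨t, subset_tsupport ζ hne0⟩
  -- The primitive of `ζ` that vanishes near `T` is an admissible test function. Its value at `0` is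
  -- `-∫ ζ`, and this is how the constant `c` enters.
  set ψ : ℝ → ℝ := fun t => ∫ r in T..t, ζ r with hψdef
  have hψd : ∀ t, HasDerivAt ψ (ζ t) t := fun t =>
    (hζ.continuous.integral_hasStrictDerivAt T t).hasDerivAt
  have hψderiv : deriv ψ = ζ := funext fun t => (hψd t).deriv
  have hψ : ContDiff ℝ ∞ ψ := by
    rw [contDiff_infty_iff_deriv, hψderiv]
    exact ⟨fun t => (hψd t).differentiableAt, hζ⟩
  have hψb : ∀ t, b ≤ t → ψ t = 0 := fun t ht => by
    refine (intervalIntegral.integral_congr (g := fun _ => (0 : ℝ)) fun r hr => hb r ?_).trans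
      (by simp)
    exact (le_min hbT.le ht).trans hr.1
  have h1 := h ψ hψ ⟨b, hbT, hψb⟩
  have hψac : AbsolutelyContinuousOnInterval ψ 0 T :=
    (hψ.contDiffOn.of_le (by simp)).absolutelyContinuousOnInterval
  -- As `q` is only integrable, its primitive is absolutely continuous with derivative `q` almost
  -- everywhere; integration by parts still holds.
  have h2 := hψac.integral_deriv_mul_eq_sub hac
  rw [hψb T hbT.le] at h2
  simp only [zero_mul, intervalIntegral.integral_same, mul_zero, sub_zero] at h2
  have h3 : ∫ x in (0 : ℝ)..T, ζ x * c = -(ψ 0 * c) := by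
    rw [intervalIntegral.integral_mul_const, hψdef]
    simp only
    rw [intervalIntegral.integral_symm T 0]
    ring
  have h4 : ∫ x in (0 : ℝ)..T, (deriv ψ x * (∫ r in (0 : ℝ)..x, q r) +
      ψ x * deriv (fun t => ∫ r in (0 : ℝ)..t, q r) x) =
      ∫ x in (0 : ℝ)..T, (ζ x * (∫ r in (0 : ℝ)..x, q r) + ψ x * q x) := by
    refine intervalIntegral.integral_congr_ae ?_
    filter_upwards [hqI.ae_hasDerivAt_integral] with x hx hxm
    rw [hψderiv, (hx (uIoc_subset_uIcc hxm) 0 (by simp)).deriv]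
  rw [h4] at h2
  have hζψ : ∀ {ρ : ℝ → ℝ}, Continuous ρ → ∀ {k : ℝ → ℝ}, IntegrableOn k (Ioo 0 T) →
      IntegrableOn (fun t => ρ t * k t) (Ioo 0 T) := fun {ρ} hρ {k} hk => by
    rw [← intervalIntegrable_iff_integrableOn_Ioo_of_le hT.le] at hk ⊢
    exact hk.continuousOn_mul hρ.continuousOn
  have hPi' : IntegrableOn (fun t => ∫ r in (0 : ℝ)..t, q r) (Ioo 0 T) :=
    (hPc.integrableOn_compact isCompact_Icc).mono_set Ioo_subset_Icc_self
  have hψcont := hψ.continuous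
  have hζcont := hζ.continuous
  rw [intervalIntegral.integral_of_le hT.le, integral_Ioc_eq_integral_Ioo] at h2 h3
  rw [hψderiv] at h1
  have e0 : ∫ x, ζ x • (g x - (c + ∫ r in (0 : ℝ)..x, q r)) =
      ∫ x in Ioo 0 T, ((ζ x * g x + ψ x * q x) - ζ x * c -
        (ζ x * (∫ r in (0 : ℝ)..x, q r) + ψ x * q x)) := by
    rw [← setIntegral_eq_integral_of_forall_compl_eq_zero (s := Ioo 0 T)]
    · refine integral_congr_ae (ae_of_all _ fun x => ?_)
      simp only [smul_eq_mul]
      ring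
    · intro x hx
      have : ζ x = 0 := by
        by_contra hne0
        exact hx (hζs (subset_tsupport ζ hne0))
      rw [this, zero_smul]
  rw [e0, integral_sub, integral_sub, h2, h3]
  · linarith
  · exact (hζψ hζcont hg).add (hζψ hψcont hq)
  · exact hζψ hζcont (integrableOn_const (by simp) (by simp))
  · exact ((hζψ hζcont hg).add (hζψ hψcont hq)).sub
      (hζψ hζcont (integrableOn_const (by simp) (by simp)))
  · exact (hζψ hζcont hPi').add (hζψ hψcont hq)

lemma hasPartialAt_re_mode (z : ℂ) (k : Fin d → ℤ) (j : Fin d) (x : Torus d) :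
    HasPartialAt j (fun x => (z * mode k x).re) (z * derivSymbol j k * mode k x).re x := by
  have h := ((Complex.ofRealCLM.hasDerivAt (x := (0 : ℝ))).const_mul
    (Complex.I * k j)).cexp.const_mul (z * mode k x)
  simp only [Complex.ofRealCLM_apply, Complex.ofReal_one, mul_one, Complex.ofReal_zero, mul_zero,
    Complex.exp_zero, one_mul] at h
  have h3 := Complex.reCLM.hasFDerivAt.comp_hasDerivAt (0 : ℝ) h
  refine (h3.congr_of_eventuallyEq (Eventually.of_forall fun h => ?_)).congr_deriv ?_
  · simp only [Function.comp_apply, Complex.reCLM_apply]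
    rw [mode_add_single, ← mul_assoc]
  · simp only [Complex.reCLM_apply, derivSymbol]
    congr 1
    ring

lemma isTestFunction_mode (z : ℂ) (k : Fin d → ℤ) {ψ : ℝ → ℝ} (hψ : ContDiff ℝ ∞ ψ)
    (hsupp : ∃ b < T, ∀ t, b ≤ t → ψ t = 0) :
    IsTestFunction T fun t (x : Torus d) => ψ t * (z * mode k x).re where
  smooth := (hψ.comp contDiff_fst).mul (Complex.reCLM.contDiff.comp
    (contDiff_const.mul ((contDiff_mode_proj k).comp contDiff_snd)))
  support := by
    obtain ⟨b, hb, h⟩ := hsupp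
    exact ⟨b, hb, fun t ht x => by rw [h t ht, zero_mul]⟩

lemma integrable_re_mode_mul {g : Torus d → ℝ} (hg : Integrable g) (w : ℂ) (k : Fin d → ℤ) :
    Integrable fun x => (w * mode k x).re * g x := by
  refine (((integrable_mode_mul hg k).const_mul w).re).congr (ae_of_all _ fun x => ?_)
  change (w * (mode k x * (g x : ℂ))).re = (w * mode k x).re * g x
  rw [← mul_assoc]
  exact Complex.re_mul_ofReal _ _

lemma integral_re_mode_mul {g : Torus d → ℝ} (hg : Integrable g) (w : ℂ) (k : Fin d → ℤ) :
    ∫ x, (w * mode (-k) x).re * g x = (2 * Real.pi) ^ d * (w * coeff g k).re := by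
  have h := integral_re ((integrable_mode_mul hg (-k)).const_mul w)
  rw [integral_const_mul, integral_mode_mul] at h
  have e : ∀ x, (w * mode (-k) x).re * g x = (w * (mode (-k) x * (g x : ℂ))).re := fun x => by
    rw [← mul_assoc, Complex.re_mul_ofReal]
  simp_rw [e]
  refine h.trans ?_
  rw [mul_left_comm]
  exact Complex.re_ofReal_mul _ _

lemma integrableOn_coeff {g : ℝ → Torus d → ℝ} (hg : Integrable (fun p : ℝ × Torus d => g p.1 p.2)
    ((volume.restrict (Ioo 0 T)).prod volume)) (k : Fin d → ℤ) :
    IntegrableOn (fun t => coeff (g t) k) (Ioo 0 T) := by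
  have h : Integrable (fun p : ℝ × Torus d => mode (-k) p.2 * (g p.1 p.2 : ℂ))
      ((volume.restrict (Ioo 0 T)).prod volume) :=
    hg.ofReal.bdd_mul (c := 1) ((continuous_mode _).comp continuous_snd).aestronglyMeasurable
      (ae_of_all _ fun p => (norm_mode _ _).le)
  exact h.integral_prod_left.const_mul _

/-- The weak time derivative of the `k`-th Fourier coefficient of a weak solution. -/
def weakRate (f : Torus d → ℝ) (θ : Torus d → ℝ) (u : Torus d → Fin d → ℝ) (k : Fin d → ℤ) : ℂ :=
  -∑ j, derivSymbol j k * coeff (fun x => u x j * θ x) k + coeff f k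

variable {τ : Fin d → Fin d → (Fin d → ℤ) → ℂ} {f θ₀ : Torus d → ℝ} {θ : ℝ → Torus d → ℝ}
  {u : ℝ → Torus d → Fin d → ℝ}

lemma integrableOn_weakRate (hw : IsWeakSolution τ T f θ₀ θ u) (k : Fin d → ℤ) :
    IntegrableOn (fun t => weakRate f (θ t) (u t) k) (Ioo 0 T) := by
  refine Integrable.add (Integrable.neg (integrable_finsetSum _ fun j _ => ?_))
    (integrable_const _)
  exact (integrableOn_coeff (g := fun t x => u t x j * θ t x)
    (hw.integrable_flux j) k).const_mul _

/-- The space integral in the weak formulation, for the test function `ψ(t) Re (z e^{-ik·x})`. -/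
lemma integral_test_mode {θ : Torus d → ℝ} {u : Torus d → Fin d → ℝ}
    (hθ : Integrable θ) (hf : Integrable f) (hflux : ∀ j, Integrable fun x => u x j * θ x)
    (z : ℂ) (k : Fin d → ℤ) (α β : ℝ) :
    ∫ x, (α * (z * mode (-k) x).re +
        ∑ j, u x j * (β * (z * derivSymbol j (-k) * mode (-k) x).re)) * θ x =
      (2 * Real.pi) ^ d * (α * (z * coeff θ k).re + β * (z * weakRate f θ u k).re) -
        ∫ x, β * (z * mode (-k) x).re * f x := by
  have hi : ∀ j ∈ (Finset.univ : Finset (Fin d)), Integrable fun x =>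
      β * ((z * derivSymbol j (-k) * mode (-k) x).re * (u x j * θ x)) := fun j _ =>
    (integrable_re_mode_mul (hflux j) _ _).const_mul β
  have e : ∀ x, (α * (z * mode (-k) x).re +
        ∑ j, u x j * (β * (z * derivSymbol j (-k) * mode (-k) x).re)) * θ x =
      α * ((z * mode (-k) x).re * θ x) +
        ∑ j, β * ((z * derivSymbol j (-k) * mode (-k) x).re * (u x j * θ x)) := fun x => by
    rw [add_mul, Finset.sum_mul]
    congr 1
    · ring
    · exact Finset.sum_congr rfl fun j _ => by ring
  simp_rw [e, mul_assoc β]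
  rw [integral_add ((integrable_re_mode_mul hθ _ _).const_mul α) (integrable_finsetSum _ hi),
    integral_finsetSum _ hi, integral_const_mul, integral_const_mul, integral_re_mode_mul hθ,
    integral_re_mode_mul hf]
  simp_rw [integral_const_mul, fun j => integral_re_mode_mul (hflux j) (z * derivSymbol j (-k)) k]
  have e2 : (z * weakRate f θ u k).re =
      ∑ j, (z * derivSymbol j (-k) * coeff (fun x => u x j * θ x) k).re +
        (z * coeff f k).re := by
    rw [weakRate, mul_add, Complex.add_re, ← Finset.sum_neg_distrib, Finset.mul_sum,
      Complex.re_sum]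
    congr 1
    refine Finset.sum_congr rfl fun j _ => ?_
    simp only [derivSymbol, Pi.neg_apply, Int.cast_neg]
    congr 1
    ring
  rw [e2]
  simp only [mul_add, Finset.mul_sum]
  rw [add_sub_assoc, add_sub_assoc]
  congr 1
  · ring
  · rw [show (2 * Real.pi) ^ d * (β * (z * coeff f k).re) -
      β * ((2 * Real.pi) ^ d * (z * coeff f k).re) = 0 by ring, add_zero]
    exact Finset.sum_congr rfl fun j _ => by ring

/-- With the test function `ψ(t) Re(z e^{-ik·x})` the weak formulation becomes a scalar
distributional equation in time, initial value included. -/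
lemma weak_coeff_eq (hT : 0 < T) (hw : IsWeakSolution τ T f θ₀ θ u) (hf : Integrable f)
    (hθ₀ : Integrable θ₀) (z : ℂ) (k : Fin d → ℤ) :
    ∀ᵐ t ∂(volume.restrict (Ioo 0 T)), (z * coeff (θ t) k).re =
      (z * coeff θ₀ k).re + ∫ r in (0 : ℝ)..t, (z * weakRate f (θ r) (u r) k).re := by
  have hpos : (0 : ℝ) < (2 * Real.pi) ^ d := by positivity
  have hgI : IntegrableOn (fun t => (z * coeff (θ t) k).re) (Ioo 0 T) :=
    ((integrableOn_coeff hw.integrable_scalar k).const_mul z).re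
  have hqI : IntegrableOn (fun t => (z * weakRate f (θ t) (u t) k).re) (Ioo 0 T) :=
    ((integrableOn_weakRate hw k).const_mul z).re
  refine ae_eq_add_integral_of_weak hT hgI hqI fun ψ hψ hsupp => ?_
  have hφ := isTestFunction_mode (T := T) z (-k) hψ hsupp
  have h := hw.weak_eq _ hφ
  have hd1 : ∀ t x, deriv (fun r => ψ r * (z * mode (-k) x).re) t =
      deriv ψ t * (z * mode (-k) x).re := fun t x => by simp
  have hd2 : ∀ t (j : Fin d) (x : Torus d),
      partialDeriv j (fun x : Torus d => ψ t * (z * mode (-k) x).re) x =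
      ψ t * (z * derivSymbol j (-k) * mode (-k) x).re := fun t j x =>
    HasPartialAt.partialDeriv_eq ((hasPartialAt_re_mode z (-k) j x).const_mul (ψ t))
  simp only [hd1, hd2] at h
  have hfψ : IntegrableOn (fun t => ∫ x, ψ t * (z * mode (-k) x).re * f x) (Ioo 0 T) := by
    have e : ∀ t, ∫ x, ψ t * (z * mode (-k) x).re * f x =
        ψ t * ∫ x, (z * mode (-k) x).re * f x := fun t => by
      simp_rw [mul_assoc (ψ t)]
      exact integral_const_mul _ _
    simp_rw [e]
    exact ((hψ.continuous.mul continuous_const).continuousOn.integrableOn_compact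
      isCompact_Icc).mono_set Ioo_subset_Icc_self
  have hmain : ∀ᵐ t ∂(volume.restrict (Ioo 0 T)),
      (∫ x, (deriv ψ t * (z * mode (-k) x).re +
        ∑ j, u t x j * (ψ t * (z * derivSymbol j (-k) * mode (-k) x).re)) * θ t x) =
      (2 * Real.pi) ^ d * (deriv ψ t * (z * coeff (θ t) k).re +
        ψ t * (z * weakRate f (θ t) (u t) k).re) -
        ∫ x, ψ t * (z * mode (-k) x).re * f x := by
    filter_upwards [hw.integrable_scalar.prod_right_ae,
      ae_all_iff.2 fun j => (hw.integrable_flux j).prod_right_ae] with t h1 h2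
    exact integral_test_mode h1 hf h2 z k _ _
  rw [integral_congr_ae hmain, integral_sub ?_ hfψ] at h
  · have e3 : ∫ x, ψ 0 * (z * mode (-k) x).re * θ₀ x =
        (2 * Real.pi) ^ d * (ψ 0 * (z * coeff θ₀ k).re) := by
      simp_rw [mul_assoc (ψ 0)]
      rw [integral_const_mul, integral_re_mode_mul hθ₀]
      ring
    rw [e3, integral_const_mul] at h
    have h5 : (2 * Real.pi) ^ d * ((∫ t in Ioo 0 T, (deriv ψ t * (z * coeff (θ t) k).re +
        ψ t * (z * weakRate f (θ t) (u t) k).re)) + ψ 0 * (z * coeff θ₀ k).re) = 0 := by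
      linarith
    exact (mul_eq_zero.1 h5).resolve_left hpos.ne'
  · have hmul : ∀ {ρ g : ℝ → ℝ}, Continuous ρ → IntegrableOn g (Ioo 0 T) →
        IntegrableOn (fun t => ρ t * g t) (Ioo 0 T) := fun hρ hg => by
      rw [← intervalIntegrable_iff_integrableOn_Ioo_of_le hT.le] at hg ⊢
      exact hg.continuousOn_mul hρ.continuousOn
    exact ((hmul (hψ.continuous_deriv (by simp)) hgI).add
      (hmul hψ.continuous hqI)).const_mul _

/-- The Fourier coefficients of a weak solution are primitives of the weak rates. -/
lemma coeff_eq_add_integral (hT : 0 < T) (hw : IsWeakSolution τ T f θ₀ θ u) (hf : Integrable f)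
    (hθ₀ : Integrable θ₀) (k : Fin d → ℤ) :
    ∀ᵐ t ∂(volume.restrict (Ioo 0 T)), coeff (θ t) k =
      coeff θ₀ k + ∫ r in (0 : ℝ)..t, weakRate f (θ r) (u r) k := by
  -- Test functions are real-valued, so the complex identity is recovered from its real part (`z =
  -- 1`) and its imaginary part (`z = -i`).
  filter_upwards [weak_coeff_eq hT hw hf hθ₀ 1 k, weak_coeff_eq hT hw hf hθ₀ (-Complex.I) k,
    ae_restrict_mem measurableSet_Ioo] with t h1 h2 ht
  have hI : IntervalIntegrable (fun r => weakRate f (θ r) (u r) k) volume 0 t := by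
    rw [intervalIntegrable_iff_integrableOn_Ioo_of_le ht.1.le]
    exact (integrableOn_weakRate hw k).mono_set (Ioo_subset_Ioo_right ht.2.le)
  have hz : ∀ z : ℂ, ∫ r in (0 : ℝ)..t, (z * weakRate f (θ r) (u r) k).re =
      (z * ∫ r in (0 : ℝ)..t, weakRate f (θ r) (u r) k).re := fun z => by
    rw [← intervalIntegral.integral_const_mul]
    exact Complex.reCLM.intervalIntegral_comp_comm (hI.const_mul z)
  rw [hz] at h1 h2
  simp only [one_mul] at h1
  simp only [neg_mul, Complex.neg_re, Complex.I_mul_re, neg_neg] at h2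
  exact Complex.ext h1 h2

end WeakFourier
end ActiveScalar

namespace ActiveScalar

/-! ### Sobolev functions and their Fourier series -/

open ComplexConjugate Filter Topology

section Sobolev

variable {d : ℕ} {s : ℝ}

lemma HsBound.of_sobolevNorm_le {g : Torus d → ℝ} {C : ℝ≥0} (h : sobolevNorm s g ≤ C) :
    HsBound s C (coeff g) := fun F => by
  have h1 : ∑' k : Fin d → ℤ, ENNReal.ofReal ((1 + freqSq k) ^ s * ‖coeff g k‖ ^ 2) ≤
      (C : ℝ≥0∞) ^ (2 : ℝ) := by
    have := ENNReal.rpow_le_rpow h (z := 2) (by norm_num)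
    rwa [sobolevNorm, ← ENNReal.rpow_mul, show (1 / 2 : ℝ) * 2 = 1 by norm_num,
      ENNReal.rpow_one] at this
  have h2 := (ENNReal.sum_le_tsum F).trans h1
  have e : ∀ k : Fin d → ℤ, (1 + freqSq k) ^ s * ‖coeff g k‖ ^ 2 =
      (bracket k ^ s * ‖coeff g k‖) ^ 2 := fun k => by rw [mul_pow, bracket_rpow_sq]
  simp_rw [e] at h2
  rw [← ENNReal.ofReal_sum_of_nonneg fun k _ => sq_nonneg _] at h2
  have h3 : (C : ℝ≥0∞) ^ (2 : ℝ) = ENNReal.ofReal ((C : ℝ) ^ 2) := by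
    rw [ENNReal.ofReal_pow C.coe_nonneg, ENNReal.ofReal_coe_nnreal, ← ENNReal.rpow_natCast,
      Nat.cast_ofNat]
  rw [h3] at h2
  exact (ENNReal.ofReal_le_ofReal_iff (by positivity)).1 h2

lemma HsBound.sobolevNorm_le {g : Torus d → ℝ} {C : ℝ≥0} (h : HsBound s C (coeff g)) :
    sobolevNorm s g ≤ C := by
  have h3 : ENNReal.ofReal ((C : ℝ) ^ 2) = (C : ℝ≥0∞) ^ (2 : ℝ) := by
    rw [ENNReal.ofReal_pow C.coe_nonneg, ENNReal.ofReal_coe_nnreal, ← ENNReal.rpow_natCast,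
      Nat.cast_ofNat]
  have h1 : ∑' k : Fin d → ℤ, ENNReal.ofReal ((1 + freqSq k) ^ s * ‖coeff g k‖ ^ 2) ≤
      (C : ℝ≥0∞) ^ (2 : ℝ) := by
    rw [ENNReal.tsum_eq_iSup_sum]
    refine iSup_le fun F => ?_
    have e : ∀ k : Fin d → ℤ, (1 + freqSq k) ^ s * ‖coeff g k‖ ^ 2 =
        (bracket k ^ s * ‖coeff g k‖) ^ 2 := fun k => by rw [mul_pow, bracket_rpow_sq]
    simp_rw [e]
    rw [← ENNReal.ofReal_sum_of_nonneg fun k _ => sq_nonneg _, ← h3]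
    exact ENNReal.ofReal_le_ofReal (h F)
  have := ENNReal.rpow_le_rpow h1 (z := 1 / 2) (by norm_num)
  rwa [← ENNReal.rpow_mul, show (2 : ℝ) * (1 / 2) = 1 by norm_num, ENNReal.rpow_one] at this

lemma MemSobolev.exists_hsBound {g : Torus d → ℝ} (h : MemSobolev s g) :
    ∃ C : ℝ≥0, HsBound s C (coeff g) :=
  ⟨(sobolevNorm s g).toNNReal, HsBound.of_sobolevNorm_le (ENNReal.coe_toNNReal h.2.ne).ge⟩

lemma MemSobolev.integrable {g : Torus d → ℝ} (h : MemSobolev s g) : Integrable g :=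
  h.1.integrable (by norm_num)

/-- A function with summable Fourier coefficients is the sum of its Fourier series. -/
lemma ae_eq_series {f : Torus d → ℝ} {a : (Fin d → ℤ) → ℂ} (hf : Integrable f)
    (ha : Summable fun k => ‖a k‖) (hfa : coeff f = a) : f =ᵐ[volume] series a := by
  have hr : IsRealSeq a := hfa ▸ isRealSeq_coeff f
  exact ae_eq_of_coeff_eq hf (integrable_of_continuous (continuous_series ha))
    (by rw [hfa, coeff_series ha hr])

end Sobolev

/-! ### Uniqueness -/

section Uniqueness

variable {d : ℕ} {s M R T : ℝ} {c : (Fin d → ℤ) → (Fin d → ℤ) → ℂ} {S : (Fin d → ℤ) → ℂ}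

lemma IsFourierSolution.mono {a : ℝ → (Fin d → ℤ) → ℂ} {R' : ℝ}
    (ha : IsFourierSolution c s R T S a) (hR : 0 ≤ R) (hR' : R ≤ R') :
    IsFourierSolution c s R' T S a where
  real := ha.real
  bound t ht := (ha.bound t ht).mono hR hR'
  deriv := ha.deriv

/-- Bounded coefficients that satisfy the Fourier-side equation in integrated form for a.e. time
agree a.e. with a solution. -/
lemma exists_isFourierSolution_of_ae (hc : IsAdvectionKernel M c) (hs : (d : ℝ) / 2 + 1 < s)
    (hT : 0 < T) (hR : 0 ≤ R) {b : ℝ → (Fin d → ℤ) → ℂ} {b₀ : (Fin d → ℤ) → ℂ}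
    {q : ℝ → (Fin d → ℤ) → ℂ} (hq : ∀ k, IntegrableOn (fun t => q t k) (Ioo 0 T))
    (hreal : ∀ t, IsRealSeq (b t))
    (hbound : ∀ᵐ t ∂(volume.restrict (Ioo 0 T)), HsBound s R (b t))
    (hrate : ∀ᵐ t ∂(volume.restrict (Ioo 0 T)), ∀ k, q t k = -advect c (b t) (b t) k + S k)
    (hint : ∀ k, ∀ᵐ t ∂(volume.restrict (Ioo 0 T)), b t k = b₀ k + ∫ r in (0 : ℝ)..t, q r k) :
    ∃ a, IsFourierSolution c s R T S a ∧ a 0 = b₀ ∧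
      ∀ᵐ t ∂(volume.restrict (Ioo 0 T)), b t = a t := by
  set a : ℝ → (Fin d → ℤ) → ℂ := fun t k => b₀ k + ∫ r in (0 : ℝ)..t, q r k with hadef
  have hIcc : (volume.restrict (Ioo (0 : ℝ) T)) = volume.restrict (Icc 0 T) :=
    Measure.restrict_congr_set Ioo_ae_eq_Icc
  have hqI : ∀ k, IntervalIntegrable (fun t => q t k) volume 0 T := fun k =>
    (intervalIntegrable_iff_integrableOn_Ioo_of_le hT.le).2 (hq k)
  have hac : ∀ k, ContinuousOn (fun t => a t k) (Icc 0 T) := fun k => by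
    have := intervalIntegral.continuousOn_primitive_interval' (hqI k) left_mem_uIcc
    rw [uIcc_of_le hT.le] at this
    exact continuousOn_const.add this
  have hba : ∀ᵐ t ∂(volume.restrict (Ioo 0 T)), b t = a t :=
    (ae_all_iff.2 hint).mono fun t h => funext h
  have hareal : ∀ t ∈ Icc 0 T, IsRealSeq (a t) := fun t ht k => by
    -- The primitives are continuous up to the endpoints, so identities known for almost every time
    -- hold on all of `[0,T]`.
    refine Measure.eqOn_Icc_of_ae_eq volume hT.ne (f := fun t => a t (-k))
      (g := fun t => conj (a t k)) ?_ (hac _)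
      (Complex.continuous_conj.comp_continuousOn (hac k)) ht
    rw [← hIcc]
    filter_upwards [hba] with t h
    rw [← h]
    exact hreal t k
  have habound : ∀ t ∈ Icc 0 T, HsBound s R (a t) := fun t ht F => by
    have hcont : ContinuousOn (fun t => ∑ k ∈ F, (bracket k ^ s * ‖a t k‖) ^ 2) (Icc 0 T) :=
      continuousOn_finsetSum _ fun k _ => (continuousOn_const.mul (hac k).norm).pow 2
    -- The inequality `x ≤ R²` is written as the equality `max x R² = R²`, so that the same
    -- principle applies.
    refine max_eq_right_iff.1 (Measure.eqOn_Icc_of_ae_eq volume hT.ne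
      (f := fun t => max (∑ k ∈ F, (bracket k ^ s * ‖a t k‖) ^ 2) (R ^ 2))
      (g := fun _ => R ^ 2) ?_ (ContinuousOn.sup hcont continuousOn_const) continuousOn_const ht)
    rw [← hIcc]
    filter_upwards [hba, hbound] with t h h2
    rw [← h]
    exact max_eq_right (h2 F)
  have hadv : ∀ k, ContinuousOn (fun t => -advect c (a t) (a t) k + S k) (Icc 0 T) := fun k =>
    (continuousOn_advect hc hs hR habound habound hac hac k).neg.add continuousOn_const
  have haint : ∀ k, ∀ t ∈ Icc 0 T,
      a t k = b₀ k + ∫ r in (0 : ℝ)..t, (-advect c (a r) (a r) k + S k) := fun k t ht => by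
    simp only [hadef]
    congr 1
    rw [intervalIntegral.integral_of_le ht.1, intervalIntegral.integral_of_le ht.1,
      integral_Ioc_eq_integral_Ioo, integral_Ioc_eq_integral_Ioo]
    refine integral_congr_ae (ae_restrict_of_ae_restrict_of_subset (Ioo_subset_Ioo_right ht.2) ?_)
    filter_upwards [hba, hrate] with r h h2
    rw [h2, h]
  refine ⟨a, ⟨hareal, habound, fun t ht k => ?_⟩, funext fun k => by simp [hadef], hba⟩
  exact ((hasDerivWithinAt_integral hT.le (hadv k) ht).const_add (b₀ k)).congr
    (fun r hr => haint k r hr) (haint k t ht)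

variable {μ : Fin d → (Fin d → ℤ) → ℂ}

/-- The weak rate of a function with summable series and its velocity. -/
lemma weakRate_eq (hμ : IsVelocitySymbol M μ) {f θ : Torus d → ℝ} {u : Torus d → Fin d → ℝ}
    (hθ : Integrable θ) (ha : Summable fun k => bracket k * ‖coeff θ k‖)
    (hu : ∀ j, IsMultiplierImage (μ j) θ fun x => u x j) (k : Fin d → ℤ) :
    weakRate f θ u k =
      -advect (advectionKernel μ) (coeff θ) (coeff θ) k + coeff f k := by
  have hr := isRealSeq_coeff θ
  have hθs := ae_eq_series hθ (summable_norm_of_bracket ha) rfl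
  have hus : ∀ j, (fun x => u x j) =ᵐ[volume] series (velCoeff μ j (coeff θ)) := fun j =>
    ae_eq_series (hu j).integrable_right
      (summable_norm_of_bracket (summable_bracket_velCoeff hμ j ha)) (funext (hu j).coeff_eq)
  rw [weakRate, ← sum_derivSymbol_mul_conv hμ ha]
  congr 2
  refine Finset.sum_congr rfl fun j _ => ?_
  rw [← coeff_series_mul_series (summable_norm_of_bracket (summable_bracket_velCoeff hμ j ha))
    (summable_norm_of_bracket ha) (isRealSeq_velCoeff hμ j hr) hr,
    coeff_congr_ae (f := fun x => u x j * θ x) ((hus j).mul hθs)]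
  rfl

/-- Weak solutions bounded in `H^s` have the Fourier coefficients of the Fourier-side solution. -/
lemma ae_eq_series_of_isWeakSolution {τ : Fin d → Fin d → (Fin d → ℤ) → ℂ}
    (hμ : IsVelocitySymbol M (velocitySymbol τ)) (hs : (d : ℝ) / 2 + 1 < s) (hT : 0 < T)
    (hR : 0 ≤ R) {f θ₀ : Torus d → ℝ} (hf : Integrable f) (hθ₀ : Integrable θ₀)
    {a : ℝ → (Fin d → ℤ) → ℂ}
    (ha : IsFourierSolution (advectionKernel (velocitySymbol τ)) s R T (coeff f) a)
    (ha0 : a 0 = coeff θ₀) {θ : ℝ → Torus d → ℝ} {u : ℝ → Torus d → Fin d → ℝ}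
    (hw : IsWeakSolution τ T f θ₀ θ u) (hθ : MemLinftySobolev T s θ) :
    ∀ᵐ t ∂(volume.restrict (Ioo 0 T)), θ t =ᵐ[volume] series (a t) := by
  obtain ⟨-, C, hC⟩ := hθ
  have hc := isAdvectionKernel_advectionKernel hμ
  obtain ⟨b, hb, hb0, hba⟩ := exists_isFourierSolution_of_ae hc hs hT (R := C) C.2
    (b := fun t => coeff (θ t)) (b₀ := coeff θ₀) (S := coeff f)
    (q := fun t => weakRate f (θ t) (u t)) (integrableOn_weakRate hw)
    (fun t => isRealSeq_coeff _) (hC.mono fun t h => HsBound.of_sobolevNorm_le h.2)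
    (by
      filter_upwards [hC, hw.velocity] with t h1 h2 k
      exact weakRate_eq hμ h1.1.integrable
        ((HsBound.of_sobolevNorm_le h1.2).summable_bracket hs C.2) h2 k)
    (coeff_eq_add_integral hT hw hf hθ₀)
  -- Uniqueness compares solutions with a common bound, so both are relaxed to the larger one.
  have huniq := (hb.mono (R' := max C R) C.2 (le_max_left _ _)).unique hc hs
    (le_max_of_le_right hR) (ha.mono hR (le_max_right _ _)) (hb0.trans ha0.symm)
  filter_upwards [hC, hba, ae_restrict_mem measurableSet_Ioo] with t h1 h2 ht
  have hat := Ioo_subset_Icc_self ht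
  exact ae_eq_series h1.1.integrable ((ha.bound t hat).summable_norm hs hR)
    (h2.trans (huniq t hat))

end Uniqueness

/-! ### Existence -/

section Existence

variable {d : ℕ} {s M R T : ℝ} {S : (Fin d → ℤ) → ℂ} {a : ℝ → (Fin d → ℤ) → ℂ}

lemma coeff_zero_eq_zero_iff {f : Torus d → ℝ} : coeff f 0 = 0 ↔ ∫ x, f x = 0 := by
  have : ((2 * Real.pi) ^ d : ℝ) ≠ 0 := by positivity
  rw [coeff_zero_eq, Complex.ofReal_eq_zero, mul_eq_zero, inv_eq_zero, or_iff_right this]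

/-- In conservative form the kernel carries the derivative symbol at the output frequency, which is
zero at `k = 0`: transport does not change the mean, and the source has none. -/
lemma IsFourierSolution.apply_zero {μ : Fin d → (Fin d → ℤ) → ℂ} (hμ : IsVelocitySymbol M μ)
    (ha : IsFourierSolution (advectionKernel μ) s R T S a) (hS : S 0 = 0) (h0 : a 0 0 = 0) :
    ∀ t ∈ Icc 0 T, a t 0 = 0 := fun t ht => by
  have hadv : ∀ b : (Fin d → ℤ) → ℂ, advect (advectionKernel μ) b b 0 = 0 := fun b => by
    have : ∀ l, advectionKernel μ 0 l = 0 := fun l => by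
      rw [advectionKernel_eq hμ]
      simp [derivSymbol]
    simp [advect, this]
  have hd : ∀ r ∈ Icc 0 T, HasDerivWithinAt (fun r => a r 0) 0 (Icc 0 T) r := fun r hr => by
    have := ha.deriv r hr 0
    rwa [hadv, hS, neg_zero, zero_add] at this
  have h := sub_eq_integral_of_hasDerivWithinAt hd continuousOn_const ht
  rw [intervalIntegral.integral_zero, h0, sub_zero] at h
  exact h.symm

variable {τ : Fin d → Fin d → (Fin d → ℤ) → ℂ} {f θ₀ : Torus d → ℝ}

lemma IsBoundedPath.isVelocity (ha : IsBoundedPath s R a) (hs : (d : ℝ) / 2 + 1 < s)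
    (hμ : IsVelocitySymbol M (velocitySymbol τ)) (t : ℝ) :
    IsVelocity τ (series (a t)) fun x j => series (velCoeff (velocitySymbol τ) j (a t)) x :=
  fun j => by
    have hsum := summable_norm_of_bracket (ha.summable hs t)
    have hvel := summable_norm_of_bracket (summable_bracket_velCoeff hμ j (ha.summable hs t))
    refine ⟨integrable_of_continuous (continuous_series hsum),
      integrable_of_continuous (continuous_series hvel), fun k => ?_⟩
    exact (congrFun (coeff_series hvel (isRealSeq_velCoeff hμ j (ha.real t))) k).trans
      (by rw [coeff_series hsum (ha.real t), velCoeff])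

lemma IsBoundedPath.isWeakSolution (ha : IsBoundedPath s R a) (hs : (d : ℝ) / 2 + 1 < s)
    (hT : 0 < T) (hμ : IsVelocitySymbol M (velocitySymbol τ))
    (hsol : IsFourierSolution (advectionKernel (velocitySymbol τ)) s R T S a)
    (hS : Summable fun k => ‖S k‖) (hrS : IsRealSeq S) (hf : f =ᵐ[volume] series S)
    (hθ₀ : θ₀ =ᵐ[volume] series (a 0)) :
    IsWeakSolution τ T f θ₀ (fun t => series (a t))
      fun t x j => series (velCoeff (velocitySymbol τ) j (a t)) x where
  integrable_scalar := integrable_prod_of_continuous (ha.continuous_scalar hs) Ioo_subset_Icc_self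
  integrable_velocity j :=
    integrable_prod_of_continuous (ha.continuous_velocity hs hμ j) Ioo_subset_Icc_self
  integrable_flux j := integrable_prod_of_continuous
    ((ha.continuous_velocity hs hμ j).mul (ha.continuous_scalar hs)) Ioo_subset_Icc_self
  velocity := ae_of_all _ (ha.isVelocity hs hμ)
  weak_eq _ hφ := weak_eq_of_isFourierSolution hμ hs hT ha hsol hS hrS hf hθ₀ hφ

lemma IsBoundedPath.isClassicalSolution (ha : IsBoundedPath s R a) (hs : (d : ℝ) / 2 + 1 < s)
    (hT : 0 < T) (hμ : IsVelocitySymbol M (velocitySymbol τ))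
    (hsol : IsFourierSolution (advectionKernel (velocitySymbol τ)) s R T S a)
    (hS : Summable fun k => ‖S k‖) (hrS : IsRealSeq S) (hf : f =ᵐ[volume] series S)
    (hθ₀ : θ₀ =ᵐ[volume] series (a 0)) :
    IsClassicalSolution τ T f θ₀ (fun t => series (a t))
      fun t x j => series (velCoeff (velocitySymbol τ) j (a t)) x where
  contDiffOn_scalar := contDiffOn_series hμ hs hT ha hsol hS hrS
  continuousOn_velocity :=
    (continuous_pi fun j => ha.continuous_velocity hs hμ j).continuousOn
  velocity t _ := ha.isVelocity hs hμ t
  equation t ht := by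
    filter_upwards [hf] with x hx
    rw [(hasDerivWithinAt_series_time hμ hs ha hsol hS hrS ht x).derivWithin
      (uniqueDiffOn_Icc hT t ht), hx]
    simp_rw [fun j => (hasPartialAt_series (ha.summable hs t) j x).partialDeriv_eq]
    rw [timeDeriv, sub_add_cancel]
  initial := hθ₀.symm

lemma IsBoundedPath.memLinftySobolev (ha : IsBoundedPath s R a) (hs : (d : ℝ) / 2 + 1 < s)
    (T : ℝ) : MemLinftySobolev T s fun t => series (a t) := by
  lift R to ℝ≥0 using ha.nonneg
  refine ⟨(ha.continuous_scalar hs).aestronglyMeasurable, R, ae_of_all _ fun t => ?_⟩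
  have hsum := summable_norm_of_bracket (ha.summable hs t)
  have hle : sobolevNorm s (series (a t)) ≤ R := HsBound.sobolevNorm_le (by rw [coeff_series hsum (ha.real t)]; exact ha.bound t)
  exact ⟨⟨(continuous_series hsum).memLp_of_hasCompactSupport
    (HasCompactSupport.of_compactSpace _), hle.trans_lt ENNReal.coe_lt_top⟩, hle⟩

end Existence
end ActiveScalar

end

/-! ### Assembly of existence, regularity and uniqueness -/

theorem theorem2p4 (d : ℕ) (hd : 2 ≤ d) (s : ℝ) (hs : (d : ℝ) / 2 + 1 < s)
    (τ : Fin d → Fin d → (Fin d → ℤ) → ℂ)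
    (hA1 : ActiveScalar.AssumptionA1 τ)
    (hA2 : ActiveScalar.AssumptionA2 τ)
    (hA52 : ActiveScalar.AssumptionA52 τ)
    (θ₀ S : ActiveScalar.Torus d → ℝ)
    (hθ₀ : ActiveScalar.MemSobolev s θ₀) (hθ₀_mean : ∫ x, θ₀ x = 0)
    (hS : ActiveScalar.MemSobolev s S) (hS_mean : ∫ x, S x = 0) :
    ∃ T : ℝ, 0 < T ∧
      ∃ (θ : ℝ → ActiveScalar.Torus d → ℝ) (u : ℝ → ActiveScalar.Torus d → Fin d → ℝ),
        ActiveScalar.IsWeakSolution τ T S θ₀ θ u ∧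
        ActiveScalar.IsClassicalSolution τ T S θ₀ θ u ∧
        ActiveScalar.MemLinftySobolev T s θ ∧
        (∀ t ∈ Set.Icc 0 T, ∫ x, θ t x = 0) ∧
        ∀ (θ' : ℝ → ActiveScalar.Torus d → ℝ) (u' : ℝ → ActiveScalar.Torus d → Fin d → ℝ),
          ActiveScalar.IsWeakSolution τ T S θ₀ θ' u' →
          ActiveScalar.MemLinftySobolev T s θ' →
          ∀ᵐ t ∂(MeasureTheory.volume.restrict (Set.Ioo 0 T)),
            θ' t =ᵐ[MeasureTheory.volume] θ t := by
  open ActiveScalar in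
  obtain ⟨M, hμ⟩ := isVelocitySymbol_velocitySymbol hA1 hA2 hA52
  obtain ⟨C₁, hC₁⟩ := hθ₀.exists_hsBound
  obtain ⟨C₂, hC₂⟩ := hS.exists_hsBound
  have hc := isAdvectionKernel_advectionKernel hμ
  obtain ⟨T, hT, R, hR, a', ha', ha'0⟩ := exists_isFourierSolution hc hs
    (isRealSeq_coeff θ₀) (isRealSeq_coeff S) (R₀ := max C₁ C₂) (le_max_of_le_left C₁.2)
    (hC₁.mono C₁.2 (le_max_left _ _)) (hC₂.mono C₂.2 (le_max_right _ _))
  -- From here on the path is defined and bounded for all real times.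
  obtain ⟨a, hpath, ha, ha0⟩ := ha'.exists_clamp hT.le hR
  rw [ha'0] at ha0
  have hSsum := hC₂.summable_norm hs C₂.2
  have hSs := ae_eq_series hS.integrable hSsum rfl
  have hθs : θ₀ =ᵐ[volume] series (a 0) := by
    rw [ha0]
    exact ae_eq_series hθ₀.integrable (hC₁.summable_norm hs C₁.2) rfl
  have hrS := isRealSeq_coeff S
  refine ⟨T, hT, _, _, hpath.isWeakSolution hs hT hμ ha hSsum hrS hSs hθs,
    hpath.isClassicalSolution hs hT hμ ha hSsum hrS hSs hθs, hpath.memLinftySobolev hs T,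
    fun t ht => ?_, fun θ' u' hw hθ' => ?_⟩
  · rw [← coeff_zero_eq_zero_iff, coeff_series
      (summable_norm_of_bracket (hpath.summable hs t)) (hpath.real t)]
    exact ha.apply_zero hμ (coeff_zero_eq_zero_iff.2 hS_mean)
      (by rw [ha0, coeff_zero_eq_zero_iff.2 hθ₀_mean]) t ht
  · exact ae_eq_series_of_isWeakSolution hμ hs hT hR hS.integrable hθ₀.integrable ha ha0 hw hθ'
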